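/- Let $f_1,f_2:\mathbb R^2\to(0,+\infty)$ be Lipschitz continuous and $Q$-periodic, where $Q=(0,1)\times(0,1)$, with $f_1<f_2$ everywhere, and let $\omega\subset\mathbb R^2$ be a bounded open set with Lipschitz boundary. Write $x=(x',x_3)\in\mathbb R^2\times\mathbb R$ and, for $\varepsilon>0$, let $$V_\varepsilon=\Bigl\{(x',x_3):\ x'\in\omega,\ \varepsilon f_1\bigl(\tfrac{x'}{\varepsilon}\bigr)<x_3<\varepsilon f_2\bigl(\tfrac{x'}{\varepsilon}\bigr)\Bigr\}.$$ Let $\dot H^1(\mathbb R^3)$ be the completion of $C_c^\infty(\mathbb R^3)$ with respect to the norm $\|\nabla u\|_{L^2(\mathbb R^3)}$. Put $n_i=(-\nabla f_i,1)$ for $i=1,2$ and $\mathbf e_3=(0,0,1)$, and for $f,g\in\{f_1,f_2\}$ with $n_f=(-\nabla f,1)$, $n_g=(-\nabla g,1)$ let $$S(f,g)=\int_Q\int_{\mathbb R^2}\Biggl(\frac{n_f(x')\otimes n_g(z'+x')}{\sqrt{|z'|^2+|g(z'+x')-f(x')|^2}}-\frac{n_f(x')\otimes n_g(z'+x')}{\sqrt{|z'|^2+1}}\Biggr)dz'\,dx'.$$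 Define the constant $3\times3$ matrix $$A_{\mathrm{hom}}=\frac1{4\pi}S(f_1,f_1)+\frac1{4\pi}S(f_2,f_2)-\frac1{2\pi}S(f_1,f_2)$$ $$\qquad+\frac1{4\pi}\int_Q\int_{\mathbb R^2}\Biggl(\frac{I-\mathbf e_3\otimes\mathbf e_3}{(|z'|^2+1)^{3/2}}-\frac{3(z',0)\otimes(z',0)}{(|z'|^2+1)^{5/2}}\Biggr)(f_2-f_1)(z'+x')\,(f_2-f_1)(x')\,dz'\,dx'.$$ Let $m_0\in H^1(\omega;\mathbb R^3)$ with $|m_0|=1$ almost everywhere in $\omega$, and for every $\varepsilon>0$ let $\overline M_\varepsilon\in H^1(\omega;\mathbb R^3)$ with $|\overline M_\varepsilon|\le1$ almost everywhere in $\omega$, such that $\overline M_\varepsilon\rightharpoonup m_0$ weakly in $H^1(\omega;\mathbb R^3)$ as $\varepsilon\to0^+$. For every $\varepsilon>0$ let $\bar u_\varepsilon\in\dot H^1(\mathbb R^3)$ solve $$\Delta\bar u_\varepsilon=\operatorname{div}\bigl(\overline M_\varepsilon\,\chi_{V_\varepsilon}\bigr)\quad\text{in }\mathbb R^3$$ in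 the sense of distributions, where $\overline M_\varepsilon$ is regarded as the function $(x',x_3)\mapsto\overline M_\varepsilon(x')$ on $V_\varepsilon$. Then $$\frac1\varepsilon\int_{\mathbb R^3}|\nabla\bar u_\varepsilon|^2\,dx\ \longrightarrow\ \int_\omega A_{\mathrm{hom}}\,m_0\cdot m_0\,dx'\qquad\text{as }\varepsilon\to0^+.$$ -/

import Mathlib

noncomputable section

namespace ThinFilm

open MeasureTheory Filter Topology

/-- The plane, with its Euclidean norm and Lebesgue measure. -/
abbrev E2 : Type := EuclideanSpace ℝ (Fin 2)

/-- Three-dimensional space, with its Euclidean norm and Lebesgue measure. -/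
abbrev E3 : Type := EuclideanSpace ℝ (Fin 3)

/-- The horizontal part `x' = (x₁, x₂)` of a point `x = (x', x₃)`. -/
def horiz (x : E3) : E2 := !₂[x 0, x 1]

/-- The open unit cell `Q = (0,1) × (0,1)`. -/
def cellQ : Set E2 := {x | ∀ i, 0 < x i ∧ x i < 1}

/-- `Q`-periodicity: period one in each of the two coordinate directions. -/
def QPeriodic (f : E2 → ℝ) : Prop :=
  ∀ (x : E2) (i : Fin 2), f (x + EuclideanSpace.single i 1) = f x

/-- Lipschitz boundary: near each boundary point, in suitable Cartesian coordinates centred at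
that point, the set is the strict subgraph of a Lipschitz function of one variable. -/
def HasLipschitzBoundary (ω : Set E2) : Prop :=
  ∀ p ∈ frontier ω, ∃ (R : E2 ≃ₗᵢ[ℝ] E2) (γ : ℝ → ℝ) (K : NNReal) (r : ℝ),
    0 < r ∧ LipschitzWith K γ ∧
      ∀ x ∈ Metric.ball p r, (x ∈ ω ↔ (R (x - p)) 1 < γ ((R (x - p)) 0))

/-- The thin film `V_ε`. -/
def film (ω : Set E2) (f₁ f₂ : E2 → ℝ) (ε : ℝ) : Set E3 :=
  {x | horiz x ∈ ω ∧ ε * f₁ (ε⁻¹ • horiz x) < x 2 ∧ x 2 < ε * f₂ (ε⁻¹ • horiz x)}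

/-- The test functions `C_c^∞(U)`, extended by zero. -/
structure IsTestFunction {E : Type*} [NormedAddCommGroup E] [NormedSpace ℝ E]
    (U : Set E) (φ : E → ℝ) : Prop where
  smooth : ContDiff ℝ ((⊤ : ℕ∞) : WithTop ℕ∞) φ
  compact : HasCompactSupport φ
  support : tsupport φ ⊆ U

/-- `m ∈ H¹(ω; ℝ³)`, with weak partial derivatives `Dm 0` and `Dm 1`. -/
structure IsH1 (ω : Set E2) (m : E2 → E3) (Dm : Fin 2 → E2 → E3) : Prop where
  memLp : MemLp m 2 (volume.restrict ω)
  memLp_deriv : ∀ i, MemLp (Dm i) 2 (volume.restrict ω)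
  weak_deriv : ∀ (φ : E2 → ℝ), IsTestFunction ω φ → ∀ i,
    ∫ x in ω, (gradient φ x) i • m x = - ∫ x in ω, φ x • Dm i x

/-- The inner product of `H¹(ω; ℝ³)`, in terms of functions and their weak derivatives. -/
def h1Inner (ω : Set E2) (m : E2 → E3) (Dm : Fin 2 → E2 → E3)
    (h : E2 → E3) (Dh : Fin 2 → E2 → E3) : ℝ :=
  (∫ x in ω, inner ℝ (m x) (h x)) + ∑ i, ∫ x in ω, inner ℝ (Dm i x) (Dh i x)

/-- Weak convergence `M_ε ⇀ m₀` in the Hilbert space `H¹(ω; ℝ³)` as `ε → 0⁺`: convergence of the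
inner products with every element of the space. -/
def WeakConvH1 (ω : Set E2) (M : ℝ → E2 → E3) (DM : ℝ → Fin 2 → E2 → E3)
    (m₀ : E2 → E3) (Dm₀ : Fin 2 → E2 → E3) : Prop :=
  ∀ (h : E2 → E3) (Dh : Fin 2 → E2 → E3), IsH1 ω h Dh →
    Tendsto (fun ε => h1Inner ω (M ε) (DM ε) h Dh) (𝓝[>] 0) (𝓝 (h1Inner ω m₀ Dm₀ h Dh))

/-- `u` belongs to the homogeneous Sobolev space `Ḣ¹(ℝ³)`, the completion of `C_c^∞(ℝ³)` for the
norm `‖∇φ‖_{L²}`, and `Du` is its gradient. By the Sobolev inequality a sequence of test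
functions that is Cauchy for this norm converges in `L⁶(ℝ³)`; the element of the completion that
it represents is identified with its `L⁶` limit, and the gradient is the `L²` limit of the
gradients. -/
structure IsHomH1 (u : E3 → ℝ) (Du : E3 → E3) : Prop where
  memLp : MemLp u 6 volume
  memLp_grad : MemLp Du 2 volume
  approx : ∃ φ : ℕ → E3 → ℝ, (∀ n, IsTestFunction Set.univ (φ n)) ∧
    Tendsto (fun n => eLpNorm (φ n - u) 6 volume) atTop (𝓝 0) ∧
    Tendsto (fun n => eLpNorm (gradient (φ n) - Du) 2 volume) atTop (𝓝 0)

/-- `u ∈ Ḣ¹(ℝ³)`, with gradient `Du`, solves `Δu = div (M χ_V)` in the sense of distributions on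
`ℝ³`. -/
structure SolvesMagnetostatic (V : Set E3) (M : E3 → E3) (u : E3 → ℝ) (Du : E3 → E3) : Prop where
  isHomH1 : IsHomH1 u Du
  equation : ∀ (φ : E3 → ℝ), IsTestFunction Set.univ φ →
    ∫ x, inner ℝ (Du x) (gradient φ x) = ∫ x in V, inner ℝ (M x) (gradient φ x)

/-- The (not normalized) normal `n(x') = (-∇f(x'), 1)`; for Lipschitz `f` the gradient exists
almost everywhere. -/
def normalVec (f : E2 → ℝ) (x : E2) : E3 := !₂[-(gradient f x) 0, -(gradient f x) 1, 1]

/-- The vector `(z', 0)`. -/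
def flatVec (z : E2) : E3 := !₂[z 0, z 1, 0]

/-- The matrix
`∫_Q ∫_{ℝ²} ( n_f(x') ⊗ n_g(z'+x') / √(|z'|² + |g(z'+x') - f(x')|²)
  - n_f(x') ⊗ n_g(z'+x') / √(|z'|² + 1) ) dz' dx'`, where `n_f = (-∇f, 1)`. -/
def surfaceMatrix (f g : E2 → ℝ) : Matrix (Fin 3) (Fin 3) ℝ :=
  Matrix.of fun i j => ∫ x in cellQ, ∫ z : E2,
    (normalVec f x i * normalVec g (z + x) j / √(‖z‖ ^ 2 + |g (z + x) - f x| ^ 2)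
      - normalVec f x i * normalVec g (z + x) j / √(‖z‖ ^ 2 + 1))

/-- The matrix
`∫_Q ∫_{ℝ²} ( (I - e₃ ⊗ e₃) / (|z'|² + 1)^{3/2} - 3 (z',0) ⊗ (z',0) / (|z'|² + 1)^{5/2} )
  (f₂(z'+x') - f₁(z'+x')) (f₂(x') - f₁(x')) dz' dx'`. -/
def dipoleMatrix (f₁ f₂ : E2 → ℝ) : Matrix (Fin 3) (Fin 3) ℝ :=
  Matrix.of fun i j => ∫ x in cellQ, ∫ z : E2,
    ((1 - Matrix.single 2 2 1 : Matrix (Fin 3) (Fin 3) ℝ) i j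
          / (‖z‖ ^ 2 + 1) ^ (3 / 2 : ℝ)
        - 3 * (flatVec z i * flatVec z j) / (‖z‖ ^ 2 + 1) ^ (5 / 2 : ℝ))
      * ((f₂ (z + x) - f₁ (z + x)) * (f₂ x - f₁ x))

/-- The homogenized matrix `A_hom`. -/
def Ahom (f₁ f₂ : E2 → ℝ) : Matrix (Fin 3) (Fin 3) ℝ :=
  (1 / (4 * Real.pi)) • surfaceMatrix f₁ f₁ + (1 / (4 * Real.pi)) • surfaceMatrix f₂ f₂
    - (1 / (2 * Real.pi)) • surfaceMatrix f₁ f₂ + (1 / (4 * Real.pi)) • dipoleMatrix f₁ f₂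

end ThinFilm

end

noncomputable section

namespace ThinFilm

open MeasureTheory Filter Topology

/-! Let `F` be the magnetization extended by zero outside the film, and let `D = ∇u`. The equation
says that `D` is the `L²` projection of `F` on gradient fields, so the energy is `∫ D · F = r(0)`,
where `r(z) = ∫ D(x) · F(x + z) dx`. Instead of writing `u` with the Newton kernel, the proof
spreads that kernel over gaussian widths. The normalized gaussian `N_s = (s/π)^{3/2} exp(-s|z|²)`
satisfies `∂_s N_s = w(s) (-Δ exp(-s|z|²))` with `w(s) = 1/(4 π^{3/2} √s)`. Integrating `w(s) ∫ (-Δ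
exp(-s|z|²)) r(z) dz` over `a < s < b` therefore gives `∫ N_b r - ∫ N_a r`. Since `D` is curl-free
and `D - F` is divergence-free, `-Δ` tested against `r` equals `-∂ᵢ∂ⱼ` tested against the
correlations of `F` alone (`IsGradProj.integral_gaussNegLap_mul_crossCorr`), and the potential
disappears.

Two errors remain (`IsGradProj.abs_energy_sub_le`). The difference `r(0) - ∫ N_b r` is controlled by
the `L²` modulus of continuity of `F`. The term `∫ N_a r` is small because `F` lives in a thin
strip. The substitution `z ↦ εz`, `s ↦ s/ε²` leaves the gaussian form unchanged and makes both
bounds, divided by `ε`, converge for fixed `a` and `b`.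

For fixed `a` and `b` the limit in `ε` is dominated convergence: `ε⁻¹` times the correlation at `εz`
tends to `∫ m₀ᵢ m₀ⱼ` times the correlation of the periodic cell (`BoundedConv.tendsto_corr`). This
uses averaging of rapidly oscillating periodic functions and strong convergence of the fields.
Strong convergence follows from weak convergence because `|M_ε| ≤ 1 = |m₀|` gives `|M_ε - m₀|² ≤
2(|m₀|² - M_ε · m₀)`.

It remains to identify the cell integral. Vertical integration turns the overlap length into second
antiderivatives at differences of surface heights, and horizontal integration by parts produces the
normals (`cell_formula`). The constant `exp(-s)` is subtracted from the vertical profile so that the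
integral over small `s` converges; after integration it becomes the term with `√(|z'|² + 1)`. The
subtraction costs nothing in the entries with a vertical index and leaves the dipole term in the
horizontal ones. Integration in `s` uses `∫₀^∞ w(s) exp(-s r²) ds = 1/(4πr)` and its analogues with
`s` and `s²`. The result is the symmetrization of `Ahom` in its `S(f₁, f₂)` part, which has the same
contraction with the symmetric Gram matrix of `m₀`. -/

/-! ### Smooth cutoffs and gaussian domination -/

section Cutoff

variable {E : Type*} [NormedAddCommGroup E] [InnerProductSpace ℝ E] [FiniteDimensional ℝ E]

/-- Smooth cutoffs that exhaust the space, with uniformly bounded derivatives. -/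
theorem exists_smooth_cutoff (E : Type*) [NormedAddCommGroup E] [InnerProductSpace ℝ E]
    [FiniteDimensional ℝ E] :
    ∃ (C : ℝ) (η : ℕ → E → ℝ), (∀ n, ContDiff ℝ ((⊤ : ℕ∞) : WithTop ℕ∞) (η n)) ∧
      (∀ n, HasCompactSupport (η n)) ∧ (∀ n x, |η n x| ≤ 1) ∧
      (∀ n x, ‖fderiv ℝ (η n) x‖ ≤ C) ∧ (∀ x, ∀ᶠ n in atTop, η n =ᶠ[𝓝 x] fun _ => 1) := by
  let b : ContDiffBump (0 : E) := ⟨1, 2, one_pos, one_lt_two⟩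
  have hbs : ContDiff ℝ ((⊤ : ℕ∞) : WithTop ℕ∞) b := b.contDiff
  obtain ⟨C, hC⟩ : ∃ C, ∀ x, ‖fderiv ℝ b x‖ ≤ C :=
    (b.hasCompactSupport.fderiv (𝕜 := ℝ)).exists_bound_of_continuous
      (hbs.continuous_fderiv (by simp))
  have hC0 : 0 ≤ C := (norm_nonneg _).trans (hC 0)
  -- One bump is dilated by `n + 1`. The factor `(n + 1)⁻¹ ≤ 1` only shrinks the derivative, so the
  -- bound for the undilated bump serves every `n`.
  refine ⟨C, fun n x => b (((n : ℝ) + 1)⁻¹ • x), fun n => hbs.comp (contDiff_const_smul _), fun n => ?_,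
    fun n x => ?_, fun n x => ?_, fun x => ?_⟩
  · exact b.hasCompactSupport.comp_smul (by positivity)
  · rw [abs_of_nonneg b.nonneg]; exact b.le_one
  · have hn : (0 : ℝ) < (n : ℝ) + 1 := by positivity
    rw [fderiv_comp_smul, norm_smul, norm_inv, Real.norm_of_nonneg hn.le]
    have h1 : ((n : ℝ) + 1)⁻¹ ≤ 1 := inv_le_one_of_one_le₀ (by linarith [n.cast_nonneg (α := ℝ)])
    calc ((n : ℝ) + 1)⁻¹ * ‖fderiv ℝ b (((n : ℝ) + 1)⁻¹ • x)‖ ≤ 1 * C := by gcongr; exact hC _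
      _ = C := one_mul C
  · obtain ⟨k, hk⟩ := exists_nat_gt ‖x‖
    filter_upwards [eventually_ge_atTop k] with n hn
    have hlt : ‖x‖ < (n : ℝ) + 1 := by
      have : (k : ℝ) ≤ n := by exact_mod_cast hn
      linarith
    have : ∀ᶠ y in 𝓝 x, ‖y‖ < (n : ℝ) + 1 := continuous_norm.continuousAt.eventually_lt_const hlt
    filter_upwards [this] with y hy
    apply b.one_of_mem_closedBall
    have hn : (0 : ℝ) < (n : ℝ) + 1 := by positivity
    rw [mem_closedBall_zero_iff, norm_smul, norm_inv, Real.norm_of_nonneg hn.le]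
    exact (inv_mul_le_one₀ hn).2 hy.le

/-- Polynomial growth is absorbed by a gaussian. -/
theorem one_add_sq_pow_mul_exp_le {s : ℝ} (hs : 0 < s) (k : ℕ) :
    ∃ A : ℝ, 0 ≤ A ∧ ∀ t : ℝ,
      (1 + t ^ 2) ^ k * Real.exp (-s * t ^ 2) ≤ A * Real.exp (-(s / 2) * t ^ 2) := by
  -- The constant comes from `y ^ k / k! ≤ exp y` at `y = (s / 2)(1 + t²)`, which spends half of the
  -- gaussian decay.
  refine ⟨(k.factorial : ℝ) / (s / 2) ^ k * Real.exp (s / 2), by positivity, fun t => ?_⟩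
  have h := Real.pow_div_factorial_le_exp (s / 2 * (1 + t ^ 2)) (by positivity) k
  rw [mul_pow, div_le_iff₀ (by positivity)] at h
  have h2 : (1 + t ^ 2) ^ k
      ≤ (k.factorial : ℝ) / (s / 2) ^ k * Real.exp (s / 2 * (1 + t ^ 2)) := by
    rw [div_mul_eq_mul_div, le_div_iff₀ (by positivity)]
    linarith
  calc (1 + t ^ 2) ^ k * Real.exp (-s * t ^ 2)
      ≤ ((k.factorial : ℝ) / (s / 2) ^ k * Real.exp (s / 2 * (1 + t ^ 2)))
          * Real.exp (-s * t ^ 2) := by gcongr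
    _ = _ := by
      rw [mul_assoc, mul_assoc, ← Real.exp_add, ← Real.exp_add]
      congr 2; ring

variable [MeasurableSpace E] [BorelSpace E]

/-- A non-integrable function has integral zero by convention, whereas the known value of this
gaussian integral is positive. -/
theorem integrable_exp_neg_mul_norm_sq {s : ℝ} (hs : 0 < s) :
    Integrable fun x : E => Real.exp (-s * ‖x‖ ^ 2) := by
  by_contra h
  have h1 := GaussianFourier.integral_rexp_neg_mul_sq_norm (V := E) hs
  rw [integral_undef h] at h1
  have : 0 < (Real.pi / s) ^ ((Module.finrank ℝ E : ℝ) / 2) :=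
    Real.rpow_pos_of_pos (div_pos Real.pi_pos hs) _
  linarith

theorem integrable_of_gaussian_bound {h : E → ℝ} (hc : Continuous h) {A s : ℝ} {k : ℕ}
    (hs : 0 < s) (hb : ∀ x, |h x| ≤ A * ((1 + ‖x‖ ^ 2) ^ k * Real.exp (-s * ‖x‖ ^ 2))) :
    Integrable h := by
  obtain ⟨B, hB0, hB⟩ := one_add_sq_pow_mul_exp_le hs k
  have hA : 0 ≤ A := by
    have := (abs_nonneg _).trans (hb 0)
    simpa using this
  refine Integrable.mono' (((integrable_exp_neg_mul_norm_sq (E := E) (half_pos hs)).const_mul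
    B).const_mul A) hc.aestronglyMeasurable (Eventually.of_forall fun x => ?_)
  exact (hb x).trans (mul_le_mul_of_nonneg_left (hB _) hA)

theorem memLp_two_of_gaussian_bound {h : E → ℝ} (hc : Continuous h) {A s : ℝ} {k : ℕ}
    (hs : 0 < s) (hb : ∀ x, |h x| ≤ A * ((1 + ‖x‖ ^ 2) ^ k * Real.exp (-s * ‖x‖ ^ 2))) :
    MemLp h 2 := by
  rw [memLp_two_iff_integrable_sq hc.aestronglyMeasurable]
  refine integrable_of_gaussian_bound (A := A ^ 2) (s := 2 * s) (k := 2 * k) (hc.pow 2)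
    (by positivity) fun x => ?_
  rw [abs_pow]
  calc |h x| ^ 2 ≤ (A * ((1 + ‖x‖ ^ 2) ^ k * Real.exp (-s * ‖x‖ ^ 2))) ^ 2 := by
        gcongr; exact hb x
    _ = _ := by
      rw [mul_pow, mul_pow, ← pow_mul, mul_comm k 2, ← Real.exp_nat_mul]
      congr 3; push_cast; ring

end Cutoff

/-! ### Coordinates -/

theorem gradient_apply {n : ℕ} (φ : EuclideanSpace ℝ (Fin n) → ℝ) (x : EuclideanSpace ℝ (Fin n))
    (i : Fin n) : (gradient φ x) i = fderiv ℝ φ x (EuclideanSpace.single i 1) := by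
  have h : inner ℝ (gradient φ x) (EuclideanSpace.single i (1 : ℝ))
      = fderiv ℝ φ x (EuclideanSpace.single i 1) := by
    rw [gradient, InnerProductSpace.toDual_symm_apply]
  rw [← h, EuclideanSpace.inner_single_right]; simp

theorem norm_gradient {n : ℕ} (φ : EuclideanSpace ℝ (Fin n) → ℝ) (x : EuclideanSpace ℝ (Fin n)) :
    ‖gradient φ x‖ = ‖fderiv ℝ φ x‖ := by
  rw [gradient, LinearIsometryEquiv.norm_map]

theorem inner_eq_sum {n : ℕ} (x y : EuclideanSpace ℝ (Fin n)) : inner ℝ x y = ∑ i, x i * y i := by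
  simp [PiLp.inner_apply, mul_comm]

theorem abs_apply_le_norm {n : ℕ} (x : EuclideanSpace ℝ (Fin n)) (i : Fin n) : |x i| ≤ ‖x‖ :=
  PiLp.norm_apply_le x i

theorem abs_apply_le_one_add_sq {n : ℕ} (x : EuclideanSpace ℝ (Fin n)) (i : Fin n) :
    |x i| ≤ 1 + ‖x‖ ^ 2 := by
  have := abs_apply_le_norm x i
  nlinarith [sq_nonneg (‖x‖ - 1), norm_nonneg x]

theorem abs_apply_mul_apply_le {n : ℕ} (x : EuclideanSpace ℝ (Fin n)) (i j : Fin n) :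
    |x i * x j| ≤ ‖x‖ ^ 2 := by
  rw [abs_mul, sq]
  exact mul_le_mul (abs_apply_le_norm x i) (abs_apply_le_norm x j) (abs_nonneg _) (norm_nonneg _)

/-! ### The gaussian and its derivatives -/

theorem hasFDerivAt_mul_gaussian {n : ℕ} {p : EuclideanSpace ℝ (Fin n) → ℝ}
    {p' : EuclideanSpace ℝ (Fin n) →L[ℝ] ℝ}
    {w : EuclideanSpace ℝ (Fin n)} (hp : HasFDerivAt p p' w) (s : ℝ) :
    HasFDerivAt (fun x => p x * Real.exp (-s * ‖x‖ ^ 2))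
      (Real.exp (-s * ‖w‖ ^ 2) • (p' - (2 * s * p w) • innerSL ℝ w)) w := by
  have h1 : HasFDerivAt (fun x : EuclideanSpace ℝ (Fin n) => ‖x‖ ^ 2) (2 • innerSL ℝ w) w :=
    (hasStrictFDerivAt_norm_sq w).hasFDerivAt
  have h2 := (h1.const_mul (-s)).exp
  refine (hp.mul h2).congr_fderiv ?_
  ext v
  simp
  ring

/-- Minus the second derivatives of the gaussian `exp (-s |z|²)`. -/
def gaussHess {n : ℕ} (s : ℝ) (i j : Fin n) (z : EuclideanSpace ℝ (Fin n)) : ℝ :=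
  (2 * s * (if i = j then 1 else 0) - 4 * s ^ 2 * (z i * z j)) * Real.exp (-s * ‖z‖ ^ 2)

/-- The first derivatives of the gaussian `exp (-s |z|²)`. -/
def gaussGrad {n : ℕ} (s : ℝ) (j : Fin n) (z : EuclideanSpace ℝ (Fin n)) : ℝ :=
  (-2 * s * z j) * Real.exp (-s * ‖z‖ ^ 2)

theorem continuous_gaussHess {n : ℕ} (s : ℝ) (i j : Fin n) : Continuous (gaussHess s i j) := by
  unfold gaussHess; fun_prop

theorem contDiff_gaussGrad {n : ℕ} (s : ℝ) (j : Fin n) :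
    ContDiff ℝ ((⊤ : ℕ∞) : WithTop ℕ∞) (gaussGrad s j) := by
  unfold gaussGrad
  have h1 : ContDiff ℝ ((⊤ : ℕ∞) : WithTop ℕ∞) fun z : EuclideanSpace ℝ (Fin n) => ‖z‖ ^ 2 :=
    contDiff_norm_sq ℝ
  fun_prop

theorem abs_gaussHess_le {n : ℕ} {s a b : ℝ} (ha : 0 < a) (has : a ≤ s) (hsb : s ≤ b) (i j : Fin n)
    (z : EuclideanSpace ℝ (Fin n)) :
    |gaussHess s i j z|
      ≤ (2 * b + 4 * b ^ 2) * ((1 + ‖z‖ ^ 2) ^ 1 * Real.exp (-a * ‖z‖ ^ 2)) := by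
  have hs : 0 < s := ha.trans_le has
  unfold gaussHess
  rw [abs_mul, abs_of_pos (Real.exp_pos _), ← mul_assoc (2 * b + 4 * b ^ 2)]
  have h1 : |2 * s * (if i = j then (1 : ℝ) else 0)| ≤ 2 * b := by
    split_ifs <;> simp [abs_of_pos hs] <;> linarith
  have h2 := abs_apply_mul_apply_le z i j
  have h3 : |4 * s ^ 2 * (z i * z j)| ≤ 4 * b ^ 2 * ‖z‖ ^ 2 := by
    rw [abs_mul, abs_of_pos (by positivity : 0 < 4 * s ^ 2)]
    gcongr
  have h4 := abs_sub (2 * s * (if i = j then (1 : ℝ) else 0)) (4 * s ^ 2 * (z i * z j))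
  have hb : 0 < b := hs.trans_le hsb
  have h5 : 0 ≤ 2 * b * ‖z‖ ^ 2 := by positivity
  have h6 : 0 ≤ 4 * b ^ 2 := by positivity
  refine mul_le_mul ?_ ?_ (Real.exp_pos _).le (by positivity)
  · rw [pow_one]; linarith
  · gcongr

theorem integrable_gaussHess {n : ℕ} {s : ℝ} (hs : 0 < s) (i j : Fin n) :
    Integrable (gaussHess s i j) :=
  integrable_of_gaussian_bound (continuous_gaussHess s i j) hs
    (abs_gaussHess_le hs le_rfl le_rfl i j)

theorem memLp_gaussHess {n : ℕ} {s : ℝ} (hs : 0 < s) (i j : Fin n) :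
    MemLp (gaussHess s i j) 2 :=
  memLp_two_of_gaussian_bound (continuous_gaussHess s i j) hs
    (abs_gaussHess_le hs le_rfl le_rfl i j)

theorem abs_gaussGrad_le {n : ℕ} {s : ℝ} (hs : 0 < s) (j : Fin n) (z : EuclideanSpace ℝ (Fin n)) :
    |gaussGrad s j z| ≤ (2 * s) * ((1 + ‖z‖ ^ 2) ^ 1 * Real.exp (-s * ‖z‖ ^ 2)) := by
  unfold gaussGrad
  rw [abs_mul, abs_of_pos (Real.exp_pos _), ← mul_assoc, abs_mul, pow_one, abs_mul, abs_neg,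
    abs_two, abs_of_pos hs]
  gcongr
  exact abs_apply_le_one_add_sq z j

theorem memLp_gaussGrad {n : ℕ} {s : ℝ} (hs : 0 < s) (j : Fin n) : MemLp (gaussGrad s j) 2 :=
  memLp_two_of_gaussian_bound (contDiff_gaussGrad s j).continuous hs (abs_gaussGrad_le hs j)

theorem integrable_gaussGrad {n : ℕ} {s : ℝ} (hs : 0 < s) (j : Fin n) :
    Integrable (gaussGrad s j) :=
  integrable_of_gaussian_bound (contDiff_gaussGrad s j).continuous hs (abs_gaussGrad_le hs j)

theorem gaussHess_neg {n : ℕ} (s : ℝ) (i j : Fin n) (z : EuclideanSpace ℝ (Fin n)) :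
    gaussHess s i j (-z) = gaussHess s i j z := by
  simp [gaussHess]

theorem hasFDerivAt_apply {n : ℕ} (j : Fin n) (w : EuclideanSpace ℝ (Fin n)) :
    HasFDerivAt (fun x : EuclideanSpace ℝ (Fin n) => x j)
      (EuclideanSpace.proj j : EuclideanSpace ℝ (Fin n) →L[ℝ] ℝ) w :=
  (EuclideanSpace.proj j : EuclideanSpace ℝ (Fin n) →L[ℝ] ℝ).hasFDerivAt

theorem fderiv_gaussGrad {n : ℕ} (s : ℝ) (i j : Fin n) (w : EuclideanSpace ℝ (Fin n)) :
    fderiv ℝ (gaussGrad s j) w (EuclideanSpace.single i 1) = -gaussHess s i j w := by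
  have h := hasFDerivAt_mul_gaussian ((hasFDerivAt_apply j w).const_mul (-2 * s)) s
  have h' : HasFDerivAt (gaussGrad s j) _ w := h
  rw [h'.fderiv]
  simp [gaussHess, EuclideanSpace.inner_single_right]
  by_cases hij : i = j
  · subst hij; simp; ring
  · have : ¬ j = i := fun h => hij h.symm
    simp [hij, this]; ring

theorem fderiv_gaussHess {n : ℕ} (s : ℝ) (i j k : Fin n) (w : EuclideanSpace ℝ (Fin n)) :
    fderiv ℝ (gaussHess s i j) w (EuclideanSpace.single k 1)
      = Real.exp (-s * ‖w‖ ^ 2) *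
        (- 4 * s ^ 2 * ((if i = k then 1 else 0) * w j + w i * (if j = k then 1 else 0))
          - 2 * s * w k * (2 * s * (if i = j then 1 else 0) - 4 * s ^ 2 * (w i * w j))) := by
  have h := hasFDerivAt_mul_gaussian
    ((((hasFDerivAt_apply i w).mul (hasFDerivAt_apply j w)).const_mul (4 * s ^ 2)).const_sub
      (2 * s * (if i = j then (1 : ℝ) else 0))) s
  have h' : HasFDerivAt (gaussHess s i j) _ w := h
  rw [h'.fderiv]
  simp [EuclideanSpace.inner_single_right]
  split_ifs <;> ring

theorem differentiable_gaussHess {n : ℕ} (s : ℝ) (i j : Fin n) :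
    Differentiable ℝ (gaussHess s i j) := fun w =>
  (hasFDerivAt_mul_gaussian
    ((((hasFDerivAt_apply i w).mul (hasFDerivAt_apply j w)).const_mul (4 * s ^ 2)).const_sub
      (2 * s * (if i = j then (1 : ℝ) else 0))) s).differentiableAt

/-- Minus the laplacian of the gaussian. -/
def gaussNegLap (s : ℝ) (z : E3) : ℝ := ∑ i, gaussHess s i i z

theorem gaussNegLap_eq (s : ℝ) (z : E3) :
    gaussNegLap s z = (6 * s - 4 * s ^ 2 * ‖z‖ ^ 2) * Real.exp (-s * ‖z‖ ^ 2) := by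
  have h : ‖z‖ ^ 2 = z 0 * z 0 + z 1 * z 1 + z 2 * z 2 := by
    rw [EuclideanSpace.real_norm_sq_eq, Fin.sum_univ_three]; ring
  simp only [gaussNegLap, Fin.sum_univ_three, gaussHess, if_true]
  rw [h]; ring

/-- The gradient of the divergence of a gaussian: `∑ ∂ᵢ∂ᵢ∂ⱼ g = ∂ⱼ Δ g`. -/
theorem sum_fderiv_gaussHess (s : ℝ) (j : Fin 3) (w : E3) :
    ∑ i, fderiv ℝ (gaussHess s i j) w (EuclideanSpace.single i 1)
      = ∑ i, fderiv ℝ (gaussHess s i i) w (EuclideanSpace.single j 1) := by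
  simp only [fderiv_gaussHess, Fin.sum_univ_three]
  fin_cases j <;> simp <;> ring

/-! ### Splitting off the vertical coordinate -/

/-- The point `(x', t)` of three-dimensional space. -/
def lift3 (x : E2) (t : ℝ) : E3 := !₂[x 0, x 1, t]

@[simp] theorem horiz_lift3 (x : E2) (t : ℝ) : horiz (lift3 x t) = x := by
  ext i; fin_cases i <;> simp [horiz, lift3]

@[simp] theorem lift3_two (x : E2) (t : ℝ) : lift3 x t 2 = t := by simp [lift3]

@[simp] theorem horiz_apply_zero (x : E3) : horiz x 0 = x 0 := by simp [horiz]

@[simp] theorem horiz_apply_one (x : E3) : horiz x 1 = x 1 := by simp [horiz]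

theorem norm_lift3_sq (x : E2) (t : ℝ) : ‖lift3 x t‖ ^ 2 = ‖x‖ ^ 2 + t ^ 2 := by
  rw [EuclideanSpace.real_norm_sq_eq, EuclideanSpace.real_norm_sq_eq, Fin.sum_univ_three,
    Fin.sum_univ_two]
  simp [lift3]

theorem continuous_horiz : Continuous horiz := by
  refine (PiLp.continuous_toLp 2 (fun _ : Fin 2 => ℝ)).comp ?_
  refine continuous_pi fun i => ?_
  fin_cases i <;> simp <;> fun_prop

/-- `ℝ³ = ℝ² × ℝ` as measurable spaces. -/
def splitEquiv : E3 ≃ᵐ E2 × ℝ :=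
  ((MeasurableEquiv.toLp 2 (Fin 3 → ℝ)).symm.trans
    (MeasurableEquiv.piFinSuccAbove (fun _ : Fin 3 => ℝ) 2)).trans
    (MeasurableEquiv.prodComm.trans
      (MeasurableEquiv.prodCongr (MeasurableEquiv.toLp 2 (Fin 2 → ℝ)) (MeasurableEquiv.refl ℝ)))

theorem splitEquiv_apply (x : E3) : splitEquiv x = (horiz x, x 2) := by
  refine Prod.ext ?_ rfl
  ext i
  fin_cases i <;> rfl

theorem splitEquiv_symm_apply (p : E2 × ℝ) : splitEquiv.symm p = lift3 p.1 p.2 := by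
  rw [MeasurableEquiv.symm_apply_eq, splitEquiv_apply]; simp

theorem measurePreserving_splitEquiv : MeasurePreserving splitEquiv := by
  have h1 := EuclideanSpace.volume_preserving_symm_measurableEquiv_toLp (Fin 3)
  have h2 := volume_preserving_piFinSuccAbove (fun _ : Fin 3 => ℝ) 2
  have h3 : MeasurePreserving (Prod.swap : ℝ × (Fin 2 → ℝ) → (Fin 2 → ℝ) × ℝ) volume volume :=
    Measure.measurePreserving_swap
  have h4 := (EuclideanSpace.volume_preserving_symm_measurableEquiv_toLp (Fin 2)).symm
  have h5 : MeasurePreserving (Prod.map (MeasurableEquiv.toLp 2 (Fin 2 → ℝ)) (id : ℝ → ℝ))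
      volume volume := h4.prod (MeasurePreserving.id volume)
  exact h5.comp (h3.comp (h2.comp h1))

theorem integrable_comp_lift3_iff {h : E3 → ℝ} :
    Integrable (fun p : E2 × ℝ => h (lift3 p.1 p.2)) (volume.prod volume) ↔ Integrable h := by
  have := (measurePreserving_splitEquiv.symm).integrable_comp_emb
    (MeasurableEquiv.measurableEmbedding _) (g := h)
  simp only [Function.comp_def, splitEquiv_symm_apply] at this
  exact this

theorem integral_eq_integral_lift3 {h : E3 → ℝ} (hh : Integrable h) :
    ∫ x, h x = ∫ x' : E2, ∫ t : ℝ, h (lift3 x' t) := by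
  have h1 := (measurePreserving_splitEquiv.symm).integral_comp'
    (f := splitEquiv.symm) h
  rw [← h1]
  simp only [splitEquiv_symm_apply]
  exact integral_prod _ (integrable_comp_lift3_iff.2 hh)

/-! ### Square integrable functions -/

section LTwo

variable {α : Type*} [MeasurableSpace α] {μ : Measure α} {G : Type*} [NormedAddCommGroup G]
  [InnerProductSpace ℝ G]

theorem inner_toLp_eq {f g : α → G} (hf : MemLp f 2 μ) (hg : MemLp g 2 μ) :
    inner ℝ (hf.toLp f) (hg.toLp g) = ∫ x, inner ℝ (f x) (g x) ∂μ := by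
  rw [L2.inner_def]
  refine integral_congr_ae ?_
  filter_upwards [hf.coeFn_toLp, hg.coeFn_toLp] with x h1 h2
  rw [h1, h2]

theorem integrable_inner {f g : α → G} (hf : MemLp f 2 μ) (hg : MemLp g 2 μ) :
    Integrable (fun x => inner ℝ (f x) (g x)) μ := by
  have := L2.integrable_inner (𝕜 := ℝ) (hf.toLp f) (hg.toLp g)
  refine this.congr ?_
  filter_upwards [hf.coeFn_toLp, hg.coeFn_toLp] with x h1 h2
  rw [h1, h2]

theorem integrable_norm_sq {f : α → G} (hf : MemLp f 2 μ) : Integrable (fun x => ‖f x‖ ^ 2) μ := by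
  simpa only [real_inner_self_eq_norm_sq] using integrable_inner hf hf

theorem tendsto_integral_inner {f : ℕ → α → G} {g h : α → G} (hf : ∀ n, MemLp (f n) 2 μ)
    (hg : MemLp g 2 μ) (hh : MemLp h 2 μ)
    (hlim : Tendsto (fun n => eLpNorm (f n - g) 2 μ) atTop (𝓝 0)) :
    Tendsto (fun n => ∫ x, inner ℝ (f n x) (h x) ∂μ) atTop (𝓝 (∫ x, inner ℝ (g x) (h x) ∂μ)) := by
  have h1 := (Lp.tendsto_Lp_iff_tendsto_eLpNorm'' f hf g hg).2 hlim
  simp only [← inner_toLp_eq (hf _) hh, ← inner_toLp_eq hg hh]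
  exact h1.inner tendsto_const_nhds

end LTwo

/-! ### The weak equation -/

theorem IsTestFunction.memLp_gradient {φ : E3 → ℝ} (hφ : IsTestFunction Set.univ φ) :
    MemLp (gradient φ) 2 := by
  have hc : Continuous (gradient φ) :=
    (InnerProductSpace.toDual ℝ E3).symm.continuous.comp
      (hφ.smooth.continuous_fderiv (by simp))
  refine hc.memLp_of_hasCompactSupport ?_
  refine (hφ.compact.fderiv (𝕜 := ℝ)).comp_left (g := (InnerProductSpace.toDual ℝ E3).symm) ?_
  simp

/-- `Du` is a limit of gradients of test functions, and its inner products with such gradients are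
those of `F`: thus `Du` is the projection of `F` on the gradient fields. -/
structure IsGradProj (F Du : E3 → E3) : Prop where
  memLp_field : MemLp F 2
  memLp_grad : MemLp Du 2
  approx : ∃ φ : ℕ → E3 → ℝ, (∀ n, IsTestFunction Set.univ (φ n)) ∧
    Tendsto (fun n => eLpNorm (gradient (φ n) - Du) 2 volume) atTop (𝓝 0)
  equation : ∀ (φ : E3 → ℝ), IsTestFunction Set.univ φ →
    ∫ x, inner ℝ (Du x) (gradient φ x) = ∫ x, inner ℝ (F x) (gradient φ x)

namespace IsGradProj

variable {F Du : E3 → E3}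

/-- Orthogonality of a projection: the equation passes from gradients of test functions to their
`L²` limit `Du`. -/
theorem integral_norm_sq_eq (h : IsGradProj F Du) :
    ∫ x, ‖Du x‖ ^ 2 = ∫ x, inner ℝ (Du x) (F x) := by
  obtain ⟨φ, hφ, hlim⟩ := h.approx
  have h1 := tendsto_integral_inner (fun n => (hφ n).memLp_gradient) h.memLp_grad h.memLp_grad hlim
  have h2 := tendsto_integral_inner (fun n => (hφ n).memLp_gradient) h.memLp_grad h.memLp_field hlim
  have h3 : ∀ n, ∫ x, inner ℝ (gradient (φ n) x) (Du x) = ∫ x, inner ℝ (gradient (φ n) x) (F x) := by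
    intro n
    simpa only [real_inner_comm] using h.equation (φ n) (hφ n)
  simp only [h3] at h1
  have h4 := tendsto_nhds_unique h1 h2
  simpa only [real_inner_self_eq_norm_sq] using h4

theorem integral_norm_sq_le (h : IsGradProj F Du) : ∫ x, ‖Du x‖ ^ 2 ≤ ∫ x, ‖F x‖ ^ 2 := by
  have h1 := h.integral_norm_sq_eq
  have h2 : ∫ x, inner ℝ (Du x) (F x) ≤ ∫ x, (2⁻¹ * ‖Du x‖ ^ 2 + 2⁻¹ * ‖F x‖ ^ 2) := by
    refine integral_mono (integrable_inner h.memLp_grad h.memLp_field)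
      (((integrable_norm_sq h.memLp_grad).const_mul _).add
        ((integrable_norm_sq h.memLp_field).const_mul _)) fun x => ?_
    have := real_inner_le_norm (Du x) (F x)
    simp only
    nlinarith [sq_nonneg (‖Du x‖ - ‖F x‖)]
  rw [integral_add ((integrable_norm_sq h.memLp_grad).const_mul _)
    ((integrable_norm_sq h.memLp_field).const_mul _), integral_const_mul, integral_const_mul] at h2
  linarith

/-- The equation may be tested with functions that do not have compact support. -/
theorem equation_of_memLp (h : IsGradProj F Du) {ψ : E3 → ℝ}
    (hψ : ContDiff ℝ ((⊤ : ℕ∞) : WithTop ℕ∞) ψ) (hψ2 : MemLp ψ 2) (hψ' : MemLp (gradient ψ) 2) :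
    ∫ x, inner ℝ (Du x) (gradient ψ x) = ∫ x, inner ℝ (F x) (gradient ψ x) := by
  -- The product rule adds the term `ψ ∇η`. It is dominated because `ψ` is square integrable, and it
  -- is eventually zero at each point because the cutoffs become constant there.
  obtain ⟨C, η, hη, hηc, hη1, hηd, hηe⟩ := exists_smooth_cutoff E3
  have hC0 : 0 ≤ C := (norm_nonneg _).trans (hηd 0 0)
  have htest : ∀ n, IsTestFunction Set.univ (fun x => η n x * ψ x) := fun n =>
    ⟨(hη n).mul hψ, (hηc n).mul_right, Set.subset_univ _⟩
  have hbound : ∀ n x, ‖gradient (fun x => η n x * ψ x) x‖ ≤ ‖gradient ψ x‖ + C * |ψ x| := by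
    intro n x
    rw [norm_gradient, norm_gradient]
    have h1 : HasFDerivAt (fun x => η n x * ψ x) _ x :=
      ((hη n).differentiable (by simp) x).hasFDerivAt.mul (hψ.differentiable (by simp) x).hasFDerivAt
    rw [h1.fderiv]
    refine (norm_add_le _ _).trans ?_
    rw [norm_smul, norm_smul, Real.norm_eq_abs, Real.norm_eq_abs, mul_comm C]
    gcongr
    · exact mul_le_of_le_one_left (norm_nonneg _) (hη1 n x)
    · exact hηd n x
  have key : ∀ {G : E3 → E3}, MemLp G 2 →
      Tendsto (fun n => ∫ x, inner ℝ (G x) (gradient (fun x => η n x * ψ x) x)) atTop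
        (𝓝 (∫ x, inner ℝ (G x) (gradient ψ x))) := by
    intro G hG
    have hint : Integrable fun x => ‖G x‖ * (‖gradient ψ x‖ + C * |ψ x|) := by
      have h1 : Integrable fun x => ‖G x‖ * ‖gradient ψ x‖ :=
        hG.norm.integrable_mul hψ'.norm
      have h2 : Integrable fun x => ‖G x‖ * |ψ x| := hG.norm.integrable_mul hψ2.norm
      refine (h1.add (h2.const_mul C)).congr (Eventually.of_forall fun x => ?_)
      simp only [Pi.add_apply]; ring
    refine tendsto_integral_of_dominated_convergence _ (fun n => ?_) hint
      (fun n => Eventually.of_forall fun x => ?_) (Eventually.of_forall fun x => ?_)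
    · exact (integrable_inner hG (htest n).memLp_gradient).aestronglyMeasurable
    · refine (norm_inner_le_norm _ _).trans ?_
      gcongr
      exact hbound n x
    · refine tendsto_const_nhds.congr' ?_
      filter_upwards [hηe x] with n hn
      have : (fun x => η n x * ψ x) =ᶠ[𝓝 x] ψ := by
        filter_upwards [hn] with y hy
        rw [hy, one_mul]
      rw [gradient, gradient, this.fderiv_eq]
  have h1 := key h.memLp_grad
  have h2 := key h.memLp_field
  have h3 : ∀ n, ∫ x, inner ℝ (Du x) (gradient (fun x => η n x * ψ x) x)
      = ∫ x, inner ℝ (F x) (gradient (fun x => η n x * ψ x) x) := fun n => h.equation _ (htest n)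
  simp only [h3] at h1
  exact tendsto_nhds_unique h1 h2

end IsGradProj

/-! ### Convolution identities for the gradient projection -/

/-- Once the derivatives are moved from `φ` to the gaussian, both sides contain the same third
derivatives `∂ⱼ Δ`. This is the curl-free character of `∇φ` in integrated form. -/
theorem IsTestFunction.sum_integral_fderiv_mul_gaussHess {φ : E3 → ℝ}
    (hφ : IsTestFunction Set.univ φ) (s : ℝ) (j : Fin 3) (y : E3) :
    ∑ i, ∫ x, gaussHess s i j (x - y) * fderiv ℝ φ x (EuclideanSpace.single i 1)
      = ∫ x, gaussNegLap s (x - y) * fderiv ℝ φ x (EuclideanSpace.single j 1) := by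
  have hd : Differentiable ℝ φ := hφ.smooth.differentiable (by simp)
  have hfc : ∀ v : E3, Continuous fun x => fderiv ℝ φ x v := fun v =>
    (hφ.smooth.continuous_fderiv (by simp)).clm_apply continuous_const
  have hfs : ∀ v : E3, HasCompactSupport fun x => fderiv ℝ φ x v := fun v =>
    hφ.compact.fderiv_apply (𝕜 := ℝ) v
  have hgd : ∀ i k : Fin 3, ∀ x, fderiv ℝ (fun x => gaussHess s i k (x - y)) x
      = fderiv ℝ (gaussHess s i k) (x - y) := fun i k x => fderiv_comp_sub (f := gaussHess s i k) ..
  have hgc : ∀ i k l : Fin 3, Continuous fun x : E3 =>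
      fderiv ℝ (gaussHess s i k) (x - y) (EuclideanSpace.single l 1) := by
    intro i k l
    simp only [fderiv_gaussHess]
    fun_prop
  have hgc0 : ∀ i k : Fin 3, Continuous fun x : E3 => gaussHess s i k (x - y) := fun i k =>
    (continuous_gaussHess s i k).comp (by fun_prop)
  have hint1 : ∀ i k l : Fin 3, Integrable fun x : E3 =>
      fderiv ℝ (gaussHess s i k) (x - y) (EuclideanSpace.single l 1) * φ x := fun i k l =>
    ((hgc i k l).mul hφ.smooth.continuous).integrable_of_hasCompactSupport hφ.compact.mul_left
  have hint2 : ∀ i k l : Fin 3, Integrable fun x : E3 =>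
      gaussHess s i k (x - y) * fderiv ℝ φ x (EuclideanSpace.single l 1) := fun i k l =>
    ((hgc0 i k).mul (hfc _)).integrable_of_hasCompactSupport (hfs _).mul_left
  have hibp : ∀ i k l : Fin 3,
      ∫ x, gaussHess s i k (x - y) * fderiv ℝ φ x (EuclideanSpace.single l 1)
        = - ∫ x, fderiv ℝ (gaussHess s i k) (x - y) (EuclideanSpace.single l 1) * φ x := by
    intro i k l
    have := integral_mul_fderiv_eq_neg_fderiv_mul_of_integrable (μ := volume)
      (f := fun x => gaussHess s i k (x - y)) (g := φ) (v := EuclideanSpace.single l (1 : ℝ))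
      (by simpa only [hgd] using hint1 i k l) (hint2 i k l)
      (((hgc0 i k).mul hφ.smooth.continuous).integrable_of_hasCompactSupport hφ.compact.mul_left)
      (fun x _ => ((differentiable_gaussHess s i k).comp
        (differentiable_id.sub_const y)).differentiableAt)
      (fun x _ => hd x)
    simpa only [hgd] using this
  have hR : ∫ x, gaussNegLap s (x - y) * fderiv ℝ φ x (EuclideanSpace.single j 1)
      = ∑ i, ∫ x, gaussHess s i i (x - y) * fderiv ℝ φ x (EuclideanSpace.single j 1) := by
    rw [← integral_finsetSum _ fun i _ => hint2 i i j]
    simp only [gaussNegLap, Finset.sum_mul]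
  rw [hR]
  simp only [hibp, Finset.sum_neg_distrib]
  rw [← integral_finsetSum _ fun i _ => hint1 i j i, ← integral_finsetSum _ fun i _ => hint1 i i j]
  simp only [← Finset.sum_mul, sum_fderiv_gaussHess]

theorem memLp_comp_sub {h : E3 → ℝ} (hh : MemLp h 2) (y : E3) : MemLp (fun x => h (x - y)) 2 :=
  hh.comp_measurePreserving (measurePreserving_sub_right volume y)

theorem memLp_coord {n : ℕ} {α : Type*} [MeasurableSpace α] {μ : Measure α} {p : ENNReal}
    {F : α → EuclideanSpace ℝ (Fin n)} (hF : MemLp F p μ) (i : Fin n) :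
    MemLp (fun x => F x i) p μ :=
  (EuclideanSpace.proj i : EuclideanSpace ℝ (Fin n) →L[ℝ] ℝ).comp_memLp' hF

theorem memLp_of_coord {n : ℕ} {α : Type*} [MeasurableSpace α] {μ : Measure α} {p : ENNReal}
    {F : α → EuclideanSpace ℝ (Fin n)} (hF : ∀ i, MemLp (fun x => F x i) p μ) : MemLp F p μ := by
  have h : F = fun x => ∑ i, F x i • EuclideanSpace.single i (1 : ℝ) := by
    ext x i
    simp [Finset.sum_apply, Pi.single_apply]
  rw [h]
  refine memLp_finsetSum _ fun i _ => ?_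
  have := ((ContinuousLinearMap.toSpanSingleton ℝ
    (EuclideanSpace.single i (1 : ℝ) : EuclideanSpace ℝ (Fin n)))).comp_memLp' (hF i)
  simpa [Function.comp_def] using this

theorem memLp_gaussNegLap {s : ℝ} (hs : 0 < s) : MemLp (gaussNegLap s) 2 :=
  memLp_finsetSum _ fun i _ => memLp_gaussHess hs i i

theorem integrable_gaussNegLap {s : ℝ} (hs : 0 < s) : Integrable (gaussNegLap s) :=
  integrable_finsetSum _ fun i _ => integrable_gaussHess hs i i

theorem gradient_gaussGrad_sub (s : ℝ) (j i : Fin 3) (y x : E3) :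
    gradient (fun x => gaussGrad s j (x - y)) x i = - gaussHess s i j (x - y) := by
  rw [gradient_apply, fderiv_comp_sub (f := gaussGrad s j), fderiv_gaussGrad]

namespace IsGradProj

variable {F Du : E3 → E3}

/-- Both sides are `L²`-continuous in the gradient, so the identity for test functions passes to
`Du`. -/
theorem sum_integral_mul_gaussHess (h : IsGradProj F Du) {s : ℝ} (hs : 0 < s) (j : Fin 3) (y : E3) :
    ∑ i, ∫ x, gaussHess s i j (x - y) * Du x i = ∫ x, gaussNegLap s (x - y) * Du x j := by
  obtain ⟨φ, hφ, hlim⟩ := h.approx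
  have hcoord : ∀ {k : E3 → ℝ}, MemLp k 2 → ∀ i,
      Tendsto (fun n => ∫ x, k (x - y) * fderiv ℝ (φ n) x (EuclideanSpace.single i 1)) atTop
        (𝓝 (∫ x, k (x - y) * Du x i)) := by
    intro k hk i
    have hK : MemLp (fun x => k (x - y) • EuclideanSpace.single i (1 : ℝ) : E3 → E3) 2 := by
      have := ((ContinuousLinearMap.toSpanSingleton ℝ
        (EuclideanSpace.single i (1 : ℝ) : E3))).comp_memLp' (memLp_comp_sub hk y)
      simpa [Function.comp_def] using this
    have := tendsto_integral_inner (fun n => (hφ n).memLp_gradient) h.memLp_grad hK hlim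
    simpa [inner_smul_right, EuclideanSpace.inner_single_right, gradient_apply] using this
  have h1 := tendsto_finsetSum Finset.univ fun i (_ : i ∈ Finset.univ) =>
    hcoord (memLp_gaussHess hs i j) i
  have h2 := hcoord (memLp_gaussNegLap hs) j
  simp only [fun n => (hφ n).sum_integral_fderiv_mul_gaussHess s j y] at h1
  exact tendsto_nhds_unique h1 h2

/-- The equation is tested with the derivative `∂ⱼ` of a gaussian centred at `y`, whose gradient is
minus a column of `gaussHess`. On the side of `Du`, being curl-free turns that column into the
laplacian; on the side of `F` the second derivatives stay. -/
theorem integral_gaussNegLap_mul (h : IsGradProj F Du) {s : ℝ} (hs : 0 < s) (j : Fin 3) (y : E3) :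
    ∫ x, Du x j * gaussNegLap s (y - x) = ∑ i, ∫ x, F x i * gaussHess s i j (y - x) := by
  have hgr : MemLp (gradient fun x => gaussGrad s j (x - y)) 2 :=
    memLp_of_coord fun i => by
      simp only [gradient_gaussGrad_sub]
      exact (memLp_comp_sub (memLp_gaussHess hs i j) y).neg
  have heq := h.equation_of_memLp (ψ := fun x => gaussGrad s j (x - y))
    ((contDiff_gaussGrad s j).comp (contDiff_id.sub contDiff_const))
    (memLp_comp_sub (memLp_gaussGrad hs j) y) hgr
  have hexp : ∀ {G : E3 → E3}, MemLp G 2 →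
      ∫ x, inner ℝ (G x) (gradient (fun x => gaussGrad s j (x - y)) x)
        = - ∑ i, ∫ x, gaussHess s i j (x - y) * G x i := by
    intro G hG
    rw [← integral_finsetSum, ← integral_neg]
    · refine integral_congr_ae (Eventually.of_forall fun x => ?_)
      simp only [inner_eq_sum, gradient_gaussGrad_sub]
      rw [← Finset.sum_neg_distrib]
      exact Finset.sum_congr rfl fun i _ => by ring
    · intro i _
      exact (memLp_comp_sub (memLp_gaussHess hs i j) y).integrable_mul (memLp_coord hG i)
  rw [hexp h.memLp_grad, hexp h.memLp_field, neg_inj, h.sum_integral_mul_gaussHess hs] at heq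
  have hsymm : ∀ i k : Fin 3, ∀ x, gaussHess s i k (x - y) = gaussHess s i k (y - x) := by
    intro i k x
    rw [← gaussHess_neg, neg_sub]
  simp only [gaussNegLap, hsymm] at heq
  simpa only [gaussNegLap, mul_comm] using heq

end IsGradProj

/-! ### Fubini for a kernel integrated against a correlation -/

section Fubini

variable {E : Type*} [NormedAddCommGroup E] [InnerProductSpace ℝ E] [FiniteDimensional ℝ E]
  [MeasurableSpace E] [BorelSpace E]

theorem abs_integral_mul_comp_add_le {p q : E → ℝ} (hp : MemLp p 2) (hq : MemLp q 2) (z : E) :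
    ∫ x, |p x * q (x + z)| ≤ 2⁻¹ * (∫ x, p x ^ 2) + 2⁻¹ * ∫ x, q x ^ 2 := by
  have hqz : MemLp (fun x => q (x + z)) 2 :=
    hq.comp_measurePreserving (measurePreserving_add_right volume z)
  have h1 : ∫ x, q x ^ 2 = ∫ x, q (x + z) ^ 2 :=
    (integral_add_right_eq_self (fun x => q x ^ 2) z).symm
  rw [h1, ← integral_const_mul, ← integral_const_mul, ← integral_add]
  · refine integral_mono (hp.integrable_mul hqz).abs
      ((hp.integrable_sq.const_mul _).add (hqz.integrable_sq.const_mul _)) fun x => ?_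
    simp only [abs_mul]
    nlinarith [sq_nonneg (|p x| - |q (x + z)|), sq_abs (p x), sq_abs (q (x + z))]
  · exact hp.integrable_sq.const_mul _
  · exact hqz.integrable_sq.const_mul _

/-- Absolute convergence of `∬ k(z) p(x) q(x + z)`. -/
theorem integrable_mul_mul_comp_add {k p q : E → ℝ} (hk : Integrable k) (hp : MemLp p 2)
    (hq : MemLp q 2) :
    Integrable (fun w : E × E => k w.1 * (p w.2 * q (w.2 + w.1))) (volume.prod volume) := by
  have hm : AEStronglyMeasurable (fun w : E × E => k w.1 * (p w.2 * q (w.2 + w.1)))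
      (volume.prod volume) := by
    refine hk.aestronglyMeasurable.comp_fst.mul (hp.aestronglyMeasurable.comp_snd.mul ?_)
    refine hq.aestronglyMeasurable.comp_quasiMeasurePreserving
      (f := fun w : E × E => w.2 + w.1) ?_
    have := quasiMeasurePreserving_add (μ := (volume : Measure E)) (ν := (volume : Measure E))
    simpa only [add_comm] using this
  rw [integrable_prod_iff hm]
  constructor
  · refine Eventually.of_forall fun z => ?_
    have hqz : MemLp (fun x => q (x + z)) 2 :=
      hq.comp_measurePreserving (measurePreserving_add_right volume z)
    exact Integrable.const_mul (f := fun x => p x * q (x + z)) (hp.integrable_mul hqz) (k z)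
  · refine Integrable.mono' ((hk.abs).mul_const
      (2⁻¹ * (∫ x, p x ^ 2) + 2⁻¹ * ∫ x, q x ^ 2)) hm.norm.integral_prod_right'
      (Eventually.of_forall fun z => ?_)
    simp only [norm_mul, Real.norm_eq_abs]
    rw [abs_of_nonneg (integral_nonneg fun x => by positivity), integral_const_mul]
    have := abs_integral_mul_comp_add_le hp hq z
    simp only [abs_mul] at this
    gcongr

/-- The substitution `z = y - x` turns the pairing of `k` with the correlation of `p` and `q` into
the pairing of `q` with the convolution of `p` and `k`. -/
theorem integral_mul_integral_mul_comp_add {k p q : E → ℝ} (hk : Integrable k) (hp : MemLp p 2)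
    (hq : MemLp q 2) :
    ∫ z, k z * ∫ x, p x * q (x + z) = ∫ y, q y * ∫ x, p x * k (y - x) := by
  have hshift : ∀ z : E, ∫ x, p x * q (x + z) = ∫ y, q y * p (y + -z) := by
    intro z
    rw [← integral_sub_right_eq_self (fun x => p x * q (x + z)) z]
    refine integral_congr_ae (Eventually.of_forall fun y => ?_)
    simp only [sub_add_cancel, ← sub_eq_add_neg]; ring
  simp only [hshift]
  have hk' : Integrable fun z => k (-z) := hk.comp_neg
  rw [← integral_neg_eq_self]
  simp only [neg_neg]
  have hint := integrable_mul_mul_comp_add hk' hq hp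
  simp only [← integral_const_mul]
  rw [integral_integral_swap hint]
  refine integral_congr_ae (Eventually.of_forall fun y => ?_)
  simp only
  rw [← integral_add_left_eq_self (fun x => q y * (p x * k (y - x))) y]
  refine integral_congr_ae (Eventually.of_forall fun z => ?_)
  simp only [sub_add_cancel_left]
  ring

end Fubini

/-- The correlation of the components `i` and `j` of a field. -/
def corr (F : E3 → E3) (i j : Fin 3) (z : E3) : ℝ := ∫ x, F x i * F (x + z) j

/-- The correlation of two fields. -/
def crossCorr (D F : E3 → E3) (z : E3) : ℝ := ∫ x, inner ℝ (D x) (F (x + z))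

theorem memLp_comp_add {G : Type*} [NormedAddCommGroup G] {F : E3 → G} (hF : MemLp F 2) (z : E3) :
    MemLp (fun x => F (x + z)) 2 :=
  hF.comp_measurePreserving (measurePreserving_add_right volume z)

theorem crossCorr_eq_sum {D F : E3 → E3} (hD : MemLp D 2) (hF : MemLp F 2) (z : E3) :
    crossCorr D F z = ∑ j, ∫ x, D x j * F (x + z) j := by
  rw [crossCorr, ← integral_finsetSum]
  · simp only [inner_eq_sum]
  · exact fun j _ => (memLp_coord hD j).integrable_mul (memLp_coord (memLp_comp_add hF z) j)

theorem integrable_mul_integral {k : E3 → ℝ} {D F : E3 → E3} (hk : Integrable k) (hD : MemLp D 2)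
    (hF : MemLp F 2) (i j : Fin 3) :
    Integrable fun z => k z * ∫ x, D x i * F (x + z) j := by
  have := (integrable_mul_mul_comp_add hk (memLp_coord hD i) (memLp_coord hF j)).integral_prod_left
  simpa only [integral_const_mul] using this

/-- This eliminates the unknown gradient: the convolution identity
`IsGradProj.integral_gaussNegLap_mul` is paired with `F`, which leaves correlations of `F` with
itself only. -/
theorem IsGradProj.integral_gaussNegLap_mul_crossCorr {F Du : E3 → E3} (h : IsGradProj F Du) {s : ℝ}
    (hs : 0 < s) :
    ∫ z, gaussNegLap s z * crossCorr Du F z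
      = ∑ i, ∑ j, ∫ z, gaussHess s i j z * corr F i j z := by
  simp only [crossCorr_eq_sum h.memLp_grad h.memLp_field, Finset.mul_sum]
  rw [integral_finsetSum _ fun j _ => integrable_mul_integral (integrable_gaussNegLap hs)
    h.memLp_grad h.memLp_field j j, Finset.sum_comm]
  refine Finset.sum_congr rfl fun j _ => ?_
  rw [integral_mul_integral_mul_comp_add (integrable_gaussNegLap hs) (memLp_coord h.memLp_grad j)
    (memLp_coord h.memLp_field j)]
  simp only [h.integral_gaussNegLap_mul hs, Finset.mul_sum, corr]
  have hint : ∀ i : Fin 3, Integrable fun y : E3 => F y j * ∫ x, F x i * gaussHess s i j (y - x) := by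
    intro i
    have h1 := (integrable_mul_mul_comp_add (integrable_gaussHess hs i j)
      (memLp_coord h.memLp_field j) (memLp_coord h.memLp_field i)).integral_prod_right
    refine h1.congr (Eventually.of_forall fun y => ?_)
    simp only
    rw [← integral_const_mul,
      ← integral_sub_right_eq_self (fun z => gaussHess s i j z * (F y j * F (y + z) i)) y]
    refine integral_congr_ae (Eventually.of_forall fun x => ?_)
    simp only [add_sub_cancel]
    rw [← gaussHess_neg, neg_sub]
    ring
  rw [integral_finsetSum _ fun i _ => hint i]
  refine Finset.sum_congr rfl fun i _ => ?_
  exact (integral_mul_integral_mul_comp_add (integrable_gaussHess hs i j)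
    (memLp_coord h.memLp_field i) (memLp_coord h.memLp_field j)).symm

/-! ### Gaussian superposition of the Newton kernel -/

/-- The weight for which `∫₀^∞ heatWeight s * exp (-s r²) ds = 1 / (4 π r)`. -/
def heatWeight (s : ℝ) : ℝ := 1 / (4 * (Real.pi * √Real.pi) * √s)

/-- The normalized gaussian on `ℝ³`. -/
def normGauss (s : ℝ) (z : E3) : ℝ :=
  s * √s / (Real.pi * √Real.pi) * Real.exp (-s * ‖z‖ ^ 2)

theorem heatWeight_nonneg (s : ℝ) : 0 ≤ heatWeight s := by unfold heatWeight; positivity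

theorem normGauss_nonneg {s : ℝ} (hs : 0 < s) (z : E3) : 0 ≤ normGauss s z := by
  unfold normGauss; positivity

theorem continuous_normGauss (s : ℝ) : Continuous (normGauss s) := by
  unfold normGauss; fun_prop

theorem integrable_normGauss {s : ℝ} (hs : 0 < s) : Integrable (normGauss s) :=
  (integrable_exp_neg_mul_norm_sq hs).const_mul _

theorem rpow_three_halves {x : ℝ} (hx : 0 ≤ x) : x ^ ((3 : ℝ) / 2) = x * √x := by
  rw [Real.sqrt_eq_rpow, show (3 : ℝ) / 2 = 1 + 1 / 2 by norm_num,
    Real.rpow_add_of_nonneg hx (by norm_num) (by norm_num), Real.rpow_one]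

theorem integral_normGauss {s : ℝ} (hs : 0 < s) : ∫ z, normGauss s z = 1 := by
  unfold normGauss
  rw [integral_const_mul, GaussianFourier.integral_rexp_neg_mul_sq_norm hs]
  have hp := Real.pi_pos
  simp only [finrank_euclideanSpace, Fintype.card_fin]
  push_cast
  rw [rpow_three_halves (by positivity), Real.sqrt_div hp.le]
  have h1 : 0 < √s := Real.sqrt_pos.2 hs
  have h2 : 0 < √Real.pi := Real.sqrt_pos.2 hp
  field_simp

/-- At time `1 / (4 s)` the heat kernel is `normGauss s`, so this is the heat equation in the
variable `s`. The weight combines the jacobian `1 / (4 s²)` with the normalization `(s / π)^{3/2}`.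
-/
theorem hasDerivAt_normGauss {s : ℝ} (hs : 0 < s) (z : E3) :
    HasDerivAt (fun s => normGauss s z) (heatWeight s * gaussNegLap s z) s := by
  have h1 : HasDerivAt (fun s : ℝ => s * √s) (1 * √s + s * (1 / (2 * √s))) s :=
    (hasDerivAt_id s).mul (Real.hasDerivAt_sqrt hs.ne')
  have h2 : HasDerivAt (fun s : ℝ => Real.exp (-s * ‖z‖ ^ 2))
      (Real.exp (-s * ‖z‖ ^ 2) * (-1 * ‖z‖ ^ 2)) s :=
    (((hasDerivAt_id s).neg).mul_const _).exp
  have h3 := (h1.div_const (Real.pi * √Real.pi)).mul h2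
  refine h3.congr_deriv ?_
  rw [gaussNegLap_eq, heatWeight]
  have hq : 0 < √s := Real.sqrt_pos.2 hs
  have h2 : 0 < √Real.pi := Real.sqrt_pos.2 Real.pi_pos
  have hp := Real.pi_pos
  have hss : s = √s ^ 2 := (Real.sq_sqrt hs.le).symm
  generalize √s = q at *
  subst hss
  field_simp
  ring

theorem continuousOn_heatWeight : ContinuousOn heatWeight (Set.Ioi 0) := by
  unfold heatWeight
  refine continuousOn_const.div (by fun_prop) fun s hs => ?_
  have : 0 < √s := Real.sqrt_pos.2 hs
  have := Real.pi_pos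
  positivity

theorem continuous_gaussHess_left {n : ℕ} (i j : Fin n) :
    Continuous fun p : ℝ × EuclideanSpace ℝ (Fin n) => gaussHess p.1 i j p.2 := by
  unfold gaussHess; fun_prop

theorem integral_heatWeight_mul_gaussNegLap {a b : ℝ} (ha : 0 < a) (hab : a ≤ b) (z : E3) :
    ∫ s in a..b, heatWeight s * gaussNegLap s z = normGauss b z - normGauss a z := by
  refine intervalIntegral.integral_eq_sub_of_hasDerivAt (f := fun s => normGauss s z)
    (fun s hs => ?_) ?_
  · rw [Set.uIcc_of_le hab] at hs
    exact hasDerivAt_normGauss (ha.trans_le hs.1) z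
  · refine ContinuousOn.intervalIntegrable ?_
    rw [Set.uIcc_of_le hab]
    refine ((continuousOn_heatWeight.mono fun s hs => ha.trans_le hs.1)).mul ?_
    simp only [gaussNegLap_eq]
    fun_prop

theorem heatWeight_le {a s : ℝ} (ha : 0 < a) (has : a ≤ s) : heatWeight s ≤ heatWeight a := by
  unfold heatWeight
  have h1 : 0 < √a := Real.sqrt_pos.2 ha
  have h2 : 0 < √Real.pi := Real.sqrt_pos.2 Real.pi_pos
  have hp := Real.pi_pos
  have := Real.sqrt_le_sqrt has
  gcongr

theorem measurable_heatWeight : Measurable heatWeight := by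
  unfold heatWeight; fun_prop

/-- Exchange of the superposition in `s` and the integration against a bounded function. -/
theorem integral_heatWeight_gaussHess_swap {a b : ℝ} (ha : 0 < a) (hab : a ≤ b) {r : E3 → ℝ}
    (hr : AEStronglyMeasurable r) {B : ℝ} (hB : ∀ z, |r z| ≤ B) (i j : Fin 3) :
    Integrable (fun p : ℝ × E3 => heatWeight p.1 * (gaussHess p.1 i j p.2 * r p.2))
      ((volume.restrict (Set.Ioc a b)).prod volume) := by
  have hB0 : 0 ≤ B := (abs_nonneg _).trans (hB 0)
  have hbd : Integrable (fun p : ℝ × E3 => heatWeight a *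
      ((2 * b + 4 * b ^ 2) * ((1 + ‖p.2‖ ^ 2) ^ 1 * Real.exp (-a * ‖p.2‖ ^ 2)) * B))
      ((volume.restrict (Set.Ioc a b)).prod volume) := by
    have h1 : Integrable fun z : E3 =>
        (2 * b + 4 * b ^ 2) * ((1 + ‖z‖ ^ 2) ^ 1 * Real.exp (-a * ‖z‖ ^ 2)) := by
      refine integrable_of_gaussian_bound (A := 2 * b + 4 * b ^ 2) (s := a) (k := 1) (by fun_prop) ha
        fun z => ?_
      rw [abs_of_nonneg]
      have : 0 < b := ha.trans_le hab
      positivity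
    have h2 : Integrable (fun _ : ℝ => heatWeight a) (volume.restrict (Set.Ioc a b)) :=
      integrable_const _
    exact h2.mul_prod (h1.mul_const B)
  refine hbd.mono' ?_ ?_
  · refine (measurable_heatWeight.aestronglyMeasurable.comp_fst).mul
      ((continuous_gaussHess_left i j).aestronglyMeasurable.mul hr.comp_snd)
  · have : ∀ᵐ p : ℝ × E3 ∂((volume.restrict (Set.Ioc a b)).prod volume), p.1 ∈ Set.Ioc a b :=
      Measure.quasiMeasurePreserving_fst.ae (ae_restrict_mem measurableSet_Ioc)
    filter_upwards [this] with p hp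
    rw [norm_mul, norm_mul, Real.norm_of_nonneg (heatWeight_nonneg _)]
    have h1 := abs_gaussHess_le ha hp.1.le hp.2 i j p.2
    have hb : 0 < b := ha.trans_le hab
    refine mul_le_mul (heatWeight_le ha hp.1.le) ?_ (by positivity) (heatWeight_nonneg _)
    exact mul_le_mul h1 (hB _) (abs_nonneg _) (by positivity)

/-- The superposition over `[a, b]` collapses to two normalized gaussians. For large `b` one
approximates evaluation at zero; for small `a` the other averages over a large region. -/
theorem integral_heatWeight_integral_gaussNegLap {a b : ℝ} (ha : 0 < a) (hab : a ≤ b) {r : E3 → ℝ}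
    (hr : AEStronglyMeasurable r) {B : ℝ} (hB : ∀ z, |r z| ≤ B) :
    ∫ s in a..b, heatWeight s * ∫ z, gaussNegLap s z * r z
      = ∫ z, (normGauss b z - normGauss a z) * r z := by
  have hint : Integrable (fun p : ℝ × E3 => heatWeight p.1 * (gaussNegLap p.1 p.2 * r p.2))
      ((volume.restrict (Set.Ioc a b)).prod volume) := by
    have := integrable_finsetSum (Finset.univ : Finset (Fin 3)) fun i _ =>
      integral_heatWeight_gaussHess_swap ha hab hr hB i i
    simpa only [gaussNegLap, Finset.sum_mul, Finset.mul_sum] using this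
  rw [intervalIntegral.integral_of_le hab]
  simp only [← integral_const_mul]
  rw [integral_integral_swap hint]
  refine integral_congr_ae (Eventually.of_forall fun z => ?_)
  simp only
  rw [← integral_heatWeight_mul_gaussNegLap ha hab, intervalIntegral.integral_of_le hab,
    ← integral_mul_const]
  simp only [mul_assoc]

/-! ### Correlations -/

theorem abs_crossCorr_le {D F : E3 → E3} (hD : MemLp D 2) (hF : MemLp F 2) (z : E3) :
    |crossCorr D F z| ≤ 2⁻¹ * (∫ x, ‖D x‖ ^ 2) + 2⁻¹ * ∫ x, ‖F x‖ ^ 2 := by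
  have hFz := memLp_comp_add hF z
  have h1 : ∫ x, ‖F x‖ ^ 2 = ∫ x, ‖F (x + z)‖ ^ 2 :=
    (integral_add_right_eq_self (fun x => ‖F x‖ ^ 2) z).symm
  rw [h1, ← integral_const_mul, ← integral_const_mul,
    ← integral_add ((integrable_norm_sq hD).const_mul _) ((integrable_norm_sq hFz).const_mul _)]
  refine (abs_integral_le_integral_abs).trans ?_
  refine integral_mono (integrable_inner hD hFz).abs
    (((integrable_norm_sq hD).const_mul _).add ((integrable_norm_sq hFz).const_mul _)) fun x => ?_
  have := abs_real_inner_le_norm (D x) (F (x + z))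
  simp only
  nlinarith [sq_nonneg (‖D x‖ - ‖F (x + z)‖)]

/-- Fubini yields measurability only of integrable functions of `z`, so the correlation is first
multiplied by the weight `exp (-‖z‖²)`, which is then divided out. -/
theorem aestronglyMeasurable_crossCorr {D F : E3 → E3} (hD : MemLp D 2) (hF : MemLp F 2) :
    AEStronglyMeasurable (crossCorr D F) := by
  have h1 : ∀ j : Fin 3, AEStronglyMeasurable fun z : E3 => ∫ x, D x j * F (x + z) j := by
    intro j
    have h2 := (integrable_mul_integral (integrable_exp_neg_mul_norm_sq (E := E3) one_pos)
      hD hF j j).aestronglyMeasurable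
    have h3 : AEStronglyMeasurable (fun z : E3 => Real.exp (1 * ‖z‖ ^ 2)) :=
      Continuous.aestronglyMeasurable (by fun_prop)
    refine (h3.mul h2).congr (Eventually.of_forall fun z => ?_)
    simp only [Pi.mul_apply]
    rw [← mul_assoc, ← Real.exp_add]
    simp
  have h2 : crossCorr D F = fun z => ∑ j, ∫ x, D x j * F (x + z) j :=
    funext fun z => crossCorr_eq_sum hD hF z
  rw [h2]
  exact Finset.aestronglyMeasurable_fun_sum _ fun j _ => h1 j

/-- The squared `L²` modulus of continuity of a field. -/
def shiftSq (F : E3 → E3) (z : E3) : ℝ := ∫ x, ‖F x - F (x + z)‖ ^ 2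

theorem integral_inner_eq_crossCorr_zero (D F : E3 → E3) :
    ∫ x, inner ℝ (D x) (F x) = crossCorr D F 0 := by
  simp [crossCorr]

theorem shiftSq_eq {F : E3 → E3} (hF : MemLp F 2) (z : E3) :
    shiftSq F z = 2 * (∫ x, ‖F x‖ ^ 2) - 2 * crossCorr F F z := by
  have hFz := memLp_comp_add hF z
  have h1 : ∫ x, ‖F x‖ ^ 2 = ∫ x, ‖F (x + z)‖ ^ 2 :=
    (integral_add_right_eq_self (fun x => ‖F x‖ ^ 2) z).symm
  have h2 : shiftSq F z = (∫ x, ‖F x‖ ^ 2) - 2 * crossCorr F F z + ∫ x, ‖F (x + z)‖ ^ 2 := by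
    have hI : Integrable fun x => ‖F x‖ ^ 2 - 2 * inner ℝ (F x) (F (x + z)) :=
      (integrable_norm_sq hF).sub ((integrable_inner hF hFz).const_mul 2)
    rw [shiftSq, crossCorr, ← integral_const_mul,
      ← integral_sub (integrable_norm_sq hF) ((integrable_inner hF hFz).const_mul _),
      ← integral_add hI (integrable_norm_sq hFz)]
    simp only [norm_sub_sq_real]
  rw [h2, ← h1]; ring

/-- Young's inequality for `D · (F - F(· + z))`. The weight `l` is left free so that the first term
can later be made small at the expense of the second. -/
theorem abs_crossCorr_zero_sub_le {D F : E3 → E3} (hD : MemLp D 2) (hF : MemLp F 2) {l : ℝ}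
    (hl : 0 < l) (z : E3) :
    |crossCorr D F 0 - crossCorr D F z| ≤ l / 2 * (∫ x, ‖D x‖ ^ 2) + 1 / (2 * l) * shiftSq F z := by
  have hFz := memLp_comp_add hF z
  have hdiff : MemLp (fun x => F x - F (x + z)) 2 := hF.sub hFz
  have h1 : crossCorr D F 0 - crossCorr D F z = ∫ x, inner ℝ (D x) (F x - F (x + z)) := by
    rw [← integral_inner_eq_crossCorr_zero, crossCorr,
      ← integral_sub (integrable_inner hD hF) (integrable_inner hD hFz)]
    simp only [inner_sub_right]
  rw [h1, shiftSq, ← integral_const_mul, ← integral_const_mul,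
    ← integral_add ((integrable_norm_sq hD).const_mul _) ((integrable_norm_sq hdiff).const_mul _)]
  refine (abs_integral_le_integral_abs).trans ?_
  refine integral_mono (integrable_inner hD hdiff).abs
    (((integrable_norm_sq hD).const_mul _).add ((integrable_norm_sq hdiff).const_mul _)) fun x => ?_
  have h2 := abs_real_inner_le_norm (D x) (F x - F (x + z))
  simp only
  refine h2.trans ?_
  have h3 : l / 2 * ‖D x‖ ^ 2 + 1 / (2 * l) * ‖F x - F (x + z)‖ ^ 2
      - ‖D x‖ * ‖F x - F (x + z)‖ = 1 / (2 * l) * (l * ‖D x‖ - ‖F x - F (x + z)‖) ^ 2 := by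
    field_simp; ring
  have h4 : 0 ≤ 1 / (2 * l) * (l * ‖D x‖ - ‖F x - F (x + z)‖) ^ 2 := by positivity
  linarith

/-! ### The approximation of the energy by gaussian correlations -/

/-- The horizontal strip `0 < x₃ < l`. -/
def strip (l : ℝ) : Set E3 := {x | 0 < x 2 ∧ x 2 < l}

theorem measurableSet_strip (l : ℝ) : MeasurableSet (strip l) := by
  have h : Measurable fun x : E3 => x 2 := by fun_prop
  exact (measurableSet_lt measurable_const h).inter (measurableSet_lt h measurable_const)

theorem normGauss_lift3 {a : ℝ} (ha : 0 < a) (z : E2) (t : ℝ) :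
    normGauss a (lift3 z t)
      = (a / Real.pi * Real.exp (-a * ‖z‖ ^ 2)) * (√(a / Real.pi) * Real.exp (-a * t ^ 2)) := by
  rw [normGauss, norm_lift3_sq, Real.sqrt_div ha.le, mul_add, Real.exp_add]
  have h1 : 0 < √Real.pi := Real.sqrt_pos.2 Real.pi_pos
  field_simp

/-- The vertical marginal of the gaussian has density at most `√(a / π)`, and the strip has
thickness `l`. -/
theorem integral_normGauss_indicator_strip_le {a l : ℝ} (ha : 0 < a) (hl : 0 ≤ l) (x : E3) :
    ∫ z, normGauss a z * (strip l).indicator 1 (x + z) ≤ l * √(a / Real.pi) := by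
  have hm : Measurable fun z : E3 => (strip l).indicator (1 : E3 → ℝ) (x + z) :=
    (measurable_one.indicator (measurableSet_strip l)).comp (measurable_const_add x)
  have hi1 : ∀ y : E3, |(strip l).indicator (1 : E3 → ℝ) y| ≤ 1 := by
    intro y; by_cases hy : y ∈ strip l <;> simp [hy]
  have hint : Integrable fun z => normGauss a z * (strip l).indicator 1 (x + z) :=
    (integrable_normGauss ha).mul_bdd (c := 1) hm.aestronglyMeasurable
      (Eventually.of_forall fun z => hi1 _)
  rw [integral_eq_integral_lift3 hint]
  have hinner : ∀ z : E2, ∫ t, normGauss a (lift3 z t) * (strip l).indicator 1 (x + lift3 z t)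
      ≤ (a / Real.pi * Real.exp (-a * ‖z‖ ^ 2)) * (l * √(a / Real.pi)) := by
    intro z
    have hle : ∀ t : ℝ, normGauss a (lift3 z t) * (strip l).indicator 1 (x + lift3 z t)
        ≤ (Set.Ioo (-(x 2)) (l - x 2)).indicator
          (fun _ => (a / Real.pi * Real.exp (-a * ‖z‖ ^ 2)) * √(a / Real.pi)) t := by
      intro t
      by_cases ht : t ∈ Set.Ioo (-(x 2)) (l - x 2)
      · rw [Set.indicator_of_mem ht]
        have h1 : x + lift3 z t ∈ strip l := by
          simp only [strip, Set.mem_ofPred_eq, PiLp.add_apply, lift3_two]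
          constructor <;> linarith [ht.1, ht.2]
        rw [Set.indicator_of_mem h1, Pi.one_apply, mul_one, normGauss_lift3 ha]
        have h2 : Real.exp (-a * t ^ 2) ≤ 1 := Real.exp_le_one_iff.2 (by nlinarith [sq_nonneg t])
        have hp := Real.pi_pos
        refine mul_le_mul_of_nonneg_left ?_ (by positivity)
        exact mul_le_of_le_one_right (Real.sqrt_nonneg _) h2
      · rw [Set.indicator_of_notMem ht]
        have h1 : x + lift3 z t ∉ strip l := by
          intro h
          simp only [strip, Set.mem_ofPred_eq, PiLp.add_apply, lift3_two] at h
          exact ht ⟨by linarith [h.1], by linarith [h.2]⟩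
        rw [Set.indicator_of_notMem h1, mul_zero]
    have hnn : ∀ t : ℝ, 0 ≤ normGauss a (lift3 z t) * (strip l).indicator 1 (x + lift3 z t) :=
      fun t => mul_nonneg (normGauss_nonneg ha _) (Set.indicator_nonneg (fun _ _ => zero_le_one) _)
    refine (integral_mono_of_nonneg (Eventually.of_forall hnn) ?_
      (Eventually.of_forall hle)).trans (le_of_eq ?_)
    · exact (integrable_indicator_iff measurableSet_Ioo).2
        (integrableOn_const (by simp) enorm_ne_top)
    · rw [integral_indicator measurableSet_Ioo, setIntegral_const, Real.volume_real_Ioo_of_le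
        (by linarith), smul_eq_mul]
      ring
  have hg := integrable_exp_neg_mul_norm_sq (E := E2) ha
  have hp := Real.pi_pos
  calc ∫ z : E2, ∫ t, normGauss a (lift3 z t) * (strip l).indicator 1 (x + lift3 z t)
      ≤ ∫ z : E2, (a / Real.pi * Real.exp (-a * ‖z‖ ^ 2)) * (l * √(a / Real.pi)) := by
        refine integral_mono (integrable_comp_lift3_iff.2 hint).integral_prod_left
          ((hg.const_mul _).mul_const _) hinner
    _ = l * √(a / Real.pi) := by
        rw [integral_mul_const, integral_const_mul,
          GaussianFourier.integral_rexp_neg_mul_sq_norm ha]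
        simp only [finrank_euclideanSpace, Fintype.card_fin]
        norm_num
        field_simp

/-- Since `F (x + z)` vanishes unless `x + z` lies in the strip, Young's inequality can keep the
indicator of the strip on the `D` term. Averaging that indicator over `z` gives the small factor `l
√(a / π)`. -/
theorem abs_integral_normGauss_mul_crossCorr_le {D F : E3 → E3} (hD : MemLp D 2) (hF : MemLp F 2)
    {a l c : ℝ} (ha : 0 < a) (hl : 0 ≤ l) (hc : 0 < c) (hsupp : ∀ x, x ∉ strip l → F x = 0) :
    |∫ z, normGauss a z * crossCorr D F z|
      ≤ 1 / (2 * c) * (l * √(a / Real.pi)) * (∫ x, ‖D x‖ ^ 2) + c / 2 * ∫ x, ‖F x‖ ^ 2 := by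
  have hi1 : ∀ y : E3, |(strip l).indicator (1 : E3 → ℝ) y| ≤ 1 := by
    intro y; by_cases hy : y ∈ strip l <;> simp [hy]
  have hi0 : ∀ y : E3, 0 ≤ (strip l).indicator (1 : E3 → ℝ) y :=
    fun y => Set.indicator_nonneg (fun _ _ => zero_le_one) _
  have hmi : Measurable ((strip l).indicator (1 : E3 → ℝ)) :=
    measurable_one.indicator (measurableSet_strip l)
  have hD2 := integrable_norm_sq hD
  have hDi : ∀ z : E3, Integrable fun x => (strip l).indicator (1 : E3 → ℝ) (x + z) * ‖D x‖ ^ 2 :=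
    fun z => hD2.bdd_mul (c := 1) (hmi.comp (measurable_add_const z)).aestronglyMeasurable
      (Eventually.of_forall fun x => hi1 _)
  have hprod : Integrable (fun p : E3 × E3 => normGauss a p.1 *
      ((strip l).indicator (1 : E3 → ℝ) (p.2 + p.1) * ‖D p.2‖ ^ 2)) (volume.prod volume) := by
    have h1 := (integrable_normGauss ha).mul_prod hD2
    refine (h1.bdd_mul (c := 1) (f := fun p : E3 × E3 => (strip l).indicator (1 : E3 → ℝ)
      (p.2 + p.1)) ?_ (Eventually.of_forall fun x => hi1 _)).congr
        (Eventually.of_forall fun p => ?_)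
    · exact (hmi.comp (measurable_snd.add measurable_fst)).aestronglyMeasurable
    · simp only; ring
  have hpt : ∀ z, |crossCorr D F z| ≤
      1 / (2 * c) * (∫ x, (strip l).indicator (1 : E3 → ℝ) (x + z) * ‖D x‖ ^ 2)
        + c / 2 * ∫ x, ‖F x‖ ^ 2 := by
    intro z
    have hFz := memLp_comp_add hF z
    have h1 : ∫ x, ‖F x‖ ^ 2 = ∫ x, ‖F (x + z)‖ ^ 2 :=
      (integral_add_right_eq_self (fun x => ‖F x‖ ^ 2) z).symm
    rw [h1, ← integral_const_mul, ← integral_const_mul,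
      ← integral_add ((hDi z).const_mul _) ((integrable_norm_sq hFz).const_mul _)]
    refine (abs_integral_le_integral_abs).trans ?_
    refine integral_mono (integrable_inner hD hFz).abs
      (((hDi z).const_mul _).add ((integrable_norm_sq hFz).const_mul _)) fun x => ?_
    simp only
    by_cases hx : x + z ∈ strip l
    · rw [Set.indicator_of_mem hx, Pi.one_apply, one_mul]
      refine (abs_real_inner_le_norm _ _).trans ?_
      have h3 : 1 / (2 * c) * ‖D x‖ ^ 2 + c / 2 * ‖F (x + z)‖ ^ 2
          - ‖D x‖ * ‖F (x + z)‖ = 1 / (2 * c) * (‖D x‖ - c * ‖F (x + z)‖) ^ 2 := by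
        field_simp; ring
      have h4 : 0 ≤ 1 / (2 * c) * (‖D x‖ - c * ‖F (x + z)‖) ^ 2 := by positivity
      linarith
    · rw [hsupp _ hx]; simp [Set.indicator_of_notMem hx]
  have hdom : Integrable fun z => normGauss a z *
      (1 / (2 * c) * (∫ x, (strip l).indicator (1 : E3 → ℝ) (x + z) * ‖D x‖ ^ 2)
        + c / 2 * ∫ x, ‖F x‖ ^ 2) := by
    have h1 := hprod.integral_prod_left
    simp only [integral_const_mul] at h1
    refine ((h1.const_mul (1 / (2 * c))).add
      ((integrable_normGauss ha).mul_const (c / 2 * ∫ x, ‖F x‖ ^ 2))).congr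
        (Eventually.of_forall fun z => ?_)
    simp only [Pi.add_apply]; ring
  have hstep : |∫ z, normGauss a z * crossCorr D F z| ≤ ∫ z, normGauss a z *
      (1 / (2 * c) * (∫ x, (strip l).indicator (1 : E3 → ℝ) (x + z) * ‖D x‖ ^ 2)
        + c / 2 * ∫ x, ‖F x‖ ^ 2) := by
    refine (abs_integral_le_integral_abs).trans (integral_mono_of_nonneg
      (Eventually.of_forall fun z => abs_nonneg _) hdom (Eventually.of_forall fun z => ?_))
    simp only
    rw [abs_mul, abs_of_nonneg (normGauss_nonneg ha z)]
    exact mul_le_mul_of_nonneg_left (hpt z) (normGauss_nonneg ha z)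
  refine hstep.trans ?_
  have hswap : ∫ z, normGauss a z * (∫ x, (strip l).indicator (1 : E3 → ℝ) (x + z) * ‖D x‖ ^ 2)
      ≤ (l * √(a / Real.pi)) * ∫ x, ‖D x‖ ^ 2 := by
    simp only [← integral_const_mul]
    rw [integral_integral_swap hprod]
    have h2 := hprod.integral_prod_right
    refine integral_mono h2 (hD2.const_mul _) fun x => ?_
    simp only [← mul_assoc]
    rw [integral_mul_const]
    exact mul_le_mul_of_nonneg_right (integral_normGauss_indicator_strip_le ha hl x) (by positivity)
  have hsplit : ∫ z, normGauss a z *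
      (1 / (2 * c) * (∫ x, (strip l).indicator (1 : E3 → ℝ) (x + z) * ‖D x‖ ^ 2)
        + c / 2 * ∫ x, ‖F x‖ ^ 2)
      = 1 / (2 * c) * (∫ z, normGauss a z *
          (∫ x, (strip l).indicator (1 : E3 → ℝ) (x + z) * ‖D x‖ ^ 2))
        + c / 2 * ∫ x, ‖F x‖ ^ 2 := by
    have h1 := hprod.integral_prod_left
    simp only [integral_const_mul] at h1
    generalize c / 2 * ∫ x, ‖F x‖ ^ 2 = K
    have h3 : ∫ z, normGauss a z * K = K := by
      rw [integral_mul_const, integral_normGauss ha, one_mul]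
    nth_rw 2 [← h3]
    rw [← integral_const_mul, ← integral_add (h1.const_mul _)
      ((integrable_normGauss ha).mul_const _)]
    congr 1; ext z; ring
  rw [hsplit, mul_assoc]
  gcongr

/-- The energy is approximated by gaussian averages of the correlations of the field. -/
theorem IsGradProj.abs_energy_sub_le {F Du : E3 → E3} (h : IsGradProj F Du) {a b l c : ℝ}
    (ha : 0 < a) (hab : a ≤ b) (hl : 0 ≤ l) (hc : 0 < c)
    (hsupp : ∀ x, x ∉ strip l → F x = 0) :
    |(∫ x, ‖Du x‖ ^ 2)
        - ∫ s in a..b, heatWeight s * ∑ i, ∑ j, ∫ z, gaussHess s i j z * corr F i j z|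
      ≤ (c + 1 / (2 * c) * (l * √(a / Real.pi))) * (∫ x, ‖F x‖ ^ 2)
        + 1 / (2 * c) * ∫ z, normGauss b z * shiftSq F z := by
  have hb : 0 < b := ha.trans_le hab
  set r := crossCorr Du F with hr
  have hrm := aestronglyMeasurable_crossCorr h.memLp_grad h.memLp_field
  have hrb := abs_crossCorr_le h.memLp_grad h.memLp_field
  have hrint : ∀ {s : ℝ}, 0 < s → Integrable fun z => normGauss s z * r z := fun hs =>
    (integrable_normGauss hs).mul_bdd hrm (Eventually.of_forall hrb)
  have h1 : ∫ s in a..b, heatWeight s * ∑ i, ∑ j, ∫ z, gaussHess s i j z * corr F i j z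
      = (∫ z, normGauss b z * r z) - ∫ z, normGauss a z * r z := by
    have hsub : (∫ z, normGauss b z * r z) - ∫ z, normGauss a z * r z
        = ∫ z, (normGauss b z - normGauss a z) * r z := by
      rw [← integral_sub (hrint hb) (hrint ha)]
      congr 1; ext z; ring
    rw [hsub, ← integral_heatWeight_integral_gaussNegLap ha hab hrm hrb]
    refine intervalIntegral.integral_congr fun s hs => ?_
    rw [Set.uIcc_of_le hab] at hs
    rw [h.integral_gaussNegLap_mul_crossCorr (ha.trans_le hs.1)]
  -- The gaussian has mass one, so the energy `r 0` can be compared with `r z` under a single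
  -- integral.
  have h2 : ∫ x, ‖Du x‖ ^ 2 = ∫ z, normGauss b z * r 0 := by
    rw [h.integral_norm_sq_eq, integral_inner_eq_crossCorr_zero, integral_mul_const,
      integral_normGauss hb, one_mul]
  have h3 : (∫ x, ‖Du x‖ ^ 2) - (∫ z, normGauss b z * r z)
      = ∫ z, normGauss b z * (r 0 - r z) := by
    rw [h2, ← integral_sub ((integrable_normGauss hb).mul_const _) (hrint hb)]
    simp only [mul_sub]
  have hshm : AEStronglyMeasurable (shiftSq F) := by
    have : shiftSq F = fun z => 2 * (∫ x, ‖F x‖ ^ 2) - 2 * crossCorr F F z :=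
      funext fun z => shiftSq_eq h.memLp_field z
    rw [this]
    exact aestronglyMeasurable_const.sub
      ((aestronglyMeasurable_crossCorr h.memLp_field h.memLp_field).const_mul 2)
  have hshb : ∀ z, |shiftSq F z| ≤ 4 * ∫ x, ‖F x‖ ^ 2 := by
    intro z
    have h4 := abs_crossCorr_le h.memLp_field h.memLp_field z
    have h5 : 0 ≤ shiftSq F z := integral_nonneg fun x => by positivity
    rw [abs_of_nonneg h5, shiftSq_eq h.memLp_field]
    have := neg_abs_le (crossCorr F F z)
    linarith
  have hshint : Integrable fun z => normGauss b z * shiftSq F z :=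
    (integrable_normGauss hb).mul_bdd hshm (Eventually.of_forall hshb)
  have h4 : |∫ z, normGauss b z * (r 0 - r z)|
      ≤ c / 2 * (∫ x, ‖Du x‖ ^ 2) + 1 / (2 * c) * ∫ z, normGauss b z * shiftSq F z := by
    have h5 : c / 2 * (∫ x, ‖Du x‖ ^ 2) + 1 / (2 * c) * ∫ z, normGauss b z * shiftSq F z
        = ∫ z, (normGauss b z * (c / 2 * ∫ x, ‖Du x‖ ^ 2)
            + 1 / (2 * c) * (normGauss b z * shiftSq F z)) := by
      rw [integral_add ((integrable_normGauss hb).mul_const _) (hshint.const_mul _),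
        integral_mul_const, integral_normGauss hb, one_mul, integral_const_mul]
    rw [h5]
    refine (abs_integral_le_integral_abs).trans (integral_mono_of_nonneg
      (Eventually.of_forall fun z => abs_nonneg _)
      (((integrable_normGauss hb).mul_const _).add (hshint.const_mul _))
      (Eventually.of_forall fun z => ?_))
    simp only [abs_mul]
    rw [abs_of_nonneg (normGauss_nonneg hb z)]
    calc normGauss b z * |r 0 - r z| ≤ normGauss b z *
          (c / 2 * (∫ x, ‖Du x‖ ^ 2) + 1 / (2 * c) * shiftSq F z) :=
          mul_le_mul_of_nonneg_left
            (abs_crossCorr_zero_sub_le h.memLp_grad h.memLp_field hc z) (normGauss_nonneg hb z)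
      _ = _ := by ring
  have h6 := abs_integral_normGauss_mul_crossCorr_le h.memLp_grad h.memLp_field ha hl hc hsupp
  have h7 := h.integral_norm_sq_le
  have h8 : 0 ≤ 1 / (2 * c) * (l * √(a / Real.pi)) := by positivity
  have h9 := mul_le_mul_of_nonneg_left h7 h8
  have h10 := mul_le_mul_of_nonneg_left h7 (by positivity : 0 ≤ c / 2)
  rw [h1, show (∫ x, ‖Du x‖ ^ 2) - ((∫ z, normGauss b z * r z) - ∫ z, normGauss a z * r z)
    = (∫ z, normGauss b z * (r 0 - r z)) + ∫ z, normGauss a z * r z by rw [← h3]; ring]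
  refine (abs_add_le _ _).trans ?_
  linarith

/-! ### Periodic functions on the plane -/

/-- The standard basis of the plane. -/
def stdBasis : Module.Basis (Fin 2) ℝ E2 := (EuclideanSpace.basisFun (Fin 2) ℝ).toBasis

theorem stdBasis_apply (i : Fin 2) : stdBasis i = EuclideanSpace.single i 1 := by
  simp [stdBasis]

theorem QPeriodic.add_mem_span {f : E2 → ℝ} (hf : QPeriodic f) {v : E2}
    (hv : v ∈ Submodule.span ℤ (Set.range stdBasis)) (x : E2) : f (v + x) = f x := by
  induction hv using Submodule.span_induction generalizing x with
  | mem v hv =>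
    obtain ⟨i, rfl⟩ := hv
    rw [stdBasis_apply, add_comm]
    exact hf x i
  | zero => rw [zero_add]
  | add v w _ _ h1 h2 => rw [add_assoc, h1, h2]
  | smul n v _ h =>
    have hn : ∀ k : ℕ, ∀ x, f ((k : ℤ) • v + x) = f x := by
      intro k
      induction k with
      | zero => intro x; simp
      | succ k ih =>
        intro x
        rw [show ((k + 1 : ℕ) : ℤ) • v + x = (k : ℤ) • v + (v + x) by
          push_cast; rw [add_smul, one_smul, add_assoc], ih, h]
    obtain ⟨k, rfl | rfl⟩ := n.eq_nat_or_neg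
    · exact hn k x
    · rw [← hn k (-(k : ℤ) • v + x)]
      congr 1
      rw [neg_smul]; abel

theorem mem_fundamentalDomain_iff (x : E2) :
    x ∈ ZSpan.fundamentalDomain stdBasis ↔ ∀ i, x i ∈ Set.Ico (0 : ℝ) 1 := by
  rw [ZSpan.mem_fundamentalDomain]; rfl

theorem cellQ_ae_eq_fundamentalDomain :
    cellQ =ᵐ[volume] ZSpan.fundamentalDomain stdBasis := by
  have hmp := EuclideanSpace.volume_preserving_symm_measurableEquiv_toLp (Fin 2)
  have h1 : (Set.univ.pi fun _ : Fin 2 => Set.Ioo (0 : ℝ) 1)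
      =ᵐ[volume] Set.univ.pi fun _ : Fin 2 => Set.Ico (0 : ℝ) 1 :=
    (Measure.univ_pi_Ioo_ae_eq_Icc (μ := fun _ : Fin 2 => (volume : Measure ℝ))
      (f := fun _ => 0) (g := fun _ => 1)).trans
      (Measure.univ_pi_Ico_ae_eq_Icc (μ := fun _ : Fin 2 => (volume : Measure ℝ))
        (f := fun _ => 0) (g := fun _ => 1)).symm
  have h2 := hmp.quasiMeasurePreserving.preimage_ae_eq h1
  have h3 : cellQ = (MeasurableEquiv.toLp 2 (Fin 2 → ℝ)).symm ⁻¹'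
      (Set.univ.pi fun _ : Fin 2 => Set.Ioo (0 : ℝ) 1) := by
    ext x; simp [cellQ]
  have h4 : ZSpan.fundamentalDomain stdBasis = (MeasurableEquiv.toLp 2 (Fin 2 → ℝ)).symm ⁻¹'
      (Set.univ.pi fun _ : Fin 2 => Set.Ico (0 : ℝ) 1) := by
    ext x
    rw [mem_fundamentalDomain_iff]
    simp
  rw [h3, h4]
  exact h2

theorem volume_cellQ : volume cellQ = 1 := by
  have hmp := EuclideanSpace.volume_preserving_symm_measurableEquiv_toLp (Fin 2)
  have h : cellQ = (MeasurableEquiv.toLp 2 (Fin 2 → ℝ)).symm ⁻¹'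
      (Set.univ.pi fun _ : Fin 2 => Set.Ioo (0 : ℝ) 1) := by
    ext x; simp [cellQ]
  rw [h, hmp.measure_preimage_equiv, Real.volume_pi_Ioo]
  simp

instance isProbabilityMeasure_cellQ : IsProbabilityMeasure (volume.restrict cellQ) :=
  ⟨by rw [Measure.restrict_apply_univ, volume_cellQ]⟩

theorem norm_lt_two_of_mem_cellQ {x : E2} (hx : x ∈ cellQ) : ‖x‖ < 2 := by
  have h : ‖x‖ ^ 2 = x 0 ^ 2 + x 1 ^ 2 := by
    rw [EuclideanSpace.real_norm_sq_eq, Fin.sum_univ_two]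
  have h0 := hx 0
  have h1 := hx 1
  refine lt_of_pow_lt_pow_left₀ 2 (by norm_num) ?_
  rw [h]
  nlinarith [h0.1, h0.2, h1.1, h1.2]

/-- Up to a null set the cell is a fundamental domain of the integer lattice. So is its translate,
and a periodic function has the same integral over both. -/
theorem QPeriodic.setIntegral_cellQ_add {f : E2 → ℝ} (hf : QPeriodic f) (v : E2) :
    ∫ x in cellQ, f (x + v) = ∫ x in cellQ, f x := by
  have hfd := ZSpan.isAddFundamentalDomain' stdBasis (volume : Measure E2)
  have : Countable (Submodule.span ℤ (Set.range stdBasis)).toAddSubgroup :=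
    inferInstanceAs (Countable (Submodule.span ℤ (Set.range stdBasis)))
  have hinv : ∀ (g : (Submodule.span ℤ (Set.range stdBasis)).toAddSubgroup) (x : E2), f (g +ᵥ x) = f x :=
    fun g x => hf.add_mem_span g.2 x
  rw [setIntegral_congr_set cellQ_ae_eq_fundamentalDomain,
    setIntegral_congr_set cellQ_ae_eq_fundamentalDomain,
    hfd.setIntegral_eq (hfd.vadd_of_comm v) hinv]
  have h1 := (measurePreserving_add_right (volume : Measure E2) v).setIntegral_image_emb
    (measurableEmbedding_addRight v) f (ZSpan.fundamentalDomain stdBasis)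
  rw [← h1]
  congr 2
  ext x
  simp only [Set.mem_vadd_set, Set.mem_image, vadd_eq_add, add_comm v]

/-- Every value is taken at a fractional part, which lies in the compact ball of radius 2. -/
theorem QPeriodic.exists_bound {f : E2 → ℝ} (hf : QPeriodic f) (hc : Continuous f) :
    ∃ B : ℝ, 0 < B ∧ ∀ x, |f x| ≤ B := by
  obtain ⟨B, hB⟩ := (isCompact_closedBall (0 : E2) 2).exists_bound_of_continuousOn hc.continuousOn
  refine ⟨|B| + 1, by positivity, fun x => ?_⟩
  have h1 : f (ZSpan.fract stdBasis x) = f x := by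
    rw [ZSpan.fract_apply, sub_eq_neg_add]
    exact hf.add_mem_span (neg_mem (Subtype.coe_prop _)) x
  have h2 := (mem_fundamentalDomain_iff _).1 (ZSpan.fract_mem_fundamentalDomain stdBasis x)
  have h3 : ZSpan.fract stdBasis x ∈ Metric.closedBall (0 : E2) 2 := by
    rw [mem_closedBall_zero_iff]
    have h : ‖ZSpan.fract stdBasis x‖ ^ 2
        = ZSpan.fract stdBasis x 0 ^ 2 + ZSpan.fract stdBasis x 1 ^ 2 := by
      rw [EuclideanSpace.real_norm_sq_eq, Fin.sum_univ_two]
    refine (pow_le_pow_iff_left₀ (norm_nonneg _) (by norm_num) two_ne_zero).1 ?_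
    rw [h]
    nlinarith [(h2 0).1, (h2 0).2, (h2 1).1, (h2 1).2]
  rw [← h1]
  exact (hB _ h3).trans ((le_abs_self B).trans (by linarith))

/-! ### Translations in `L¹` and averaging -/

/-- Translations act continuously on `L¹`; the integral is the norm of the difference between the
class of `g` and its translate. -/
theorem tendsto_integral_abs_translate_sub {g : E2 → ℝ} (hg : Integrable g) :
    Tendsto (fun v : E2 => ∫ x, |g (x + v) - g x|) (𝓝 0) (𝓝 0) := by
  have : Fact ((1 : ENNReal) ≠ ⊤) := ⟨by simp⟩
  have hg1 : MemLp g 1 := memLp_one_iff_integrable.2 hg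
  have hgv : ∀ v : E2, Integrable fun x => g (v +ᵥ x) := fun v => by
    simpa only [vadd_eq_add, add_comm v] using hg.comp_add_right v
  have hc : Continuous fun v : E2 => (DomAddAct.mk v +ᵥ hg1.toLp g : Lp ℝ 1 (volume : Measure E2)) :=
    (DomAddAct.continuous_mk).vadd continuous_const
  have h1 := (hc.tendsto 0).sub_const (hg1.toLp g) |>.norm
  have h2 : (DomAddAct.mk (0 : E2) +ᵥ hg1.toLp g : Lp ℝ 1 (volume : Measure E2)) = hg1.toLp g := by
    rw [DomAddAct.mk_vadd_toLp]
    simp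
  rw [h2, sub_self, norm_zero] at h1
  refine h1.congr fun v => ?_
  rw [DomAddAct.mk_vadd_toLp, ← MemLp.toLp_sub, L1.norm_eq_integral_norm]
  refine integral_congr_ae ?_
  filter_upwards [MemLp.coeFn_toLp ((memLp_one_iff_integrable.2 (hgv v)).sub hg1)] with x hx
  rw [hx]
  simp [add_comm]

/-- If the phase of `Φ` is shifted by `q` and averaged over `q` in the cell, the limit value is
obtained exactly for each `ε`. Shifting the phase by `q` amounts to translating `g` by `ε q`, and
the cost is at most `sup |Φ|` times the `L¹` modulus of continuity of `g`. -/
theorem tendsto_integral_mul_periodic {g : E2 → ℝ} (hg : Integrable g) {Φ : E2 → ℝ}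
    (hΦ : Continuous Φ) (hper : QPeriodic Φ) :
    Tendsto (fun ε : ℝ => ∫ x, g x * Φ (ε⁻¹ • x)) (𝓝[>] 0)
      (𝓝 ((∫ x, g x) * ∫ x in cellQ, Φ x)) := by
  obtain ⟨B, hB0, hB⟩ := hper.exists_bound hΦ
  rw [Metric.tendsto_nhdsWithin_nhds]
  intro δ hδ
  obtain ⟨ρ, hρ, hτ⟩ := Metric.tendsto_nhds_nhds.1 (tendsto_integral_abs_translate_sub hg)
    (δ / (2 * B)) (by positivity)
  refine ⟨ρ / 2, by positivity, fun ε hε hερ => ?_⟩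
  have hε0 : 0 < ε := hε
  rw [Real.dist_eq, sub_zero, abs_of_pos hε0] at hερ
  have hbd : ∀ q : E2, Integrable fun x => g x * Φ (ε⁻¹ • x + q) := fun q =>
    hg.mul_bdd (c := B) (Continuous.aestronglyMeasurable (by fun_prop))
      (Eventually.of_forall fun x => hB _)
  have hprod : Integrable (fun p : E2 × E2 => g p.2 * Φ (ε⁻¹ • p.2 + p.1))
      ((volume.restrict cellQ).prod volume) := by
    have h1 : Integrable (fun p : E2 × E2 => g p.2) ((volume.restrict cellQ).prod volume) :=
      hg.comp_snd _
    exact h1.mul_bdd (c := B) (Continuous.aestronglyMeasurable (by fun_prop))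
      (Eventually.of_forall fun x => hB _)
  have hJ : ∫ q in cellQ, (∫ x, g x * Φ (ε⁻¹ • x + q)) = (∫ x, g x) * ∫ x in cellQ, Φ x := by
    rw [integral_integral_swap hprod, ← integral_mul_const]
    refine integral_congr_ae (Eventually.of_forall fun x => ?_)
    simp only
    rw [integral_const_mul]
    simp only [add_comm (ε⁻¹ • x), hper.setIntegral_cellQ_add]
  have hI : ∫ x, g x * Φ (ε⁻¹ • x) = ∫ q in cellQ, (∫ x, g x * Φ (ε⁻¹ • x)) := by
    rw [integral_const]; simp
  rw [hI, ← hJ, Real.dist_eq, ← integral_sub (integrable_const _) hprod.integral_prod_left]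
  have hpt : ∀ q ∈ cellQ, ‖(∫ x, g x * Φ (ε⁻¹ • x)) - ∫ x, g x * Φ (ε⁻¹ • x + q)‖ ≤ δ / 2 := by
    intro q hq
    have h1 : ∫ x, g x * Φ (ε⁻¹ • x) = ∫ x, g (x + ε • q) * Φ (ε⁻¹ • x + q) := by
      rw [← integral_add_right_eq_self (fun x => g x * Φ (ε⁻¹ • x)) (ε • q)]
      simp only [smul_add, smul_smul, inv_mul_cancel₀ hε0.ne', one_smul]
    have hgq : Integrable fun x => g (x + ε • q) := hg.comp_add_right _
    have h2 : Integrable fun x => g (x + ε • q) * Φ (ε⁻¹ • x + q) :=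
      hgq.mul_bdd (c := B) (Continuous.aestronglyMeasurable (by fun_prop))
        (Eventually.of_forall fun x => hB _)
    -- Points of the cell have norm below 2, hence the choice `ε < ρ / 2`.
    have h3 : ‖ε • q‖ < ρ := by
      rw [norm_smul, Real.norm_of_nonneg hε0.le]
      have := norm_lt_two_of_mem_cellQ hq
      nlinarith [norm_nonneg q]
    have h4 := hτ (x := ε • q) (by simpa [dist_zero_right] using h3)
    rw [Real.dist_eq, sub_zero, abs_of_nonneg (integral_nonneg fun x => abs_nonneg _)] at h4
    rw [h1, ← integral_sub h2 (hbd q)]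
    calc ‖∫ x, (g (x + ε • q) * Φ (ε⁻¹ • x + q) - g x * Φ (ε⁻¹ • x + q))‖
        ≤ ∫ x, |g (x + ε • q) - g x| * B := by
          refine norm_integral_le_of_norm_le ((hgq.sub hg).abs.mul_const B)
            (Eventually.of_forall fun x => ?_)
          rw [← sub_mul, norm_mul]
          exact mul_le_mul_of_nonneg_left (hB _) (abs_nonneg _)
      _ = (∫ x, |g (x + ε • q) - g x|) * B := integral_mul_const _ _
      _ ≤ δ / (2 * B) * B := by gcongr
      _ = δ / 2 := by field_simp
  have h5 := norm_setIntegral_le_of_norm_le_const (μ := volume) (s := cellQ)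
    (by rw [volume_cellQ]; simp) hpt
  rw [Measure.real, volume_cellQ, ENNReal.toReal_one, mul_one] at h5
  rw [← Real.norm_eq_abs]
  linarith

/-! ### Fields on a thin layer and their correlations -/

/-- The length of the vertical overlap of the layer `f₁ < t < f₂` with its translate by `-z`. -/
def overlap (f₁ f₂ : E2 → ℝ) (z : E3) (x : E2) : ℝ :=
  max (min (f₂ x) (f₂ (x + horiz z) - z 2) - max (f₁ x) (f₁ (x + horiz z) - z 2)) 0

/-- The correlation of the periodic layer with itself, per unit cell. -/
def cellCorr (f₁ f₂ : E2 → ℝ) (z : E3) : ℝ := ∫ x in cellQ, overlap f₁ f₂ z x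

/-- The field `m(x')` on the layer `ε f₁(x'/ε) < x₃ < ε f₂(x'/ε)`, and zero elsewhere. -/
def layerField (f₁ f₂ : E2 → ℝ) (ε : ℝ) (m : E2 → E3) : E3 → E3 :=
  (film Set.univ f₁ f₂ ε).indicator fun x => m (horiz x)

theorem continuous_overlap {f₁ f₂ : E2 → ℝ} (h₁ : Continuous f₁) (h₂ : Continuous f₂) (z : E3) :
    Continuous (overlap f₁ f₂ z) := by
  unfold overlap; fun_prop

theorem continuous_overlap_uncurry {f₁ f₂ : E2 → ℝ} (h₁ : Continuous f₁) (h₂ : Continuous f₂) :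
    Continuous fun p : E3 × E2 => overlap f₁ f₂ p.1 p.2 := by
  unfold overlap
  have := continuous_horiz
  fun_prop

theorem qPeriodic_overlap {f₁ f₂ : E2 → ℝ} (h₁ : QPeriodic f₁) (h₂ : QPeriodic f₂) (z : E3) :
    QPeriodic (overlap f₁ f₂ z) := by
  intro x i
  have h : ∀ f : E2 → ℝ, QPeriodic f →
      f (x + EuclideanSpace.single i 1 + horiz z) = f (x + horiz z) := by
    intro f hf
    rw [add_right_comm]
    exact hf _ i
  simp only [overlap, h₁ x i, h₂ x i, h f₁ h₁, h f₂ h₂]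

theorem overlap_nonneg (f₁ f₂ : E2 → ℝ) (z : E3) (x : E2) : 0 ≤ overlap f₁ f₂ z x :=
  le_max_right _ _

theorem overlap_le {f₁ f₂ : E2 → ℝ} {B : ℝ} (h₁ : ∀ x, 0 < f₁ x) (h₂ : ∀ x, f₂ x ≤ B) (hB : 0 ≤ B)
    (z : E3) (x : E2) : overlap f₁ f₂ z x ≤ B := by
  refine max_le ?_ hB
  have h3 := min_le_left (f₂ x) (f₂ (x + horiz z) - z 2)
  have h4 := le_max_left (f₁ x) (f₁ (x + horiz z) - z 2)
  linarith [h₁ x, h₂ x]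

theorem measurableSet_film_univ {f₁ f₂ : E2 → ℝ} (h₁ : Continuous f₁) (h₂ : Continuous f₂) (ε : ℝ) :
    MeasurableSet (film Set.univ f₁ f₂ ε) := by
  have hh := continuous_horiz
  have e : film Set.univ f₁ f₂ ε = {x | ε * f₁ (ε⁻¹ • horiz x) < x 2}
      ∩ {x | x 2 < ε * f₂ (ε⁻¹ • horiz x)} := by
    ext x; simp [film]
  rw [e]
  exact ((isOpen_lt (by fun_prop) (by fun_prop)).inter
    (isOpen_lt (by fun_prop) (by fun_prop))).measurableSet

theorem layerField_lift3 (f₁ f₂ : E2 → ℝ) (ε : ℝ) (m : E2 → E3) (i : Fin 3) (x : E2) (t : ℝ) :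
    layerField f₁ f₂ ε m (lift3 x t) i
      = (Set.Ioo (ε * f₁ (ε⁻¹ • x)) (ε * f₂ (ε⁻¹ • x))).indicator (fun _ => m x i) t := by
  by_cases h : t ∈ Set.Ioo (ε * f₁ (ε⁻¹ • x)) (ε * f₂ (ε⁻¹ • x))
  · rw [Set.indicator_of_mem h, layerField, Set.indicator_of_mem]
    · simp
    · simpa [film] using h
  · rw [Set.indicator_of_notMem h, layerField, Set.indicator_of_notMem]
    · simp
    · simpa [film] using h

theorem quasiMeasurePreserving_horiz : Measure.QuasiMeasurePreserving horiz := by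
  have h1 := measurePreserving_splitEquiv.quasiMeasurePreserving
  have h2 := (Measure.quasiMeasurePreserving_fst (μ := (volume : Measure E2))
    (ν := (volume : Measure ℝ))).comp h1
  refine ⟨continuous_horiz.measurable, ?_⟩
  have h3 := h2.absolutelyContinuous
  have e : Prod.fst ∘ splitEquiv = horiz := funext fun x => by simp [splitEquiv_apply]
  rwa [e] at h3

theorem memLp_layerField {f₁ f₂ : E2 → ℝ} (h₁ : Continuous f₁) (h₂ : Continuous f₂) {B : ℝ}
    (hf₁ : ∀ x, 0 < f₁ x) (hf₂ : ∀ x, f₂ x ≤ B) {ε : ℝ} (hε : 0 < ε) {m : E2 → E3}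
    (hm : MemLp m 2) : MemLp (layerField f₁ f₂ ε m) 2 := by
  have hmeas : AEStronglyMeasurable (layerField f₁ f₂ ε m) :=
    (hm.aestronglyMeasurable.comp_quasiMeasurePreserving quasiMeasurePreserving_horiz).indicator
      (measurableSet_film_univ h₁ h₂ ε)
  refine memLp_of_coord fun i => ?_
  have hmeasi : AEStronglyMeasurable fun x => layerField f₁ f₂ ε m x i :=
    (EuclideanSpace.proj i : E3 →L[ℝ] ℝ).continuous.comp_aestronglyMeasurable hmeas
  rw [memLp_two_iff_integrable_sq hmeasi]
  have h3 : Integrable (fun p : E2 × ℝ => m p.1 i ^ 2 * (Set.Ioo 0 (ε * B)).indicator 1 p.2)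
      (volume.prod volume) := by
    refine (memLp_coord hm i).integrable_sq.mul_prod ?_
    exact (integrable_indicator_iff measurableSet_Ioo).2 (integrableOn_const (by simp) (by simp))
  refine integrable_comp_lift3_iff.1 (h3.mono' ?_ (Eventually.of_forall fun p => ?_))
  · have := (hmeasi.pow 2).comp_quasiMeasurePreserving
      (measurePreserving_splitEquiv.symm).quasiMeasurePreserving
    refine this.congr (Eventually.of_forall fun p => ?_)
    simp [splitEquiv_symm_apply]
  · rw [layerField_lift3]
    by_cases h : p.2 ∈ Set.Ioo (ε * f₁ (ε⁻¹ • p.1)) (ε * f₂ (ε⁻¹ • p.1))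
    · have h4 : p.2 ∈ Set.Ioo 0 (ε * B) :=
        ⟨(mul_pos hε (hf₁ _)).trans h.1, h.2.trans_le (mul_le_mul_of_nonneg_left (hf₂ _) hε.le)⟩
      rw [Set.indicator_of_mem h, Set.indicator_of_mem h4]
      simp
    · rw [Set.indicator_of_notMem h]
      simp only [ne_eq, OfNat.ofNat_ne_zero, not_false_eq_true, zero_pow, norm_zero]
      exact mul_nonneg (sq_nonneg _) (Set.indicator_nonneg (fun _ _ => zero_le_one) _)

/-- On a vertical line the integrand is a constant times the indicator of the intersection of two
intervals. Measured in units of `ε`, its length is `overlap`; this accounts for the factor `ε`. -/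
theorem corr_layerField {f₁ f₂ : E2 → ℝ} (h₁ : Continuous f₁) (h₂ : Continuous f₂) {B : ℝ}
    (hf₁ : ∀ x, 0 < f₁ x) (hf₂ : ∀ x, f₂ x ≤ B) {ε : ℝ} (hε : 0 < ε) {m : E2 → E3}
    (hm : MemLp m 2) (i j : Fin 3) (z : E3) :
    corr (layerField f₁ f₂ ε m) i j (ε • z)
      = ε * ∫ x, m x i * m (x + ε • horiz z) j * overlap f₁ f₂ z (ε⁻¹ • x) := by
  have hF := memLp_layerField h₁ h₂ hf₁ hf₂ hε hm
  have hint : Integrable fun x => layerField f₁ f₂ ε m x i * layerField f₁ f₂ ε m (x + ε • z) j :=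
    (memLp_coord hF i).integrable_mul (memLp_coord (memLp_comp_add hF (ε • z)) j)
  rw [corr, integral_eq_integral_lift3 hint, ← integral_const_mul]
  refine integral_congr_ae (Eventually.of_forall fun x => ?_)
  simp only
  have hadd : ∀ t, lift3 x t + ε • z = lift3 (x + ε • horiz z) (t + ε * z 2) := by
    intro t
    ext k; fin_cases k <;> simp [lift3]
  have hscale : ε⁻¹ • (x + ε • horiz z) = ε⁻¹ • x + horiz z := by
    rw [smul_add, smul_smul, inv_mul_cancel₀ hε.ne', one_smul]
  set w := ε⁻¹ • x with hw
  set p := ε * max (f₁ w) (f₁ (w + horiz z) - z 2) with hp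
  set q := ε * min (f₂ w) (f₂ (w + horiz z) - z 2) with hq
  have hpt : ∀ t, layerField f₁ f₂ ε m (lift3 x t) i * layerField f₁ f₂ ε m (lift3 x t + ε • z) j
      = (Set.Ioo p q).indicator (fun _ => m x i * m (x + ε • horiz z) j) t := by
    intro t
    rw [hadd, layerField_lift3, layerField_lift3, hscale, ← hw]
    have hiff : t ∈ Set.Ioo p q ↔ t ∈ Set.Ioo (ε * f₁ w) (ε * f₂ w) ∧
        t + ε * z 2 ∈ Set.Ioo (ε * f₁ (w + horiz z)) (ε * f₂ (w + horiz z)) := by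
      simp only [hp, hq, mul_max_of_nonneg _ _ hε.le, mul_min_of_nonneg _ _ hε.le, Set.mem_Ioo,
        max_lt_iff, lt_min_iff, mul_sub]
      constructor
      · rintro ⟨⟨h1, h2⟩, h3, h4⟩
        exact ⟨⟨h1, h3⟩, by linarith, by linarith⟩
      · rintro ⟨⟨h1, h3⟩, h2, h4⟩
        exact ⟨⟨h1, by linarith⟩, h3, by linarith⟩
    by_cases ht : t ∈ Set.Ioo p q
    · rw [Set.indicator_of_mem ht, Set.indicator_of_mem (hiff.1 ht).1,
        Set.indicator_of_mem (hiff.1 ht).2]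
    · rw [Set.indicator_of_notMem ht]
      by_cases ht1 : t ∈ Set.Ioo (ε * f₁ w) (ε * f₂ w)
      · have : t + ε * z 2 ∉ Set.Ioo (ε * f₁ (w + horiz z)) (ε * f₂ (w + horiz z)) :=
          fun h => ht (hiff.2 ⟨ht1, h⟩)
        rw [Set.indicator_of_notMem this, mul_zero]
      · rw [Set.indicator_of_notMem ht1, zero_mul]
  simp only [hpt]
  rw [integral_indicator measurableSet_Ioo, setIntegral_const, Real.volume_real_Ioo, smul_eq_mul,
    overlap]
  have : max (q - p) 0 = ε * max (min (f₂ w) (f₂ (w + horiz z) - z 2)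
      - max (f₁ w) (f₁ (w + horiz z) - z 2)) 0 := by
    rw [mul_max_of_nonneg _ _ hε.le, mul_zero, mul_sub]
  rw [this]; ring

/-- Convergence of products of a strongly convergent bounded family with its small translates. -/
theorem tendsto_integral_abs_mul_translate_sub {p q : ℝ → E2 → ℝ} {p₀ q₀ : E2 → ℝ}
    (hp : ∀ ε, 0 < ε → Integrable (p ε)) (hq : ∀ ε, 0 < ε → Integrable (q ε))
    (hp₀ : Integrable p₀) (hq₀ : Integrable q₀)
    (hp1 : ∀ ε x, |p ε x| ≤ 1) (hq01 : ∀ x, |q₀ x| ≤ 1)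
    (hplim : Tendsto (fun ε => ∫ x, |p ε x - p₀ x|) (𝓝[>] 0) (𝓝 0))
    (hqlim : Tendsto (fun ε => ∫ x, |q ε x - q₀ x|) (𝓝[>] 0) (𝓝 0)) (v : E2) :
    Tendsto (fun ε => ∫ x, |p ε x * q ε (x + ε • v) - p₀ x * q₀ x|) (𝓝[>] 0) (𝓝 0) := by
  have htr : Tendsto (fun ε : ℝ => ∫ x, |q₀ (x + ε • v) - q₀ x|) (𝓝[>] 0) (𝓝 0) := by
    refine (tendsto_integral_abs_translate_sub hq₀).comp ?_
    have : Tendsto (fun ε : ℝ => ε • v) (𝓝 0) (𝓝 ((0 : ℝ) • v)) :=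
      (continuous_id.smul continuous_const).tendsto 0
    rw [zero_smul] at this
    exact this.mono_left nhdsWithin_le_nhds
  have hsum := (hqlim.add htr).add hplim
  simp only [add_zero] at hsum
  refine squeeze_zero' (Eventually.of_forall fun ε => integral_nonneg fun x => abs_nonneg _) ?_ hsum
  filter_upwards [self_mem_nhdsWithin] with ε hε
  have hε0 : 0 < ε := hε
  have hi1 : Integrable fun x => |q ε (x + ε • v) - q₀ (x + ε • v)| :=
    (((hq ε hε0).sub hq₀).comp_add_right (ε • v)).abs
  have hi2 : Integrable fun x => |q₀ (x + ε • v) - q₀ x| :=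
    ((hq₀.comp_add_right (ε • v)).sub hq₀).abs
  have hi3 : Integrable fun x => |p ε x - p₀ x| := ((hp ε hε0).sub hp₀).abs
  have hi12 : Integrable fun x =>
      |q ε (x + ε • v) - q₀ (x + ε • v)| + |q₀ (x + ε • v) - q₀ x| := hi1.add hi2
  rw [← integral_add_right_eq_self (fun x => |q ε x - q₀ x|) (ε • v), ← integral_add hi1 hi2,
    ← integral_add hi12 hi3]
  refine integral_mono_of_nonneg (Eventually.of_forall fun x => abs_nonneg _)
    (hi12.add hi3) (Eventually.of_forall fun x => ?_)
  -- In each of the three terms one factor is bounded by one and the other tends to zero in `L¹`.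
  have e : p ε x * q ε (x + ε • v) - p₀ x * q₀ x
      = p ε x * (q ε (x + ε • v) - q₀ (x + ε • v)) + p ε x * (q₀ (x + ε • v) - q₀ x)
        + (p ε x - p₀ x) * q₀ x := by ring
  simp only
  rw [e]
  refine (abs_add_le _ _).trans (add_le_add ((abs_add_le _ _).trans (add_le_add ?_ ?_)) ?_)
  · rw [abs_mul]; exact mul_le_of_le_one_left (abs_nonneg _) (hp1 ε x)
  · rw [abs_mul]; exact mul_le_of_le_one_left (abs_nonneg _) (hp1 ε x)
  · rw [abs_mul]; exact mul_le_of_le_one_right (abs_nonneg _) (hq01 x)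

/-- The setting of the limit: bounded fields on the plane that converge in `L¹`. -/
structure BoundedConv (m : ℝ → E2 → E3) (m₀ : E2 → E3) : Prop where
  integrable : ∀ ε, 0 < ε → Integrable (m ε)
  integrable_lim : Integrable m₀
  norm_le : ∀ ε x, ‖m ε x‖ ≤ 1
  norm_lim_le : ∀ x, ‖m₀ x‖ ≤ 1
  tendsto : Tendsto (fun ε => ∫ x, ‖m ε x - m₀ x‖) (𝓝[>] 0) (𝓝 0)

theorem memLp_two_of_integrable_of_norm_le {α G : Type*} [MeasurableSpace α] {μ : Measure α}
    [NormedAddCommGroup G] {m : α → G} (hm : Integrable m μ) (h1 : ∀ x, ‖m x‖ ≤ 1) :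
    MemLp m 2 μ := by
  rw [memLp_two_iff_integrable_sq_norm hm.aestronglyMeasurable]
  refine hm.norm.mono' (hm.aestronglyMeasurable.norm.pow 2) (Eventually.of_forall fun x => ?_)
  rw [Real.norm_of_nonneg (by positivity), sq]
  exact mul_le_of_le_one_left (norm_nonneg _) (h1 x)

namespace BoundedConv

variable {m : ℝ → E2 → E3} {m₀ : E2 → E3}

theorem memLp (h : BoundedConv m m₀) {ε : ℝ} (hε : 0 < ε) : MemLp (m ε) 2 :=
  memLp_two_of_integrable_of_norm_le (h.integrable ε hε) (h.norm_le ε)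

theorem memLp_lim (h : BoundedConv m m₀) : MemLp m₀ 2 :=
  memLp_two_of_integrable_of_norm_le h.integrable_lim h.norm_lim_le

theorem tendsto_coord (h : BoundedConv m m₀) (i : Fin 3) :
    Tendsto (fun ε => ∫ x, |m ε x i - m₀ x i|) (𝓝[>] 0) (𝓝 0) := by
  refine squeeze_zero' (Eventually.of_forall fun ε => integral_nonneg fun x => abs_nonneg _) ?_
    h.tendsto
  filter_upwards [self_mem_nhdsWithin] with ε hε
  refine integral_mono_of_nonneg (Eventually.of_forall fun x => abs_nonneg _)
    ((h.integrable ε hε).sub h.integrable_lim).norm (Eventually.of_forall fun x => ?_)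
  exact abs_apply_le_norm (m ε x - m₀ x) i

theorem integrable_coord_mul (h : BoundedConv m m₀) (i j : Fin 3) :
    Integrable fun x => m₀ x i * m₀ x j :=
  (memLp_coord h.memLp_lim i).integrable_mul (memLp_coord h.memLp_lim j)

/-- Replacing the fields by their limit costs an `L¹` error times the bound `B` of the overlap.
Afterwards the slow factor `m₀ᵢ m₀ⱼ` and the oscillating overlap separate by averaging. -/
theorem tendsto_corr (h : BoundedConv m m₀) {f₁ f₂ : E2 → ℝ} (h₁ : Continuous f₁)
    (h₂ : Continuous f₂) (hp₁ : QPeriodic f₁) (hp₂ : QPeriodic f₂) {B : ℝ} (hB : 0 ≤ B)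
    (hf₁ : ∀ x, 0 < f₁ x) (hf₂ : ∀ x, f₂ x ≤ B) (i j : Fin 3) (z : E3) :
    Tendsto (fun ε => ε⁻¹ * corr (layerField f₁ f₂ ε (m ε)) i j (ε • z)) (𝓝[>] 0)
      (𝓝 ((∫ x, m₀ x i * m₀ x j) * cellCorr f₁ f₂ z)) := by
  have hcoord : ∀ ε, 0 < ε → ∀ k, Integrable fun x => m ε x k := fun ε hε k =>
    memLp_one_iff_integrable.1 (memLp_coord (memLp_one_iff_integrable.2 (h.integrable ε hε)) k)
  have hcoord₀ : ∀ k, Integrable fun x => m₀ x k := fun k =>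
    memLp_one_iff_integrable.1 (memLp_coord (memLp_one_iff_integrable.2 h.integrable_lim) k)
  have hlim := tendsto_integral_abs_mul_translate_sub (p := fun ε x => m ε x i)
    (q := fun ε x => m ε x j) (fun ε hε => hcoord ε hε i) (fun ε hε => hcoord ε hε j) (hcoord₀ i)
    (hcoord₀ j) (fun ε x => (abs_apply_le_norm _ _).trans (h.norm_le ε x))
    (fun x => (abs_apply_le_norm _ _).trans (h.norm_lim_le x))
    (h.tendsto_coord i) (h.tendsto_coord j) (horiz z)
  have hΦ := continuous_overlap h₁ h₂ z
  have havg := tendsto_integral_mul_periodic (h.integrable_coord_mul i j) hΦ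
    (qPeriodic_overlap hp₁ hp₂ z)
  have hbd : ∀ x, ‖overlap f₁ f₂ z x‖ ≤ B := fun x => by
    rw [Real.norm_of_nonneg (overlap_nonneg _ _ _ _)]
    exact overlap_le hf₁ hf₂ hB z x
  have hdiff : Tendsto (fun ε => ε⁻¹ * corr (layerField f₁ f₂ ε (m ε)) i j (ε • z)
      - ∫ x, m₀ x i * m₀ x j * overlap f₁ f₂ z (ε⁻¹ • x)) (𝓝[>] 0) (𝓝 0) := by
    have hlimB := hlim.mul_const B
    rw [zero_mul] at hlimB
    refine squeeze_zero_norm' ?_ hlimB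
    filter_upwards [self_mem_nhdsWithin] with ε hε
    have hε0 : 0 < ε := hε
    rw [corr_layerField h₁ h₂ hf₁ hf₂ hε0 (h.memLp hε0), ← mul_assoc, inv_mul_cancel₀ hε0.ne',
      one_mul]
    have hm := memLp_coord (h.memLp hε0)
    have hprod : Integrable fun x => m ε x i * m ε (x + ε • horiz z) j :=
      (hm i).integrable_mul ((hm j).comp_measurePreserving
        (measurePreserving_add_right volume (ε • horiz z)))
    have hov : AEStronglyMeasurable fun x : E2 => overlap f₁ f₂ z (ε⁻¹ • x) :=
      Continuous.aestronglyMeasurable (by fun_prop)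
    rw [← integral_sub (hprod.mul_bdd hov (Eventually.of_forall fun x => hbd _))
      ((h.integrable_coord_mul i j).mul_bdd hov (Eventually.of_forall fun x => hbd _)),
      ← integral_mul_const]
    refine norm_integral_le_of_norm_le
      ((hprod.sub (h.integrable_coord_mul i j)).abs.mul_const B) (Eventually.of_forall fun x => ?_)
    rw [← sub_mul, norm_mul]
    exact mul_le_mul_of_nonneg_left (hbd _) (abs_nonneg _)
  have := hdiff.add havg
  simpa [cellCorr] using this

end BoundedConv

/-! ### Integration by parts against bounded Lipschitz functions -/

/-- The formula for compactly supported functions is applied to `χ k * η` and passed to the limit.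
Boundedness of `q` and of its derivative, together with integrability of `η` and of its derivative,
provides the dominating functions. -/
theorem integral_lineDeriv_mul_of_integrable {n : ℕ} {q η : EuclideanSpace ℝ (Fin n) → ℝ}
    {K : NNReal} (hq : LipschitzWith K q) {B : ℝ} (hB : ∀ x, |q x| ≤ B)
    (hη : ContDiff ℝ ((⊤ : ℕ∞) : WithTop ℕ∞) η) (hηi : Integrable η)
    {v : EuclideanSpace ℝ (Fin n)} (hηd : Integrable fun x => fderiv ℝ η x v) :
    ∫ x, η x * lineDeriv ℝ q x v = - ∫ x, fderiv ℝ η x v * q x := by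
  obtain ⟨C, χ, hχ, hχc, hχ1, hχd, hχe⟩ := exists_smooth_cutoff (EuclideanSpace ℝ (Fin n))
  have hsm : ∀ k, ContDiff ℝ ((⊤ : ℕ∞) : WithTop ℕ∞) fun x => χ k x * η x := fun k => (hχ k).mul hη
  have hcs : ∀ k, HasCompactSupport fun x => χ k x * η x := fun k => (hχc k).mul_right
  have hC0 : 0 ≤ C := (norm_nonneg _).trans (hχd 0 0)
  have hB0 : 0 ≤ B := (abs_nonneg _).trans (hB 0)
  have hibp : ∀ k, ∫ x, lineDeriv ℝ q x v * (χ k x * η x)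
      = - ∫ x, fderiv ℝ (fun x => χ k x * η x) x v * q x := by
    intro k
    obtain ⟨D, hD⟩ := ContDiff.lipschitzWith_of_hasCompactSupport (hcs k) (hsm k) (by simp)
    rw [hq.integral_lineDeriv_mul_eq hD (hcs k) v, ← integral_neg]
    refine integral_congr_ae (Eventually.of_forall fun x => ?_)
    simp only
    rw [((hsm k).differentiable (by simp) x).lineDeriv_eq_fderiv]
    simp
  have hlb : ∀ x, |lineDeriv ℝ q x v| ≤ K * ‖v‖ := fun x => norm_lineDeriv_le_of_lipschitz ℝ hq
  have hlm : Measurable fun x => lineDeriv ℝ q x v := measurable_lineDeriv hq.continuous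
  have h1 : Tendsto (fun k => ∫ x, lineDeriv ℝ q x v * (χ k x * η x)) atTop
      (𝓝 (∫ x, η x * lineDeriv ℝ q x v)) := by
    refine tendsto_integral_of_dominated_convergence (fun x => (K * ‖v‖) * |η x|) (fun k => ?_)
      (hηi.abs.const_mul _) (fun k => Eventually.of_forall fun x => ?_)
      (Eventually.of_forall fun x => ?_)
    · exact hlm.aestronglyMeasurable.mul (hsm k).continuous.aestronglyMeasurable
    · rw [norm_mul, norm_mul]
      refine mul_le_mul (hlb x) ?_ (by positivity) (by positivity)
      exact mul_le_of_le_one_left (norm_nonneg _) (hχ1 k x)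
    · refine tendsto_const_nhds.congr' ?_
      filter_upwards [hχe x] with k hk
      rw [hk.self_of_nhds]; ring
  have h2 : Tendsto (fun k => ∫ x, fderiv ℝ (fun x => χ k x * η x) x v * q x) atTop
      (𝓝 (∫ x, fderiv ℝ η x v * q x)) := by
    refine tendsto_integral_of_dominated_convergence
      (fun x => (|fderiv ℝ η x v| + C * ‖v‖ * |η x|) * B) (fun k => ?_)
      ((hηd.abs.add (hηi.abs.const_mul _)).mul_const B) (fun k => Eventually.of_forall fun x => ?_)
      (Eventually.of_forall fun x => ?_)
    · exact (((hsm k).continuous_fderiv (by simp)).clm_apply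
        continuous_const).aestronglyMeasurable.mul hq.continuous.aestronglyMeasurable
    · rw [norm_mul]
      refine mul_le_mul ?_ (hB x) (abs_nonneg _) (by positivity)
      have hd : HasFDerivAt (fun x => χ k x * η x) _ x :=
        ((hχ k).differentiable (by simp) x).hasFDerivAt.mul
          (hη.differentiable (by simp) x).hasFDerivAt
      rw [hd.fderiv, add_apply, smul_apply, smul_apply, smul_eq_mul, smul_eq_mul]
      refine (norm_add_le _ _).trans (add_le_add ?_ ?_)
      · rw [norm_mul]
        exact mul_le_of_le_one_left (norm_nonneg _) (hχ1 k x)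
      · rw [norm_mul, mul_comm]
        refine mul_le_mul_of_nonneg_right ?_ (abs_nonneg _)
        exact ((fderiv ℝ (χ k) x).le_opNorm v).trans
          (mul_le_mul_of_nonneg_right (hχd k x) (norm_nonneg v))
    · refine tendsto_const_nhds.congr' ?_
      filter_upwards [hχe x] with k hk
      have : (fun x => χ k x * η x) =ᶠ[𝓝 x] η := by
        filter_upwards [hk] with y hy
        rw [hy, one_mul]
      rw [this.fderiv_eq]
  simp only [hibp] at h1
  exact tendsto_nhds_unique h1 h2.neg

/-- Integration by parts for `G (g (x + z) - c)` with `G` continuously differentiable and `g`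
bounded and Lipschitz. -/
theorem integral_fderiv_mul_comp {G G' : ℝ → ℝ} (hG : ∀ t, HasDerivAt G (G' t) t)
    (hG' : Continuous G') {g : E2 → ℝ} {K : NNReal} (hg : LipschitzWith K g) {B : ℝ}
    (hB : ∀ x, |g x| ≤ B) {η : E2 → ℝ} (hη : ContDiff ℝ ((⊤ : ℕ∞) : WithTop ℕ∞) η)
    (hηi : Integrable η) (j : Fin 2)
    (hηd : Integrable fun x => fderiv ℝ η x (EuclideanSpace.single j 1)) (x : E2) (c : ℝ) :
    ∫ z, fderiv ℝ η z (EuclideanSpace.single j 1) * G (g (x + z) - c)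
      = - ∫ z, η z * (G' (g (x + z) - c) * (gradient g (x + z)) j) := by
  -- Only the values of `G` on `[-R, R]` matter, and there a continuously differentiable function is
  -- Lipschitz.
  set R := B + |c| with hR
  have hmem : ∀ z, g (x + z) - c ∈ Set.Icc (-R) R := by
    intro z
    rw [Set.mem_Icc, ← abs_le]
    exact (abs_sub _ _).trans (add_le_add (hB _) le_rfl)
  obtain ⟨D, hD⟩ := isCompact_Icc.exists_bound_of_continuousOn (s := Set.Icc (-R) R)
    hG'.continuousOn
  have hGl : LipschitzOnWith (Real.toNNReal D) G (Set.Icc (-R) R) := by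
    refine (convex_Icc _ _).lipschitzOnWith_of_nnnorm_hasDerivWithin_le
      (fun t _ => (hG t).hasDerivWithinAt) fun t ht => ?_
    rw [← NNReal.coe_le_coe]
    exact (hD t ht).trans (Real.le_coe_toNNReal D)
  have hinner : LipschitzWith K fun z => g (x + z) - c := by
    refine LipschitzWith.of_dist_le_mul fun z w => ?_
    rw [Real.dist_eq, sub_sub_sub_cancel_right, ← Real.dist_eq]
    refine (hg.dist_le_mul _ _).trans (le_of_eq ?_)
    rw [dist_add_left]
  have hq : LipschitzWith (Real.toNNReal D * K) fun z => G (g (x + z) - c) := by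
    rw [← lipschitzOnWith_univ]
    exact hGl.comp (lipschitzOnWith_univ.2 hinner) fun z _ => hmem z
  obtain ⟨A, hA⟩ := isCompact_Icc.exists_bound_of_continuousOn (s := Set.Icc (-R) R)
    (f := G) (fun t _ => (hG t).continuousAt.continuousWithinAt)
  have hibp := integral_lineDeriv_mul_of_integrable hq (fun z => hA _ (hmem z)) hη hηi hηd
  rw [eq_comm, neg_eq_iff_eq_neg, ← hibp]
  refine integral_congr_ae ?_
  -- Rademacher's theorem: the chain rule is available at almost every point.
  have hae : ∀ᵐ z : E2, DifferentiableAt ℝ g (x + z) :=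
    (measurePreserving_add_left volume x).quasiMeasurePreserving.ae hg.ae_differentiableAt
  filter_upwards [hae] with z hz
  have hd1 : HasFDerivAt (fun z => g (x + z)) (fderiv ℝ g (x + z)) z := by
    have := hz.hasFDerivAt.comp z ((hasFDerivAt_id z).const_add x)
    exact this
  have hd2 := (hG (g (x + z) - c)).comp_hasFDerivAt z (hd1.sub_const c)
  rw [gradient_apply]
  have h3 := (hd2.hasLineDerivAt (EuclideanSpace.single j (1 : ℝ))).lineDeriv
  simp only [Function.comp_def] at h3
  rw [h3]
  simp

/-! ### Exchanging the base point -/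

/-- The change of variables `(x, z) ↦ (x + z, -z)` interchanges the two end points of `z`.
Periodicity in `x` returns the shifted cell to its place for each fixed `z`. -/
theorem integral_cellQ_swap {Ψ : E2 → E2 → ℝ} (hm : Measurable fun p : E2 × E2 => Ψ p.1 p.2)
    (hper : ∀ z, QPeriodic fun x => Ψ x z) {k : E2 → ℝ} (hk : Integrable k)
    (hb : ∀ x z, |Ψ x z| ≤ k z) :
    ∫ x in cellQ, ∫ z, Ψ x z = ∫ x in cellQ, ∫ z, Ψ (x + z) (-z) := by
  have hi1 : Integrable (fun p : E2 × E2 => Ψ p.1 p.2) ((volume.restrict cellQ).prod volume) :=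
    (hk.comp_snd (volume.restrict cellQ)).mono' hm.aestronglyMeasurable
      (Eventually.of_forall fun p => hb _ _)
  have hi2 : Integrable (fun p : E2 × E2 => Ψ (p.1 + p.2) (-p.2))
      ((volume.restrict cellQ).prod volume) := by
    refine (hk.comp_neg.comp_snd (volume.restrict cellQ)).mono' ?_
      (Eventually.of_forall fun p => hb _ _)
    have : Measurable fun p : E2 × E2 => ((p.1 + p.2, -p.2) : E2 × E2) := by fun_prop
    exact (hm.comp this).aestronglyMeasurable
  rw [integral_integral_swap hi1]
  refine Eq.trans ?_ (integral_integral_swap hi2).symm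
  rw [← integral_neg_eq_self]
  refine integral_congr_ae (Eventually.of_forall fun z => ?_)
  exact ((hper (-z)).setIntegral_cellQ_add z).symm

/-! ### Vertical integration -/

/-- The alternating sum of `G` over the differences of the end points of two intervals. -/
def altSum (G : ℝ → ℝ) (b₁ b₂ d₁ d₂ : ℝ) : ℝ :=
  G (d₂ - b₂) - G (d₂ - b₁) - G (d₁ - b₂) + G (d₁ - b₁)

/-- The overlap length is the integral over `t ∈ (b₁, b₂]` of the indicator of `t + ζ ∈ (d₁, d₂]`.
After Fubini the fundamental theorem of calculus applies twice. Adding an affine function to `K`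
does not change `altSum`, which leaves freedom in the choice of antiderivatives. -/
theorem integral_mul_overlap {k K K' : ℝ → ℝ} (hk : Integrable k) (hkc : Continuous k)
    (hK : ∀ t, HasDerivAt K (K' t) t) (hK' : ∀ t, HasDerivAt K' (k t) t) {b₁ b₂ d₁ d₂ : ℝ}
    (hb : b₁ ≤ b₂) (hd : d₁ ≤ d₂) :
    ∫ ζ, k ζ * max (min b₂ (d₂ - ζ) - max b₁ (d₁ - ζ)) 0 = - altSum K b₁ b₂ d₁ d₂ := by
  have hlen : ∀ ζ, max (min b₂ (d₂ - ζ) - max b₁ (d₁ - ζ)) 0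
      = ∫ t in Set.Ioc b₁ b₂, (Set.Ioc d₁ d₂).indicator (1 : ℝ → ℝ) (t + ζ) := by
    intro ζ
    have h1 : (fun t => (Set.Ioc d₁ d₂).indicator (1 : ℝ → ℝ) (t + ζ))
        = (Set.Ioc (d₁ - ζ) (d₂ - ζ)).indicator 1 := by
      ext t
      have : t + ζ ∈ Set.Ioc d₁ d₂ ↔ t ∈ Set.Ioc (d₁ - ζ) (d₂ - ζ) := by
        simp only [Set.mem_Ioc, sub_lt_iff_lt_add, le_sub_iff_add_le]
      by_cases h : t + ζ ∈ Set.Ioc d₁ d₂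
      · rw [Set.indicator_of_mem h, Set.indicator_of_mem (this.1 h)]; rfl
      · rw [Set.indicator_of_notMem h, Set.indicator_of_notMem (fun h' => h (this.2 h'))]
    rw [h1, setIntegral_indicator measurableSet_Ioc, Set.Ioc_inter_Ioc]
    simp only [Pi.one_apply, setIntegral_const, smul_eq_mul, mul_one]
    rw [Real.volume_real_Ioc]
  have hprod : Integrable (fun p : ℝ × ℝ => k p.1 * (Set.Ioc d₁ d₂).indicator (1 : ℝ → ℝ) (p.2 + p.1))
      (volume.prod (volume.restrict (Set.Ioc b₁ b₂))) := by
    have h1 : Integrable (fun p : ℝ × ℝ => k p.1) (volume.prod (volume.restrict (Set.Ioc b₁ b₂))) :=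
      hk.comp_fst _
    refine h1.mul_bdd (c := 1) ?_ (Eventually.of_forall fun p => ?_)
    · exact ((measurable_one.indicator measurableSet_Ioc).comp
        (measurable_snd.add measurable_fst)).aestronglyMeasurable
    · by_cases h : p.2 + p.1 ∈ Set.Ioc d₁ d₂
      · rw [Set.indicator_of_mem h]; simp
      · rw [Set.indicator_of_notMem h]; simp
  simp only [hlen, ← integral_const_mul]
  rw [integral_integral_swap hprod]
  have hin : ∀ t, ∫ ζ, k ζ * (Set.Ioc d₁ d₂).indicator (1 : ℝ → ℝ) (t + ζ)
      = K' (d₂ - t) - K' (d₁ - t) := by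
    intro t
    rw [← integral_sub_right_eq_self
      (fun ζ => k ζ * (Set.Ioc d₁ d₂).indicator (1 : ℝ → ℝ) (t + ζ)) t]
    have h1 : (fun τ => k (τ - t) * (Set.Ioc d₁ d₂).indicator (1 : ℝ → ℝ) (t + (τ - t)))
        = (Set.Ioc d₁ d₂).indicator fun τ => k (τ - t) := by
      ext τ
      rw [add_sub_cancel]
      by_cases h : τ ∈ Set.Ioc d₁ d₂
      · rw [Set.indicator_of_mem h, Set.indicator_of_mem h]; simp
      · rw [Set.indicator_of_notMem h, Set.indicator_of_notMem h]; simp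
    rw [h1, integral_indicator measurableSet_Ioc, ← intervalIntegral.integral_of_le hd]
    refine intervalIntegral.integral_eq_sub_of_hasDerivAt (f := fun τ => K' (τ - t))
      (fun τ _ => ?_) (Continuous.intervalIntegrable (by fun_prop) _ _)
    exact (hK' (τ - t)).comp_sub_const τ t
  simp only [hin]
  have hcont : Continuous K' := continuous_iff_continuousAt.2 fun t => (hK' t).continuousAt
  rw [← intervalIntegral.integral_of_le hb,
    intervalIntegral.integral_eq_sub_of_hasDerivAt (f := fun t => K (d₁ - t) - K (d₂ - t))
      (fun t _ => ?_) (Continuous.intervalIntegrable (by fun_prop) _ _)]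
  · simp only [altSum]; ring
  · have h1 := ((hK (d₁ - t)).comp_const_sub d₁ t).sub ((hK (d₂ - t)).comp_const_sub d₂ t)
    exact h1.congr_deriv (by ring)

/-! ### Lipschitz periodic surfaces -/

/-- A bounded, Lipschitz and periodic surface. -/
structure IsSurface (f : E2 → ℝ) (K : NNReal) (B : ℝ) : Prop where
  lip : LipschitzWith K f
  per : QPeriodic f
  bdd : ∀ x, |f x| ≤ B

theorem measurable_gradient (f : E2 → ℝ) : Measurable (gradient f) :=
  (InnerProductSpace.toDual ℝ E2).symm.continuous.measurable.comp (measurable_fderiv ℝ f)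

theorem measurable_gradient_apply (f : E2 → ℝ) (i : Fin 2) :
    Measurable fun x => gradient f x i :=
  (EuclideanSpace.proj i : E2 →L[ℝ] ℝ).continuous.measurable.comp (measurable_gradient f)

@[simp] theorem normalVec_castSucc (f : E2 → ℝ) (x : E2) (i : Fin 2) :
    normalVec f x i.castSucc = -(gradient f x) i := by
  fin_cases i <;> simp [normalVec]

@[simp] theorem normalVec_two (f : E2 → ℝ) (x : E2) : normalVec f x 2 = 1 := by
  simp [normalVec]

@[simp] theorem flatVec_castSucc (z : E2) (i : Fin 2) : flatVec z i.castSucc = z i := by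
  fin_cases i <;> simp [flatVec]

@[simp] theorem flatVec_two (z : E2) : flatVec z 2 = 0 := by
  simp [flatVec]

@[simp] theorem lift3_castSucc (z : E2) (t : ℝ) (i : Fin 2) : lift3 z t i.castSucc = z i := by
  fin_cases i <;> simp [lift3]

/-- Case distinction between horizontal and vertical indices. -/
theorem forall_fin_three {p : Fin 3 → Prop} (h : ∀ i : Fin 2, p i.castSucc) (h2 : p 2) (i : Fin 3) :
    p i := by
  induction i using Fin.lastCases with
  | last => exact h2
  | cast i => exact h i

theorem measurable_normalVec (f : E2 → ℝ) (i : Fin 3) : Measurable fun x => normalVec f x i := by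
  refine forall_fin_three (p := fun i => Measurable fun x => normalVec f x i) (fun i => ?_) ?_ i
  · simp only [normalVec_castSucc]; exact (measurable_gradient_apply f i).neg
  · simp

theorem QPeriodic.gradient_apply {f : E2 → ℝ} (hf : QPeriodic f) (i : Fin 2) :
    QPeriodic fun x => gradient f x i := by
  intro x k
  have h : (fun y => f (y + EuclideanSpace.single k 1)) = f := funext fun y => hf y k
  have h2 := fderiv_comp_add_right (𝕜 := ℝ) (f := f) (x := x) (EuclideanSpace.single k (1 : ℝ))
  rw [h] at h2
  simp only [ThinFilm.gradient_apply]
  rw [h2]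

theorem QPeriodic.normalVec {f : E2 → ℝ} (hf : QPeriodic f) (i : Fin 3) :
    QPeriodic fun x => normalVec f x i := by
  refine forall_fin_three (p := fun i => QPeriodic fun x => ThinFilm.normalVec f x i)
    (fun i => ?_) ?_ i
  · intro x k
    simp only [normalVec_castSucc]
    exact congrArg Neg.neg (hf.gradient_apply i x k)
  · intro x k; simp

namespace IsSurface

variable {f g : E2 → ℝ} {K : NNReal} {B : ℝ}

theorem abs_gradient_le (hf : IsSurface f K B) (x : E2) (i : Fin 2) : |gradient f x i| ≤ K := by
  refine (abs_apply_le_norm _ _).trans ?_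
  rw [norm_gradient]
  exact norm_fderiv_le_of_lipschitz ℝ hf.lip

theorem abs_normalVec_le (hf : IsSurface f K B) (x : E2) (i : Fin 3) :
    |ThinFilm.normalVec f x i| ≤ K + 1 := by
  refine forall_fin_three (p := fun i => |ThinFilm.normalVec f x i| ≤ K + 1) (fun i => ?_) ?_ i
  · rw [normalVec_castSucc, abs_neg]
    exact (hf.abs_gradient_le x i).trans (by linarith)
  · simp

theorem bound_nonneg (hf : IsSurface f K B) : 0 ≤ B := (abs_nonneg _).trans (hf.bdd 0)

theorem abs_sub_le (hf : IsSurface f K B) (hg : IsSurface g K B) (x y : E2) :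
    |g y - f x| ≤ 2 * B := by
  refine (abs_sub _ _).trans ?_
  linarith [hf.bdd x, hg.bdd y]

end IsSurface

/-! ### Vertical profiles -/

/-- The regularized vertical profile of the gaussian. -/
def profTwo (s t : ℝ) : ℝ := Real.exp (-s * t ^ 2) - Real.exp (-s)

/-- An antiderivative of `profTwo s`. -/
def profOne (s t : ℝ) : ℝ := ∫ τ in (0 : ℝ)..t, profTwo s τ

/-- An antiderivative of `profOne s`. -/
def profZero (s t : ℝ) : ℝ := ∫ τ in (0 : ℝ)..t, profOne s τ

theorem continuous_profTwo (s : ℝ) : Continuous (profTwo s) := by unfold profTwo; fun_prop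

theorem hasDerivAt_profOne (s t : ℝ) : HasDerivAt (profOne s) (profTwo s t) t :=
  ((continuous_profTwo s).integral_hasStrictDerivAt 0 t).hasDerivAt

theorem continuous_profOne (s : ℝ) : Continuous (profOne s) :=
  continuous_iff_continuousAt.2 fun t => (hasDerivAt_profOne s t).continuousAt

theorem hasDerivAt_profZero (s t : ℝ) : HasDerivAt (profZero s) (profOne s t) t :=
  ((continuous_profOne s).integral_hasStrictDerivAt 0 t).hasDerivAt

theorem continuous_profZero (s : ℝ) : Continuous (profZero s) :=
  continuous_iff_continuousAt.2 fun t => (hasDerivAt_profZero s t).continuousAt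

theorem hasDerivAt_exp_neg_mul_sq (s t : ℝ) :
    HasDerivAt (fun t => Real.exp (-s * t ^ 2)) (-2 * s * t * Real.exp (-s * t ^ 2)) t := by
  have h := ((hasDerivAt_pow 2 t).const_mul (-s)).exp
  refine h.congr_deriv ?_
  simp; ring

theorem hasDerivAt_profTwo (s t : ℝ) :
    HasDerivAt (profTwo s) (-2 * s * t * Real.exp (-s * t ^ 2)) t :=
  (hasDerivAt_exp_neg_mul_sq s t).sub_const _

theorem profTwo_neg (s t : ℝ) : profTwo s (-t) = profTwo s t := by simp [profTwo]

theorem abs_profTwo_le {s : ℝ} (hs : 0 < s) (t : ℝ) : |profTwo s t| ≤ 1 := by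
  have h1 := Real.exp_pos (-s * t ^ 2)
  have h2 := Real.exp_pos (-s)
  have h3 : Real.exp (-s * t ^ 2) ≤ 1 := Real.exp_le_one_iff.2 (by nlinarith [sq_nonneg t])
  have h4 : Real.exp (-s) ≤ 1 := Real.exp_le_one_iff.2 (by linarith)
  rw [profTwo, abs_le]
  constructor <;> linarith

/-! ### Integrals over the cell and the plane -/

theorem integrable_cell_mul {k : E2 → ℝ} (hk : Integrable k) {W : E2 → E2 → ℝ}
    (hW : Measurable fun p : E2 × E2 => W p.1 p.2) {C : ℝ} (hC : ∀ x z, |W x z| ≤ C) :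
    Integrable (fun p : E2 × E2 => k p.2 * W p.1 p.2) ((volume.restrict cellQ).prod volume) :=
  (hk.comp_snd (volume.restrict cellQ)).mul_bdd hW.aestronglyMeasurable
    (Eventually.of_forall fun _ => hC _ _)

/-- The plane gaussian. -/
def gaussTwo (s : ℝ) (z : E2) : ℝ := Real.exp (-s * ‖z‖ ^ 2)

theorem integrable_gaussTwo {s : ℝ} (hs : 0 < s) : Integrable (gaussTwo s) :=
  integrable_exp_neg_mul_norm_sq hs

theorem contDiff_gaussTwo (s : ℝ) : ContDiff ℝ ((⊤ : ℕ∞) : WithTop ℕ∞) (gaussTwo s) := by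
  unfold gaussTwo
  have h1 : ContDiff ℝ ((⊤ : ℕ∞) : WithTop ℕ∞) fun z : E2 => ‖z‖ ^ 2 := contDiff_norm_sq ℝ
  fun_prop

theorem fderiv_gaussTwo (s : ℝ) (i : Fin 2) (z : E2) :
    fderiv ℝ (gaussTwo s) z (EuclideanSpace.single i 1) = gaussGrad s i z := by
  have h := hasFDerivAt_mul_gaussian (hasFDerivAt_const (𝕜 := ℝ) (1 : ℝ) z) s
  simp only [one_mul] at h
  have h' : HasFDerivAt (gaussTwo s) _ z := h
  rw [h'.fderiv]
  simp [gaussGrad, EuclideanSpace.inner_single_right]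
  ring

theorem gaussHess_comm {n : ℕ} (s : ℝ) (i j : Fin n) (z : EuclideanSpace ℝ (Fin n)) :
    gaussHess s i j z = gaussHess s j i z := by
  simp only [gaussHess, eq_comm (a := i), mul_comm (z i)]

theorem gaussGrad_neg {n : ℕ} (s : ℝ) (i : Fin n) (z : EuclideanSpace ℝ (Fin n)) :
    gaussGrad s i (-z) = -gaussGrad s i z := by
  simp [gaussGrad]

/-- The interaction of the surfaces `f` and `g` through the regularized gaussian. -/
def surfTerm (s : ℝ) (f g : E2 → ℝ) (i j : Fin 3) : ℝ :=
  ∫ x in cellQ, ∫ z : E2, gaussTwo s z *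
    (normalVec f x i * normalVec g (z + x) j * profTwo s (g (z + x) - f x))

/-! ### Symmetry of the surface interaction and horizontal integration by parts -/

section SurfTerm

variable {f g : E2 → ℝ} {K : NNReal} {B : ℝ} {s : ℝ}

theorem measurable_surf_integrand (hf : IsSurface f K B) (hg : IsSurface g K B) (s : ℝ)
    (i j : Fin 3) : Measurable fun p : E2 × E2 =>
      normalVec f p.1 i * normalVec g (p.2 + p.1) j * profTwo s (g (p.2 + p.1) - f p.1) := by
  have h1 : Measurable fun p : E2 × E2 => normalVec f p.1 i :=
    (measurable_normalVec f i).comp measurable_fst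
  have h2 : Measurable fun p : E2 × E2 => normalVec g (p.2 + p.1) j :=
    (measurable_normalVec g j).comp (measurable_snd.add measurable_fst)
  have hfc := hf.lip.continuous
  have hgc := hg.lip.continuous
  have hpc := continuous_profTwo s
  have h3 : Measurable fun p : E2 × E2 => profTwo s (g (p.2 + p.1) - f p.1) :=
    Continuous.measurable (by fun_prop)
  exact (h1.mul h2).mul h3

theorem abs_surf_integrand_le (hf : IsSurface f K B) (hg : IsSurface g K B) (hs : 0 < s)
    (i j : Fin 3) (x z : E2) :
    |normalVec f x i * normalVec g (z + x) j * profTwo s (g (z + x) - f x)|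
      ≤ ((K + 1) * (K + 1) : ℝ) * 1 := by
  rw [abs_mul, abs_mul]
  have h1 := hf.abs_normalVec_le x i
  have h2 := hg.abs_normalVec_le (z + x) j
  have h3 := abs_profTwo_le hs (g (z + x) - f x)
  gcongr

/-- Exchanging the base points interchanges the surfaces together with their indices, since the
gaussian and `profTwo` are even. -/
theorem surfTerm_swap (hf : IsSurface f K B) (hg : IsSurface g K B) (hs : 0 < s) (i j : Fin 3) :
    surfTerm s f g i j = surfTerm s g f j i := by
  have hc := (contDiff_gaussTwo s).continuous.measurable
  rw [surfTerm, integral_cellQ_swap (k := fun z => gaussTwo s z * ((K + 1) * (K + 1) * 1))]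
  · rw [surfTerm]
    refine integral_congr_ae (Eventually.of_forall fun x => integral_congr_ae
      (Eventually.of_forall fun z => ?_))
    simp only
    rw [show -z + (x + z) = x by abel, add_comm x z, ← neg_sub (f (z + x)) (g x), profTwo_neg]
    simp only [gaussTwo, norm_neg]
    ring
  · exact (hc.comp measurable_snd).mul (measurable_surf_integrand hf hg s i j)
  · intro z x k
    have e : z + (x + EuclideanSpace.single k 1) = z + x + EuclideanSpace.single k 1 := by abel
    have e1 : normalVec f (x + EuclideanSpace.single k 1) i = normalVec f x i :=
      hf.per.normalVec i x k
    have e2 : normalVec g (z + x + EuclideanSpace.single k 1) j = normalVec g (z + x) j :=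
      hg.per.normalVec j (z + x) k
    simp only [e]
    rw [e1, e2, hf.per x k, hg.per (z + x) k]
  · exact (integrable_gaussTwo hs).mul_const _
  · intro x z
    rw [abs_mul, abs_of_pos (a := gaussTwo s z) (Real.exp_pos _)]
    exact mul_le_mul_of_nonneg_left (abs_surf_integrand_le hf hg hs i j x z) (Real.exp_pos _).le

/-- Height differences stay in `[-2B, 2B]`, so the constant depends on `G` and `B` only and serves
all pairs of surfaces. -/
theorem exists_bound_comp_sub {G : ℝ → ℝ} (hG : Continuous G) (B : ℝ) :
    ∃ C, 0 ≤ C ∧ ∀ {f g : E2 → ℝ} {K : NNReal}, IsSurface f K B → IsSurface g K B →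
      ∀ x y, |G (g y - f x)| ≤ C := by
  obtain ⟨C, hC⟩ := isCompact_Icc.exists_bound_of_continuousOn (s := Set.Icc (-(2 * B)) (2 * B))
    hG.continuousOn
  refine ⟨|C|, abs_nonneg _, fun hf hg x y => ?_⟩
  refine (hC _ ?_).trans (le_abs_self C)
  rw [Set.mem_Icc, ← abs_le]
  exact hf.abs_sub_le hg x y

/-- Integration by parts in the variable of the surface `f`. -/
theorem integral_gaussGrad_mul_profOne (hf : IsSurface f K B) (hg : IsSurface g K B) (hs : 0 < s)
    (i : Fin 2) {w : E2 → ℝ} (hwm : Measurable w) (hwp : QPeriodic w) {C : ℝ}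
    (hwb : ∀ x, |w x| ≤ C) :
    ∫ x in cellQ, ∫ z, gaussGrad s i z * (profOne s (g (x + z) - f x) * w (x + z))
      = ∫ x in cellQ, ∫ z, gaussTwo s z *
          (w x * normalVec f (z + x) i.castSucc * profTwo s (f (z + x) - g x)) := by
  obtain ⟨D, hD0, hD⟩ := exists_bound_comp_sub (continuous_profOne s) B
  have hC0 : 0 ≤ C := (abs_nonneg _).trans (hwb 0)
  have hfc := hf.lip.continuous
  have hgc := hg.lip.continuous
  rw [integral_cellQ_swap (k := fun z => |gaussGrad s i z| * (D * C))]
  · refine integral_congr_ae (Eventually.of_forall fun x => ?_)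
    simp only
    -- After the base points are exchanged, `f` sits at the moving point with a minus sign and `g x`
    -- is a constant. This explains the reflected antiderivative.
    have hibp := integral_fderiv_mul_comp (G := fun t => profOne s (-t))
      (G' := fun t => -profTwo s (-t))
      (fun t => ((hasDerivAt_profOne s (-t)).comp t (hasDerivAt_neg t)).congr_deriv (by ring))
      (by have := continuous_profTwo s; fun_prop) hf.lip hf.bdd (contDiff_gaussTwo s)
      (integrable_gaussTwo hs) i (by simpa only [fderiv_gaussTwo] using integrable_gaussGrad hs i)
      x (g x)
    simp only [fderiv_gaussTwo, neg_sub, gaussGrad_neg] at hibp ⊢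
    have e1 : ∀ z : E2, x + z + -z = x := fun z => by abel
    have e2 : ∀ z : E2, -gaussGrad s i z * (profOne s (g (x + z + -z) - f (x + z)) * w (x + z + -z))
        = -w x * (gaussGrad s i z * profOne s (g x - f (x + z))) := by
      intro z; rw [e1]; ring
    simp only [e2]
    rw [integral_const_mul, hibp, neg_mul_neg, ← integral_const_mul]
    refine integral_congr_ae (Eventually.of_forall fun z => ?_)
    simp only [normalVec_castSucc]
    rw [add_comm z x, ← profTwo_neg s (f (x + z) - g x), neg_sub]
    ring
  · have h1 : Measurable fun p : E2 × E2 => gaussGrad s i p.2 :=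
      ((contDiff_gaussGrad s i).continuous.comp continuous_snd).measurable
    have h2 : Measurable fun p : E2 × E2 => profOne s (g (p.1 + p.2) - f p.1) :=
      ((continuous_profOne s).comp (by fun_prop)).measurable
    exact h1.mul (h2.mul (hwm.comp (measurable_fst.add measurable_snd)))
  · intro z x k
    have e : x + EuclideanSpace.single k 1 + z = x + z + EuclideanSpace.single k 1 := by abel
    simp only [e]
    rw [hg.per (x + z) k, hf.per x k, hwp (x + z) k]
  · exact (integrable_gaussGrad hs i).abs.mul_const _
  · intro x z
    rw [abs_mul, abs_mul]
    exact mul_le_mul_of_nonneg_left (mul_le_mul (hD hf hg _ _) (hwb _) (abs_nonneg _) hD0)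
      (abs_nonneg _)

/-- Two integrations by parts. The first takes `∂ⱼ` from the gaussian and differentiates through
`g`; after an exchange of base points, the second takes `∂ᵢ` and differentiates through `f`. The
vertical profile is differentiated twice, from `profZero` to `profTwo`. -/
theorem integral_gaussHess_mul_profZero (hf : IsSurface f K B) (hg : IsSurface g K B) (hs : 0 < s)
    (i j : Fin 2) :
    ∫ x in cellQ, ∫ z, gaussHess s i j z * profZero s (g (x + z) - f x)
      = - surfTerm s g f j.castSucc i.castSucc := by
  have h1 : ∀ x, ∫ z, gaussHess s i j z * profZero s (g (x + z) - f x)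
      = ∫ z, gaussGrad s i z * (profOne s (g (x + z) - f x) * gradient g (x + z) j) := by
    intro x
    have hibp := integral_fderiv_mul_comp (hasDerivAt_profZero s) (continuous_profOne s) hg.lip
      hg.bdd (contDiff_gaussGrad s i) (integrable_gaussGrad hs i) j
      (by simp only [fderiv_gaussGrad]; exact (integrable_gaussHess hs j i).neg) x (f x)
    simp only [fderiv_gaussGrad, neg_mul, integral_neg, neg_inj] at hibp
    simp only [gaussHess_comm s i j]
    exact hibp
  simp only [h1]
  rw [integral_gaussGrad_mul_profOne hf hg hs i (measurable_gradient_apply g j)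
    (hg.per.gradient_apply j) (fun x => hg.abs_gradient_le x j), surfTerm, ← integral_neg]
  refine integral_congr_ae (Eventually.of_forall fun x => ?_)
  simp only
  rw [← integral_neg]
  refine integral_congr_ae (Eventually.of_forall fun z => ?_)
  simp only [normalVec_castSucc]
  ring

/-- With one vertical index a single integration by parts is enough; the vertical component of the
other normal is one. -/
theorem integral_gaussGrad_mul_profOne_eq (hf : IsSurface f K B) (hg : IsSurface g K B) (hs : 0 < s)
    (i : Fin 2) :
    ∫ x in cellQ, ∫ z, gaussGrad s i z * profOne s (g (x + z) - f x)
      = surfTerm s g f 2 i.castSucc := by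
  have := integral_gaussGrad_mul_profOne hf hg hs i (w := fun _ => 1) measurable_const
    (fun _ _ => rfl) (C := 1) (fun _ => by simp)
  simp only [mul_one] at this
  rw [this, surfTerm]
  simp only [normalVec_two]

end SurfTerm

/-! ### The cell formula at a fixed gaussian width -/

/-- The dipole interaction through the gaussian. -/
def dipTerm (s : ℝ) (f₁ f₂ : E2 → ℝ) (i j : Fin 3) : ℝ :=
  ∫ x in cellQ, ∫ z : E2,
    ((2 * s * (1 - Matrix.single 2 2 1 : Matrix (Fin 3) (Fin 3) ℝ) i j
        - 4 * s ^ 2 * (flatVec z i * flatVec z j)) * Real.exp (-s * (‖z‖ ^ 2 + 1)))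
      * ((f₂ (z + x) - f₁ (z + x)) * (f₂ x - f₁ x))

section CellFormula

variable {f₁ f₂ : E2 → ℝ} {K : NNReal} {B : ℝ} {s : ℝ}

theorem integral_cell_altSum (hf₁ : IsSurface f₁ K B) (hf₂ : IsSurface f₂ K B) {k : E2 → ℝ}
    (hk : Integrable k) {G : ℝ → ℝ} (hG : Continuous G) :
    ∫ x in cellQ, ∫ z, k z * altSum G (f₁ x) (f₂ x) (f₁ (x + z)) (f₂ (x + z))
      = (∫ x in cellQ, ∫ z, k z * G (f₂ (x + z) - f₂ x))
        - (∫ x in cellQ, ∫ z, k z * G (f₂ (x + z) - f₁ x))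
        - (∫ x in cellQ, ∫ z, k z * G (f₁ (x + z) - f₂ x))
        + ∫ x in cellQ, ∫ z, k z * G (f₁ (x + z) - f₁ x) := by
  obtain ⟨C, hC0, hC⟩ := exists_bound_comp_sub hG B
  have hi : ∀ {f g : E2 → ℝ}, IsSurface f K B → IsSurface g K B →
      Integrable (fun p : E2 × E2 => k p.2 * G (g (p.1 + p.2) - f p.1))
        ((volume.restrict cellQ).prod volume) := by
    intro f g hf hg
    have hfc := hf.lip.continuous
    have hgc := hg.lip.continuous
    exact integrable_cell_mul hk (W := fun x z => G (g (x + z) - f x))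
      (Continuous.measurable (by fun_prop)) (fun x z => hC hf hg _ _)
  have h22 := hi hf₂ hf₂
  have h12 := hi hf₁ hf₂
  have h21 := hi hf₂ hf₁
  have h11 := hi hf₁ hf₁
  rw [← integral_prod _ h22, ← integral_prod _ h12, ← integral_prod _ h21, ← integral_prod _ h11,
    ← integral_sub h22 h12, ← integral_sub (by exact h22.sub h12) h21,
    ← integral_add (by exact (h22.sub h12).sub h21) h11]
  rw [integral_prod]
  · refine integral_congr_ae (Eventually.of_forall fun x => integral_congr_ae
      (Eventually.of_forall fun z => ?_))
    simp only [altSum]; ring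
  · exact ((h22.sub h12).sub h21).add h11

/-- The vertical variable is isolated so that its integral can be evaluated in closed form for fixed
`x` and `z`. -/
theorem integral_gaussHess_mul_cellCorr (hf₁ : IsSurface f₁ K B) (hf₂ : IsSurface f₂ K B)
    (hpos : ∀ x, 0 < f₁ x) (hs : 0 < s) (i j : Fin 3) :
    ∫ z, gaussHess s i j z * cellCorr f₁ f₂ z
      = ∫ x in cellQ, ∫ z : E2, ∫ ζ : ℝ, gaussHess s i j (lift3 z ζ) *
          max (min (f₂ x) (f₂ (x + z) - ζ) - max (f₁ x) (f₁ (x + z) - ζ)) 0 := by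
  have h₁ := hf₁.lip.continuous
  have h₂ := hf₂.lip.continuous
  have hB := hf₁.bound_nonneg
  have hbd : ∀ z x, ‖overlap f₁ f₂ z x‖ ≤ B := fun z x => by
    rw [Real.norm_of_nonneg (overlap_nonneg _ _ _ _)]
    exact overlap_le hpos (fun x => (le_abs_self _).trans (hf₂.bdd x)) hB z x
  have hint : Integrable (fun p : E3 × E2 => gaussHess s i j p.1 * overlap f₁ f₂ p.1 p.2)
      (volume.prod (volume.restrict cellQ)) :=
    ((integrable_gaussHess hs i j).comp_fst (volume.restrict cellQ)).mul_bdd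
      (continuous_overlap_uncurry h₁ h₂).aestronglyMeasurable
      (Eventually.of_forall fun p => hbd _ _)
  simp only [cellCorr, ← integral_const_mul]
  rw [integral_integral_swap hint]
  refine integral_congr_ae (Eventually.of_forall fun x => ?_)
  have hov : Continuous fun z => overlap f₁ f₂ z x :=
    (continuous_overlap_uncurry h₁ h₂).comp (by fun_prop : Continuous fun z : E3 => (z, x))
  have hix : Integrable fun z => gaussHess s i j z * overlap f₁ f₂ z x :=
    (integrable_gaussHess hs i j).mul_bdd hov.aestronglyMeasurable
      (Eventually.of_forall fun z => hbd _ _)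
  simp only
  rw [integral_eq_integral_lift3 hix]
  simp only [overlap, horiz_lift3, lift3_two]

theorem continuous_profile_integrable {k : ℝ → ℝ} (hs : 0 < s) {A : ℝ} (hk : Continuous k)
    (hb : ∀ t, |k t| ≤ A * ((1 + t ^ 2) ^ 1 * Real.exp (-s * t ^ 2))) : Integrable k :=
  integrable_of_gaussian_bound (E := ℝ) (A := A) (s := s) (k := 1) hk hs fun t => by
    simpa only [Real.norm_eq_abs, sq_abs] using hb t

theorem gaussHess_lift3 (s : ℝ) (i j : Fin 3) (z : E2) (ζ : ℝ) :
    gaussHess s i j (lift3 z ζ)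
      = (2 * s * (if i = j then 1 else 0) - 4 * s ^ 2 * (lift3 z ζ i * lift3 z ζ j))
        * (Real.exp (-s * ‖z‖ ^ 2) * Real.exp (-s * ζ ^ 2)) := by
  rw [gaussHess, norm_lift3_sq, mul_add, Real.exp_add]

theorem gaussHess_lift3_castSucc (s : ℝ) (i j : Fin 2) (z : E2) (ζ : ℝ) :
    gaussHess s i.castSucc j.castSucc (lift3 z ζ) = gaussHess s i j z * Real.exp (-s * ζ ^ 2) := by
  refine (gaussHess_lift3 s _ _ z ζ).trans ?_
  simp only [gaussHess, lift3_castSucc, Fin.castSucc_inj]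
  ring

theorem gaussHess_lift3_mixed (s : ℝ) (i : Fin 2) (z : E2) (ζ : ℝ) :
    gaussHess s i.castSucc 2 (lift3 z ζ)
      = gaussGrad s i z * (2 * s * ζ * Real.exp (-s * ζ ^ 2)) := by
  have h : i.castSucc ≠ 2 := Fin.ne_of_lt (Fin.castSucc_lt_last i)
  refine (gaussHess_lift3 s _ _ z ζ).trans ?_
  simp only [gaussGrad, lift3_castSucc, lift3_two, if_neg h]
  ring

theorem gaussHess_lift3_vertical (s : ℝ) (z : E2) (ζ : ℝ) :
    gaussHess s 2 2 (lift3 z ζ)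
      = gaussTwo s z * ((2 * s - 4 * s ^ 2 * ζ ^ 2) * Real.exp (-s * ζ ^ 2)) := by
  rw [gaussHess_lift3]
  simp only [gaussTwo, lift3_two, if_true]
  ring

/-- For two horizontal indices the vertical kernel is `exp (-s ζ²)`, that is `profTwo` plus the
constant `exp (-s)`. The first part yields surface interactions by double integration by parts, and
the second yields the dipole term. -/
theorem cell_formula_castSucc (hf₁ : IsSurface f₁ K B) (hf₂ : IsSurface f₂ K B)
    (hpos : ∀ x, 0 < f₁ x) (hlt : ∀ x, f₁ x < f₂ x) (hs : 0 < s) (i j : Fin 2) :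
    ∫ z, gaussHess s i.castSucc j.castSucc z * cellCorr f₁ f₂ z
      = surfTerm s f₂ f₂ j.castSucc i.castSucc - surfTerm s f₂ f₁ j.castSucc i.castSucc
        - surfTerm s f₁ f₂ j.castSucc i.castSucc + surfTerm s f₁ f₁ j.castSucc i.castSucc
        + dipTerm s f₁ f₂ i.castSucc j.castSucc := by
  have h₁ := hf₁.lip.continuous
  have h₂ := hf₂.lip.continuous
  rw [integral_gaussHess_mul_cellCorr hf₁ hf₂ hpos hs]
  have hvert : ∀ x z : E2, ∫ ζ : ℝ, gaussHess s i.castSucc j.castSucc (lift3 z ζ) *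
      max (min (f₂ x) (f₂ (x + z) - ζ) - max (f₁ x) (f₁ (x + z) - ζ)) 0
      = gaussHess s i j z * (Real.exp (-s) * ((f₂ (x + z) - f₁ (x + z)) * (f₂ x - f₁ x)))
        - gaussHess s i j z * altSum (profZero s) (f₁ x) (f₂ x) (f₁ (x + z)) (f₂ (x + z)) := by
    intro x z
    simp only [gaussHess_lift3_castSucc, mul_assoc]
    -- The removed constant has second antiderivative `exp (-s) t² / 2`. The alternating sum of `t²
    -- / 2` is minus the product of the two thicknesses.
    rw [integral_const_mul, integral_mul_overlap (K' := fun t => profOne s t + Real.exp (-s) * t)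
      (K := fun t => profZero s t + Real.exp (-s) * (t ^ 2 / 2)) ?_ (by fun_prop) ?_ ?_
      (hlt x).le (hlt _).le]
    · simp only [altSum]; ring
    · refine continuous_profile_integrable (A := 1) hs (by fun_prop) fun t => ?_
      rw [abs_of_pos (Real.exp_pos _), one_mul, pow_one]
      exact le_mul_of_one_le_left (Real.exp_pos _).le (by nlinarith [sq_nonneg t])
    · intro t
      refine ((hasDerivAt_profZero s t).add
        (((hasDerivAt_pow 2 t).div_const 2).const_mul (Real.exp (-s)))).congr_deriv ?_
      simp
    · intro t
      refine ((hasDerivAt_profOne s t).add ((hasDerivAt_id t).const_mul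
        (Real.exp (-s)))).congr_deriv ?_
      simp [profTwo]
  simp only [hvert]
  have hkH := integrable_gaussHess hs i j
  obtain ⟨C, hC0, hC⟩ := exists_bound_comp_sub (continuous_profZero s) B
  have hcP := continuous_profZero s
  have ha : Integrable (fun p : E2 × E2 => gaussHess s i j p.2 *
      altSum (profZero s) (f₁ p.1) (f₂ p.1) (f₁ (p.1 + p.2)) (f₂ (p.1 + p.2)))
      ((volume.restrict cellQ).prod volume) := by
    refine integrable_cell_mul hkH (W := fun x z =>
      altSum (profZero s) (f₁ x) (f₂ x) (f₁ (x + z)) (f₂ (x + z))) (C := C + C + C + C)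
      (Continuous.measurable (by unfold altSum; fun_prop)) fun x z => ?_
    unfold altSum
    refine (abs_add_le _ _).trans (add_le_add ((abs_sub _ _).trans (add_le_add
      ((abs_sub _ _).trans (add_le_add ?_ ?_)) ?_)) ?_)
    · exact hC hf₂ hf₂ _ _
    · exact hC hf₁ hf₂ _ _
    · exact hC hf₂ hf₁ _ _
    · exact hC hf₁ hf₁ _ _
  have hd : Integrable (fun p : E2 × E2 => gaussHess s i j p.2 * (Real.exp (-s) *
      ((f₂ (p.1 + p.2) - f₁ (p.1 + p.2)) * (f₂ p.1 - f₁ p.1))))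
      ((volume.restrict cellQ).prod volume) := by
    refine integrable_cell_mul hkH (W := fun x z =>
      Real.exp (-s) * ((f₂ (x + z) - f₁ (x + z)) * (f₂ x - f₁ x)))
      (C := Real.exp (-s) * ((2 * B) * (2 * B)))
      (Continuous.measurable (by fun_prop)) fun x z => ?_
    rw [abs_mul, abs_mul, abs_of_pos (Real.exp_pos _)]
    have h3 := hf₁.abs_sub_le hf₂ x x
    have h4 := hf₁.abs_sub_le hf₂ (x + z) (x + z)
    have hB := hf₁.bound_nonneg
    gcongr
  have hsplit := integral_sub hd ha
  rw [integral_prod _ (by exact hd.sub ha), integral_prod _ ha, integral_prod _ hd] at hsplit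
  refine hsplit.trans ?_
  simp only
  rw [integral_cell_altSum hf₁ hf₂ hkH (continuous_profZero s),
    integral_gaussHess_mul_profZero hf₂ hf₂ hs, integral_gaussHess_mul_profZero hf₁ hf₂ hs,
    integral_gaussHess_mul_profZero hf₂ hf₁ hs, integral_gaussHess_mul_profZero hf₁ hf₁ hs]
  have hdip : ∫ x in cellQ, ∫ z, gaussHess s i j z * (Real.exp (-s) *
      ((f₂ (x + z) - f₁ (x + z)) * (f₂ x - f₁ x))) = dipTerm s f₁ f₂ i.castSucc j.castSucc := by
    unfold dipTerm
    refine integral_congr_ae (Eventually.of_forall fun x => integral_congr_ae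
      (Eventually.of_forall fun z => ?_))
    have hne : ∀ k : Fin 2, (2 : Fin 3) ≠ k.castSucc := fun k =>
      (Fin.ne_of_lt (Fin.castSucc_lt_last k)).symm
    have hone : (1 - Matrix.single 2 2 1 : Matrix (Fin 3) (Fin 3) ℝ) i.castSucc j.castSucc
        = if i = j then 1 else 0 := by
      rw [Matrix.sub_apply, Matrix.single_apply_of_row_ne (hne i), sub_zero, Matrix.one_apply]
      simp only [Fin.castSucc_inj]
    simp only [hone, flatVec_castSucc, gaussHess, mul_add, Real.exp_add, mul_one, add_comm z x]
    ring
  rw [hdip]; ring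

/-- Here the vertical kernel is already a derivative, that of `-profTwo`. The constant subtracted in
`profTwo` adds only a linear term to the second antiderivative, which the alternating sum
annihilates; hence there is no dipole term. -/
theorem cell_formula_mixed (hf₁ : IsSurface f₁ K B) (hf₂ : IsSurface f₂ K B)
    (hpos : ∀ x, 0 < f₁ x) (hlt : ∀ x, f₁ x < f₂ x) (hs : 0 < s) (i : Fin 2) :
    ∫ z, gaussHess s i.castSucc 2 z * cellCorr f₁ f₂ z
      = surfTerm s f₂ f₂ 2 i.castSucc - surfTerm s f₂ f₁ 2 i.castSucc
        - surfTerm s f₁ f₂ 2 i.castSucc + surfTerm s f₁ f₁ 2 i.castSucc := by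
  rw [integral_gaussHess_mul_cellCorr hf₁ hf₂ hpos hs]
  have hvert : ∀ x z : E2, ∫ ζ : ℝ, gaussHess s i.castSucc 2 (lift3 z ζ) *
      max (min (f₂ x) (f₂ (x + z) - ζ) - max (f₁ x) (f₁ (x + z) - ζ)) 0
      = gaussGrad s i z * altSum (profOne s) (f₁ x) (f₂ x) (f₁ (x + z)) (f₂ (x + z)) := by
    intro x z
    have e : ∀ ζ : ℝ, gaussHess s i.castSucc 2 (lift3 z ζ) *
        max (min (f₂ x) (f₂ (x + z) - ζ) - max (f₁ x) (f₁ (x + z) - ζ)) 0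
        = gaussGrad s i z * ((2 * s * ζ * Real.exp (-s * ζ ^ 2)) *
          max (min (f₂ x) (f₂ (x + z) - ζ) - max (f₁ x) (f₁ (x + z) - ζ)) 0) := fun ζ => by
      rw [gaussHess_lift3_mixed, mul_assoc]
    simp only [e]
    rw [integral_const_mul, integral_mul_overlap (K' := fun t => -profTwo s t)
      (K := fun t => -profOne s t) ?_ (by fun_prop) ?_ ?_ (hlt x).le (hlt _).le]
    · simp only [altSum]; ring
    · refine continuous_profile_integrable (A := 2 * s) hs (by fun_prop) fun t => ?_
      rw [abs_mul, abs_of_pos (Real.exp_pos _), abs_mul, abs_of_pos (by positivity : 0 < 2 * s),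
        mul_assoc, pow_one]
      gcongr
      nlinarith [sq_nonneg (|t| - 1), sq_abs t, abs_nonneg t]
    · intro t
      exact (hasDerivAt_profOne s t).neg
    · intro t
      refine (hasDerivAt_profTwo s t).neg.congr_deriv ?_
      ring
  simp only [hvert]
  rw [integral_cell_altSum hf₁ hf₂ (integrable_gaussGrad hs i) (continuous_profOne s),
    integral_gaussGrad_mul_profOne_eq hf₂ hf₂ hs, integral_gaussGrad_mul_profOne_eq hf₁ hf₂ hs,
    integral_gaussGrad_mul_profOne_eq hf₂ hf₁ hs, integral_gaussGrad_mul_profOne_eq hf₁ hf₁ hs]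

/-- The vertical kernel is minus the second derivative of `profTwo`, so no horizontal integration by
parts is needed and the subtracted constant cancels in the alternating sum. -/
theorem cell_formula_vertical (hf₁ : IsSurface f₁ K B) (hf₂ : IsSurface f₂ K B)
    (hpos : ∀ x, 0 < f₁ x) (hlt : ∀ x, f₁ x < f₂ x) (hs : 0 < s) :
    ∫ z, gaussHess s 2 2 z * cellCorr f₁ f₂ z
      = surfTerm s f₂ f₂ 2 2 - surfTerm s f₁ f₂ 2 2 - surfTerm s f₂ f₁ 2 2
        + surfTerm s f₁ f₁ 2 2 := by
  rw [integral_gaussHess_mul_cellCorr hf₁ hf₂ hpos hs]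
  have hvert : ∀ x z : E2, ∫ ζ : ℝ, gaussHess s 2 2 (lift3 z ζ) *
      max (min (f₂ x) (f₂ (x + z) - ζ) - max (f₁ x) (f₁ (x + z) - ζ)) 0
      = gaussTwo s z * altSum (profTwo s) (f₁ x) (f₂ x) (f₁ (x + z)) (f₂ (x + z)) := by
    intro x z
    have e : ∀ ζ : ℝ, gaussHess s 2 2 (lift3 z ζ) *
        max (min (f₂ x) (f₂ (x + z) - ζ) - max (f₁ x) (f₁ (x + z) - ζ)) 0
        = gaussTwo s z * (((2 * s - 4 * s ^ 2 * ζ ^ 2) * Real.exp (-s * ζ ^ 2)) *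
          max (min (f₂ x) (f₂ (x + z) - ζ) - max (f₁ x) (f₁ (x + z) - ζ)) 0) := fun ζ => by
      rw [gaussHess_lift3_vertical, mul_assoc]
    simp only [e]
    rw [integral_const_mul, integral_mul_overlap
      (K' := fun t => 2 * s * t * Real.exp (-s * t ^ 2))
      (K := fun t => -profTwo s t) ?_ (by fun_prop) ?_ ?_ (hlt x).le (hlt _).le]
    · simp only [altSum]; ring
    · refine continuous_profile_integrable (A := 2 * s + 4 * s ^ 2) hs (by fun_prop) fun t => ?_
      rw [abs_mul, abs_of_pos (Real.exp_pos _), ← mul_assoc, pow_one]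
      gcongr
      refine (abs_sub _ _).trans ?_
      rw [abs_of_pos (by positivity : 0 < 2 * s),
        abs_of_nonneg (by positivity : 0 ≤ 4 * s ^ 2 * t ^ 2)]
      nlinarith [mul_nonneg hs.le (sq_nonneg t), sq_nonneg s]
    · intro t
      refine (hasDerivAt_profTwo s t).neg.congr_deriv ?_
      ring
    · intro t
      refine (((hasDerivAt_id t).const_mul (2 * s)).mul (hasDerivAt_exp_neg_mul_sq s t)).congr_deriv
        ?_
      simp; ring
  simp only [hvert]
  rw [integral_cell_altSum hf₁ hf₂ (integrable_gaussTwo hs) (continuous_profTwo s)]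
  simp only [surfTerm, normalVec_two, one_mul, add_comm]

theorem dipTerm_two_right (s : ℝ) (f₁ f₂ : E2 → ℝ) (i : Fin 3) : dipTerm s f₁ f₂ i 2 = 0 := by
  have h : (1 - Matrix.single 2 2 1 : Matrix (Fin 3) (Fin 3) ℝ) i 2 = 0 := by
    fin_cases i <;> simp
  simp [dipTerm, h]

theorem dipTerm_comm (s : ℝ) (f₁ f₂ : E2 → ℝ) (i j : Fin 3) :
    dipTerm s f₁ f₂ i j = dipTerm s f₁ f₂ j i := by
  have h : (1 - Matrix.single 2 2 1 : Matrix (Fin 3) (Fin 3) ℝ) i j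
      = (1 - Matrix.single 2 2 1 : Matrix (Fin 3) (Fin 3) ℝ) j i := by
    fin_cases i <;> fin_cases j <;> simp
  simp only [dipTerm, h, mul_comm (flatVec _ i)]

/-- The gaussian cell energy in terms of surface and dipole interactions. -/
theorem cell_formula (hf₁ : IsSurface f₁ K B) (hf₂ : IsSurface f₂ K B)
    (hpos : ∀ x, 0 < f₁ x) (hlt : ∀ x, f₁ x < f₂ x) (hs : 0 < s) (i j : Fin 3) :
    ∫ z, gaussHess s i j z * cellCorr f₁ f₂ z
      = surfTerm s f₁ f₁ i j + surfTerm s f₂ f₂ i j - surfTerm s f₁ f₂ i j - surfTerm s f₁ f₂ j i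
        + dipTerm s f₁ f₂ i j := by
  have hmixed : ∀ i : Fin 2, ∫ z, gaussHess s i.castSucc 2 z * cellCorr f₁ f₂ z
      = surfTerm s f₁ f₁ i.castSucc 2 + surfTerm s f₂ f₂ i.castSucc 2
        - surfTerm s f₁ f₂ i.castSucc 2 - surfTerm s f₁ f₂ 2 i.castSucc
        + dipTerm s f₁ f₂ i.castSucc 2 := by
    intro i
    rw [cell_formula_mixed hf₁ hf₂ hpos hlt hs, dipTerm_two_right,
      surfTerm_swap hf₂ hf₁ hs 2, surfTerm_swap hf₁ hf₁ hs 2, surfTerm_swap hf₂ hf₂ hs 2]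
    ring
  induction i using Fin.lastCases with
  | last =>
    induction j using Fin.lastCases with
    | last =>
      -- The last index is definitionally `2`, the form in which the vertical formula is stated.
      change ∫ z, gaussHess s 2 2 z * cellCorr f₁ f₂ z = surfTerm s f₁ f₁ 2 2
        + surfTerm s f₂ f₂ 2 2 - surfTerm s f₁ f₂ 2 2 - surfTerm s f₁ f₂ 2 2 + dipTerm s f₁ f₂ 2 2
      rw [cell_formula_vertical hf₁ hf₂ hpos hlt hs, dipTerm_two_right, surfTerm_swap hf₂ hf₁ hs]
      ring
    | cast j =>
      have h := hmixed j
      simp only [gaussHess_comm s j.castSucc 2] at h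
      refine h.trans ?_
      rw [surfTerm_swap hf₁ hf₁ hs j.castSucc, surfTerm_swap hf₂ hf₂ hs j.castSucc, dipTerm_comm]
      change _ = surfTerm s f₁ f₁ 2 j.castSucc + surfTerm s f₂ f₂ 2 j.castSucc
        - surfTerm s f₁ f₂ 2 j.castSucc - surfTerm s f₁ f₂ j.castSucc 2
        + dipTerm s f₁ f₂ 2 j.castSucc
      ring
  | cast i =>
    induction j using Fin.lastCases with
    | last => exact hmixed i
    | cast j =>
      rw [cell_formula_castSucc hf₁ hf₂ hpos hlt hs, surfTerm_swap hf₂ hf₁ hs j.castSucc,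
        surfTerm_swap hf₁ hf₁ hs j.castSucc, surfTerm_swap hf₂ hf₂ hs j.castSucc]
      ring

end CellFormula

/-! ### Integration over the gaussian width -/

/-- Fubini with the width integrated first: its absolute integral is needed only up to a bound
integrable in the remaining variables. -/
theorem integral_swap_of_bound {X : Type*} [MeasurableSpace X] {μ : Measure X} [SFinite μ]
    {k : ℝ → X → ℝ} (hk : Measurable fun p : ℝ × X => k p.1 p.2) {b v : X → ℝ}
    (hb : Integrable b μ)
    (h : ∀ᵐ p ∂μ, IntegrableOn (fun s => k s p) (Set.Ioi 0) ∧
      ∫ s in Set.Ioi 0, |k s p| ≤ b p ∧ ∫ s in Set.Ioi 0, k s p = v p) :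
    IntegrableOn (fun s => ∫ p, k s p ∂μ) (Set.Ioi 0) ∧ Integrable v μ ∧
      ∫ s in Set.Ioi 0, ∫ p, k s p ∂μ = ∫ p, v p ∂μ := by
  have hi : Integrable (fun p : ℝ × X => k p.1 p.2)
      ((volume.restrict (Set.Ioi (0 : ℝ))).prod μ) := by
    rw [integrable_prod_iff' hk.aestronglyMeasurable]
    refine ⟨h.mono fun p hp => hp.1, hb.mono' ?_ (h.mono fun p hp => ?_)⟩
    · exact (hk.norm.aestronglyMeasurable.prod_swap).integral_prod_right'
    · rw [Real.norm_of_nonneg (integral_nonneg fun _ => norm_nonneg _)]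
      exact hp.2.1
  have hv : (fun p => ∫ s in Set.Ioi 0, k s p) =ᵐ[μ] v := h.mono fun p hp => hp.2.2
  refine ⟨hi.integral_prod_left, hi.integral_prod_right.congr hv, ?_⟩
  rw [integral_integral_swap hi]
  exact integral_congr_ae hv

theorem heatWeight_mul_pow {s : ℝ} (hs : 0 < s) (k : ℕ) (r : ℝ) :
    heatWeight s * (s ^ k * Real.exp (-s * r))
      = 1 / (4 * (Real.pi * √Real.pi)) * (s ^ ((k : ℝ) + 1 / 2 - 1) * Real.exp (-(r * s))) := by
  have h : s ^ ((k : ℝ) + 1 / 2 - 1) = s ^ k / √s := by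
    rw [show (k : ℝ) + 1 / 2 - 1 = k - 1 / 2 by ring, Real.rpow_sub hs, Real.rpow_natCast,
      Real.sqrt_eq_rpow]
  rw [h, heatWeight, show -s * r = -(r * s) by ring]
  have := Real.sqrt_pos.2 hs
  have := Real.sqrt_pos.2 Real.pi_pos
  have := Real.pi_pos
  field_simp

theorem integral_heatWeight_mul_pow {r : ℝ} (hr : 0 < r) (k : ℕ) :
    ∫ s in Set.Ioi 0, heatWeight s * (s ^ k * Real.exp (-s * r))
      = 1 / (4 * (Real.pi * √Real.pi)) * ((1 / r) ^ ((k : ℝ) + 1 / 2) *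
          Real.Gamma ((k : ℝ) + 1 / 2)) := by
  rw [setIntegral_congr_fun measurableSet_Ioi fun s hs => heatWeight_mul_pow hs k r,
    integral_const_mul, Real.integral_rpow_mul_exp_neg_mul_Ioi (by positivity) hr]

/-- A nonzero value of the integral already forces integrability. -/
theorem integrableOn_heatWeight_mul_pow {r : ℝ} (hr : 0 < r) (k : ℕ) :
    IntegrableOn (fun s => heatWeight s * (s ^ k * Real.exp (-s * r))) (Set.Ioi 0) := by
  apply Integrable.of_integral_ne_zero
  rw [integral_heatWeight_mul_pow hr]
  have h1 := Real.Gamma_pos_of_pos (show (0 : ℝ) < (k : ℝ) + 1 / 2 by positivity)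
  have h2 := Real.pi_pos
  positivity

theorem integral_heatWeight_mul_exp {r : ℝ} (hr : 0 < r) :
    ∫ s in Set.Ioi 0, heatWeight s * Real.exp (-s * r) = 1 / (4 * Real.pi) * (1 / √r) := by
  have h := integral_heatWeight_mul_pow hr 0
  simp only [pow_zero, one_mul] at h
  rw [h]
  have := Real.sqrt_pos.2 hr
  have := Real.sqrt_pos.2 Real.pi_pos
  have := Real.pi_pos
  rw [show ((0 : ℕ) : ℝ) + 1 / 2 = 1 / 2 by norm_num, Real.Gamma_one_half_eq,
    Real.div_rpow zero_le_one hr.le, Real.one_rpow, ← Real.sqrt_eq_rpow]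
  field_simp

theorem integrableOn_heatWeight_mul_exp {r : ℝ} (hr : 0 < r) :
    IntegrableOn (fun s => heatWeight s * Real.exp (-s * r)) (Set.Ioi 0) := by
  have h := integrableOn_heatWeight_mul_pow hr 0
  simpa only [pow_zero, one_mul] using h

theorem integral_heatWeight_mul_id {r : ℝ} (hr : 0 < r) :
    ∫ s in Set.Ioi 0, heatWeight s * (s ^ 1 * Real.exp (-s * r))
      = 1 / (8 * Real.pi) * (1 / r ^ (3 / 2 : ℝ)) := by
  rw [integral_heatWeight_mul_pow hr 1]
  have hg : Real.Gamma (3 / 2) = 1 / 2 * √Real.pi := by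
    rw [show (3 / 2 : ℝ) = 1 / 2 + 1 by norm_num, Real.Gamma_add_one (by norm_num),
      Real.Gamma_one_half_eq]
  have := Real.rpow_pos_of_pos hr (3 / 2)
  have := Real.sqrt_pos.2 Real.pi_pos
  have := Real.pi_pos
  rw [show ((1 : ℕ) : ℝ) + 1 / 2 = 3 / 2 by norm_num, hg,
    Real.div_rpow zero_le_one hr.le, Real.one_rpow]
  field_simp
  norm_num

theorem integral_heatWeight_mul_sq {r : ℝ} (hr : 0 < r) :
    ∫ s in Set.Ioi 0, heatWeight s * (s ^ 2 * Real.exp (-s * r))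
      = 3 / (16 * Real.pi) * (1 / r ^ (5 / 2 : ℝ)) := by
  rw [integral_heatWeight_mul_pow hr 2]
  have hg : Real.Gamma (5 / 2) = 3 / 4 * √Real.pi := by
    rw [show (5 / 2 : ℝ) = 1 / 2 + 1 + 1 by norm_num, Real.Gamma_add_one (by norm_num),
      Real.Gamma_add_one (by norm_num), Real.Gamma_one_half_eq]
    ring
  have := Real.rpow_pos_of_pos hr (5 / 2)
  have := Real.sqrt_pos.2 Real.pi_pos
  have := Real.pi_pos
  rw [show ((2 : ℕ) : ℝ) + 1 / 2 = 5 / 2 by norm_num, hg,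
    Real.div_rpow zero_le_one hr.le, Real.one_rpow]
  field_simp
  norm_num

/-! ### The surface interaction -/

/-- For fixed `p` and `q` the difference of exponentials has one sign for all `s`, so the absolute
value can be taken after integration. -/
theorem integral_abs_heatWeight_exp_sub {p q : ℝ} (hp : 0 < p) (hq : 0 < q) :
    ∫ s in Set.Ioi 0, |heatWeight s * Real.exp (-s * p) - heatWeight s * Real.exp (-s * q)|
      = |1 / (4 * Real.pi) * (1 / √p) - 1 / (4 * Real.pi) * (1 / √q)| := by
  wlog hpq : p ≤ q generalizing p q
  · rw [abs_sub_comm, ← this hq hp (le_of_not_ge hpq)]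
    simp only [abs_sub_comm]
  have h : ∀ s ∈ Set.Ioi (0 : ℝ),
      |heatWeight s * Real.exp (-s * p) - heatWeight s * Real.exp (-s * q)|
        = heatWeight s * Real.exp (-s * p) - heatWeight s * Real.exp (-s * q) := by
    intro s hs
    rw [abs_of_nonneg]
    rw [sub_nonneg]
    refine mul_le_mul_of_nonneg_left (Real.exp_le_exp.2 ?_) (heatWeight_nonneg s)
    have hs' : (0 : ℝ) < s := hs
    nlinarith
  rw [setIntegral_congr_fun measurableSet_Ioi h,
    integral_sub (integrableOn_heatWeight_mul_exp hp) (integrableOn_heatWeight_mul_exp hq),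
    integral_heatWeight_mul_exp hp, integral_heatWeight_mul_exp hq, abs_of_nonneg]
  rw [sub_nonneg]
  have := Real.pi_pos
  have := Real.sqrt_pos.2 hp
  have := Real.sqrt_le_sqrt hpq
  gcongr

/-- With `p` and `q` the two roots, the difference is `(1 - t²) / (p q (p + q))`, where `p ≥ ρ` and
`q (p + q) ≥ 1 + ρ²`. The regularizing term thus improves the decay to `ρ⁻³`, which is integrable at
infinity in the plane. -/
theorem abs_one_div_sqrt_sub_le {ρ t D : ℝ} (hρ : 0 < ρ) (ht : |t| ≤ D) :
    |1 / √(ρ ^ 2 + t ^ 2) - 1 / √(ρ ^ 2 + 1)| ≤ (1 + D ^ 2) * (ρ⁻¹ * (1 + ρ ^ 2)⁻¹) := by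
  set p := √(ρ ^ 2 + t ^ 2)
  set q := √(ρ ^ 2 + 1)
  have hp2 : p ^ 2 = ρ ^ 2 + t ^ 2 := Real.sq_sqrt (by positivity)
  have hq2 : q ^ 2 = ρ ^ 2 + 1 := Real.sq_sqrt (by positivity)
  have hp : ρ ≤ p := Real.le_sqrt_of_sq_le (by nlinarith [sq_nonneg t])
  have hp0 : 0 < p := hρ.trans_le hp
  have hq0 : 0 < q := Real.sqrt_pos.2 (by positivity)
  have e : 1 / p - 1 / q = (1 - t ^ 2) / (p * (q * (q + p))) := by
    have h : (q - p) * (q + p) = 1 - t ^ 2 := by linear_combination hq2 - hp2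
    rw [← h]
    field_simp
  have ht2 : t ^ 2 ≤ D ^ 2 := by
    rw [← sq_abs t]; exact pow_le_pow_left₀ (abs_nonneg _) ht 2
  have hn : |1 - t ^ 2| ≤ 1 + D ^ 2 := by
    rw [abs_le]; constructor <;> nlinarith [sq_nonneg t]
  rw [e, abs_div, abs_of_pos (a := p * (q * (q + p))) (by positivity), ← mul_inv, ← div_eq_mul_inv]
  have hd : ρ * (1 + ρ ^ 2) ≤ p * (q * (q + p)) := by
    refine mul_le_mul hp ?_ (by positivity) hp0.le
    nlinarith [mul_pos hq0 hp0]
  gcongr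

/-- In polar coordinates the jacobian cancels the singularity and leaves `1 / (1 + y²)` on the
half-line. -/
theorem integrable_inv_norm_mul :
    Integrable fun z : E2 => ‖z‖⁻¹ * (1 + ‖z‖ ^ 2)⁻¹ := by
  have h := (integrable_fun_norm_addHaar (volume : Measure E2)
    (f := fun y : ℝ => y⁻¹ * (1 + y ^ 2)⁻¹)).2
  refine h ?_
  refine (integrable_inv_one_add_sq.integrableOn (s := Set.Ioi 0)).congr_fun ?_ measurableSet_Ioi
  intro y hy
  have hy' : (0 : ℝ) < y := hy
  simp only [finrank_euclideanSpace, Fintype.card_fin, smul_eq_mul, Nat.add_one_sub_one, pow_one]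
  field_simp

theorem ae_snd_ne_zero :
    ∀ᵐ p : E2 × E2 ∂((volume.restrict cellQ).prod volume), p.2 ≠ 0 := by
  have h : ∀ᵐ z : E2, z ≠ 0 := by
    rw [ae_iff]; simp
  exact Measure.quasiMeasurePreserving_snd.ae h

section Surface

variable {f g f₁ f₂ : E2 → ℝ} {K : NNReal} {B : ℝ}

/-- The gaussian times `profTwo` is a difference of two exponentials in `s`, which the weight
integrates to a difference of inverse distances. Away from the null set `z = 0` that difference has
an integrable bound, and this justifies exchanging the integrals. -/
theorem integral_heatWeight_surfTerm (hf : IsSurface f K B) (hg : IsSurface g K B)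
    (i j : Fin 3) :
    IntegrableOn (fun s => heatWeight s * surfTerm s f g i j) (Set.Ioi 0) ∧
      ∫ s in Set.Ioi 0, heatWeight s * surfTerm s f g i j
        = 1 / (4 * Real.pi) * surfaceMatrix f g i j := by
  set μ := (volume.restrict cellQ).prod (volume : Measure E2)
  set N : E2 × E2 → ℝ := fun p => normalVec f p.1 i * normalVec g (p.2 + p.1) j
  set k : ℝ → E2 × E2 → ℝ := fun s p =>
    heatWeight s * (gaussTwo s p.2 * (N p * profTwo s (g (p.2 + p.1) - f p.1)))
  have hfc := hf.lip.continuous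
  have hgc := hg.lip.continuous
  have hN : Measurable N := ((measurable_normalVec f i).comp measurable_fst).mul
    ((measurable_normalVec g j).comp (measurable_snd.add measurable_fst))
  have hNb : ∀ p, |N p| ≤ (K + 1) * (K + 1) := fun p => by
    rw [abs_mul]
    have h1 := hf.abs_normalVec_le p.1 i
    have h2 := hg.abs_normalVec_le (p.2 + p.1) j
    gcongr
  have hk : Measurable fun p : ℝ × (E2 × E2) => k p.1 p.2 := by
    have h1 : Measurable fun p : ℝ × (E2 × E2) => gaussTwo p.1 p.2.2 := by
      unfold gaussTwo; exact Continuous.measurable (by fun_prop)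
    have h2 : Measurable fun p : ℝ × (E2 × E2) =>
        profTwo p.1 (g (p.2.2 + p.2.1) - f p.2.1) := by
      unfold profTwo; exact Continuous.measurable (by fun_prop)
    exact (measurable_heatWeight.comp measurable_fst).mul
      (h1.mul ((hN.comp measurable_snd).mul h2))
  set b : E2 × E2 → ℝ := fun p =>
    ((K + 1) * (K + 1) * (1 / (4 * Real.pi) * (1 + (2 * B) ^ 2))) * (‖p.2‖⁻¹ * (1 + ‖p.2‖ ^ 2)⁻¹)
  have hb : Integrable b μ :=
    (integrable_inv_norm_mul.comp_snd (volume.restrict cellQ)).const_mul _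
  set v : E2 × E2 → ℝ := fun p => 1 / (4 * Real.pi) *
    (N p / √(‖p.2‖ ^ 2 + |g (p.2 + p.1) - f p.1| ^ 2) - N p / √(‖p.2‖ ^ 2 + 1))
  have hkey : ∀ᵐ p ∂μ, IntegrableOn (fun s => k s p) (Set.Ioi 0) ∧
      ∫ s in Set.Ioi 0, |k s p| ≤ b p ∧ ∫ s in Set.Ioi 0, k s p = v p := by
    filter_upwards [ae_snd_ne_zero] with p hp
    have hρ : 0 < ‖p.2‖ := norm_pos_iff.2 hp
    set t := g (p.2 + p.1) - f p.1
    have hP : 0 < ‖p.2‖ ^ 2 + t ^ 2 := by positivity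
    have hQ : 0 < ‖p.2‖ ^ 2 + 1 := by positivity
    have hkp : (fun s => k s p) = fun s => N p * (heatWeight s * Real.exp (-s * (‖p.2‖ ^ 2 + t ^ 2))
        - heatWeight s * Real.exp (-s * (‖p.2‖ ^ 2 + 1))) := by
      funext s
      simp only [k, gaussTwo, profTwo, mul_add, mul_one, Real.exp_add]
      ring
    have hi := (integrableOn_heatWeight_mul_exp hP).sub (integrableOn_heatWeight_mul_exp hQ)
    refine ⟨?_, ?_, ?_⟩
    · rw [hkp]; exact hi.const_mul _
    · have : (fun s => |k s p|) = fun s =>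
          |N p| * |heatWeight s * Real.exp (-s * (‖p.2‖ ^ 2 + t ^ 2))
            - heatWeight s * Real.exp (-s * (‖p.2‖ ^ 2 + 1))| := by
        funext s; rw [congrFun hkp s, abs_mul]
      rw [this, integral_const_mul, integral_abs_heatWeight_exp_sub hP hQ, ← mul_sub,
        abs_mul (1 / (4 * Real.pi)), abs_of_nonneg (a := 1 / (4 * Real.pi)) (by have := Real.pi_pos; positivity)]
      have h1 := abs_one_div_sqrt_sub_le hρ (hf.abs_sub_le hg p.1 (p.2 + p.1))
      have h2 := hNb p
      have := Real.pi_pos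
      calc _ ≤ (K + 1) * (K + 1) * (1 / (4 * Real.pi) *
            ((1 + (2 * B) ^ 2) * (‖p.2‖⁻¹ * (1 + ‖p.2‖ ^ 2)⁻¹))) := by gcongr
        _ = b p := by simp only [b]; ring
    · rw [hkp, integral_const_mul, integral_sub (integrableOn_heatWeight_mul_exp hP)
        (integrableOn_heatWeight_mul_exp hQ), integral_heatWeight_mul_exp hP,
        integral_heatWeight_mul_exp hQ]
      simp only [v, sq_abs]
      simp only [t]
      ring
  obtain ⟨h1, h2, h3⟩ := integral_swap_of_bound hk hb hkey
  have hsurf : Set.EqOn (fun s => ∫ p, k s p ∂μ) (fun s => heatWeight s * surfTerm s f g i j)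
      (Set.Ioi 0) := by
    intro s hs
    simp only [k]
    rw [integral_const_mul, surfTerm, integral_prod]
    exact integrable_cell_mul (integrable_gaussTwo hs)
      (W := fun x z => normalVec f x i * normalVec g (z + x) j * profTwo s (g (z + x) - f x))
      (measurable_surf_integrand hf hg s i j) (abs_surf_integrand_le hf hg hs i j)
  refine ⟨h1.congr_fun hsurf measurableSet_Ioi, ?_⟩
  rw [← setIntegral_congr_fun measurableSet_Ioi hsurf, h3, integral_prod _ h2]
  simp only [v, surfaceMatrix, Matrix.of_apply, integral_const_mul, N]

/-! ### The dipole interaction -/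

theorem abs_flatVec_mul_le (z : E2) (i j : Fin 3) :
    |flatVec z i * flatVec z j| ≤ ‖z‖ ^ 2 := by
  have h : ∀ i, |flatVec z i| ≤ ‖z‖ := by
    refine forall_fin_three (fun i => ?_) ?_
    · rw [flatVec_castSucc]; exact abs_apply_le_norm _ _
    · simp
  rw [abs_mul, sq]
  exact mul_le_mul (h i) (h j) (abs_nonneg _) (norm_nonneg _)

theorem abs_one_sub_single_le (i j : Fin 3) :
    |(1 - Matrix.single 2 2 1 : Matrix (Fin 3) (Fin 3) ℝ) i j| ≤ 1 := by
  fin_cases i <;> fin_cases j <;> simp [Matrix.single]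

theorem abs_dipole_coeff_le {s d q ρ : ℝ} (hs : 0 < s) (hd : |d| ≤ 1) (hq : |q| ≤ ρ ^ 2) :
    |2 * s * d - 4 * s ^ 2 * q| ≤ 2 * s + 4 * s ^ 2 * ρ ^ 2 := by
  refine (abs_sub _ _).trans ?_
  rw [abs_mul (2 * s), abs_mul (4 * s ^ 2), abs_of_pos (show 0 < 2 * s by positivity),
    abs_of_pos (show 0 < 4 * s ^ 2 by positivity)]
  have : 2 * s * |d| ≤ 2 * s * 1 := by gcongr
  have : 4 * s ^ 2 * |q| ≤ 4 * s ^ 2 * ρ ^ 2 := by gcongr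
  linarith

theorem continuous_flatVec_apply (i : Fin 3) : Continuous fun z => flatVec z i := by
  refine forall_fin_three (p := fun i => Continuous fun z => flatVec z i) (fun i => ?_) ?_ i
  · simp only [flatVec_castSucc]; fun_prop
  · simp only [flatVec_two]; fun_prop

/-- The factors `s` and `s²` integrate, through values of the Gamma function, to the powers `-3/2`
and `-5/2` of `‖z‖² + 1`. -/
theorem integral_heatWeight_dipTerm (hf₁ : IsSurface f₁ K B) (hf₂ : IsSurface f₂ K B)
    (i j : Fin 3) :
    IntegrableOn (fun s => heatWeight s * dipTerm s f₁ f₂ i j) (Set.Ioi 0) ∧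
      ∫ s in Set.Ioi 0, heatWeight s * dipTerm s f₁ f₂ i j
        = 1 / (4 * Real.pi) * dipoleMatrix f₁ f₂ i j := by
  set μ := (volume.restrict cellQ).prod (volume : Measure E2)
  set d : ℝ := (1 - Matrix.single 2 2 1 : Matrix (Fin 3) (Fin 3) ℝ) i j with hd
  have hd1 : |d| ≤ 1 := abs_one_sub_single_le i j
  set P : E2 → ℝ := fun z => flatVec z i * flatVec z j
  have hPc : Continuous P := (continuous_flatVec_apply i).mul (continuous_flatVec_apply j)
  set N : E2 × E2 → ℝ := fun p =>
    (f₂ (p.2 + p.1) - f₁ (p.2 + p.1)) * (f₂ p.1 - f₁ p.1)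
  have hc₁ := hf₁.lip.continuous
  have hc₂ := hf₂.lip.continuous
  have hN : Continuous N := by fun_prop
  have hNb : ∀ p, |N p| ≤ (2 * B) * (2 * B) := fun p => by
    have hB := hf₁.bound_nonneg
    rw [abs_mul]
    have h1 := hf₁.abs_sub_le hf₂ (p.2 + p.1) (p.2 + p.1)
    have h2 := hf₁.abs_sub_le hf₂ p.1 p.1
    gcongr
  set k : ℝ → E2 × E2 → ℝ := fun s p =>
    heatWeight s * (((2 * s * d - 4 * s ^ 2 * P p.2) * Real.exp (-s * (‖p.2‖ ^ 2 + 1))) * N p)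
  have hk : Measurable fun p : ℝ × (E2 × E2) => k p.1 p.2 := by
    have h1 : Measurable fun p : ℝ × (E2 × E2) =>
        ((2 * p.1 * d - 4 * p.1 ^ 2 * P p.2.2) * Real.exp (-p.1 * (‖p.2.2‖ ^ 2 + 1))) * N p.2 :=
      Continuous.measurable (by fun_prop)
    exact (measurable_heatWeight.comp measurable_fst).mul h1
  -- The two terms contribute at most `(1 + 3) / (4 π) = 1 / π` times `(1 + ‖z‖²)^(-3/2)`, which is
  -- integrable because `3` exceeds the dimension.
  set b : E2 × E2 → ℝ := fun p =>
    ((2 * B) * (2 * B) * (1 / Real.pi)) * (1 + ‖p.2‖ ^ 2) ^ (-3 / 2 : ℝ)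
  have hb : Integrable b μ := by
    have h := integrable_rpow_neg_one_add_norm_sq (E := E2) (μ := volume) (r := 3) (by simp; norm_num)
    exact (h.comp_snd (volume.restrict cellQ)).const_mul _
  set v : E2 × E2 → ℝ := fun p => 1 / (4 * Real.pi) *
    ((d / (‖p.2‖ ^ 2 + 1) ^ (3 / 2 : ℝ) - 3 * P p.2 / (‖p.2‖ ^ 2 + 1) ^ (5 / 2 : ℝ)) * N p)
  have hkey : ∀ᵐ p ∂μ, IntegrableOn (fun s => k s p) (Set.Ioi 0) ∧
      ∫ s in Set.Ioi 0, |k s p| ≤ b p ∧ ∫ s in Set.Ioi 0, k s p = v p := by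
    refine Eventually.of_forall fun p => ?_
    have hr : 0 < ‖p.2‖ ^ 2 + 1 := by positivity
    have hkp : (fun s => k s p) = fun s =>
        2 * d * N p * (heatWeight s * (s ^ 1 * Real.exp (-s * (‖p.2‖ ^ 2 + 1))))
        - 4 * P p.2 * N p * (heatWeight s * (s ^ 2 * Real.exp (-s * (‖p.2‖ ^ 2 + 1)))) := by
      funext s; simp only [k]; ring
    have hi1 := integrableOn_heatWeight_mul_pow hr 1
    have hi2 := integrableOn_heatWeight_mul_pow hr 2
    have hi : IntegrableOn (fun s => k s p) (Set.Ioi 0) := by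
      rw [hkp]; exact (hi1.const_mul _).sub (hi2.const_mul _)
    refine ⟨hi, ?_, ?_⟩
    · have hle : ∫ s in Set.Ioi 0, |k s p| ≤ ∫ s in Set.Ioi 0,
          ((2 * B) * (2 * B) * (2 * (heatWeight s * (s ^ 1 * Real.exp (-s * (‖p.2‖ ^ 2 + 1))))
          + 4 * ‖p.2‖ ^ 2 * (heatWeight s * (s ^ 2 * Real.exp (-s * (‖p.2‖ ^ 2 + 1)))))) := by
        refine setIntegral_mono_on hi.abs
          (((hi1.const_mul _).add (hi2.const_mul _)).const_mul _) measurableSet_Ioi fun s hs => ?_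
        have hs' : (0 : ℝ) < s := hs
        have hw := heatWeight_nonneg s
        have hP := abs_flatVec_mul_le p.2 i j
        have h1 := abs_dipole_coeff_le hs' hd1 hP
        have hN' := hNb p
        simp only [k]
        rw [abs_mul (heatWeight s), abs_mul _ (N p), abs_mul _ (Real.exp _), abs_of_nonneg hw,
          abs_of_pos (Real.exp_pos _)]
        calc _ ≤ heatWeight s * ((2 * s + 4 * s ^ 2 * ‖p.2‖ ^ 2) *
              Real.exp (-s * (‖p.2‖ ^ 2 + 1)) * (2 * B * (2 * B))) := by gcongr
          _ = _ := by ring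
      refine hle.trans ?_
      rw [integral_const_mul, integral_add (hi1.const_mul _) (hi2.const_mul _),
        integral_const_mul, integral_const_mul, integral_heatWeight_mul_id hr,
        integral_heatWeight_mul_sq hr]
      simp only [b]
      have hB := hf₁.bound_nonneg
      have hpi := Real.pi_pos
      have e5 : (‖p.2‖ ^ 2 + 1) ^ (5 / 2 : ℝ)
          = (‖p.2‖ ^ 2 + 1) ^ (3 / 2 : ℝ) * (‖p.2‖ ^ 2 + 1) := by
        rw [show (5 / 2 : ℝ) = 3 / 2 + 1 by norm_num, Real.rpow_add_one hr.ne']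
      have e3 : (1 + ‖p.2‖ ^ 2) ^ (-3 / 2 : ℝ) = 1 / (‖p.2‖ ^ 2 + 1) ^ (3 / 2 : ℝ) := by
        rw [add_comm, show (-3 / 2 : ℝ) = -(3 / 2) by norm_num, Real.rpow_neg hr.le, one_div]
      rw [e5, e3]
      have h3 : 0 < (‖p.2‖ ^ 2 + 1) ^ (3 / 2 : ℝ) := Real.rpow_pos_of_pos hr _
      have hq : ‖p.2‖ ^ 2 / (‖p.2‖ ^ 2 + 1) ≤ 1 := by
        rw [div_le_one hr]; linarith
      rw [mul_assoc (2 * B * (2 * B)) (1 / Real.pi)]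
      refine mul_le_mul_of_nonneg_left ?_ (show 0 ≤ 2 * B * (2 * B) by positivity)
      calc _ = 1 / (4 * Real.pi) * (1 / (‖p.2‖ ^ 2 + 1) ^ (3 / 2 : ℝ)) *
            (1 + 3 * (‖p.2‖ ^ 2 / (‖p.2‖ ^ 2 + 1))) := by field_simp; ring
        _ ≤ 1 / (4 * Real.pi) * (1 / (‖p.2‖ ^ 2 + 1) ^ (3 / 2 : ℝ)) * (1 + 3 * 1) := by gcongr
        _ = _ := by field_simp; ring
    · rw [hkp, integral_sub (hi1.const_mul _) (hi2.const_mul _), integral_const_mul,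
        integral_const_mul, integral_heatWeight_mul_id hr, integral_heatWeight_mul_sq hr]
      simp only [v]
      ring
  obtain ⟨h1, h2, h3⟩ := integral_swap_of_bound hk hb hkey
  have hdip : Set.EqOn (fun s => ∫ p, k s p ∂μ) (fun s => heatWeight s * dipTerm s f₁ f₂ i j)
      (Set.Ioi 0) := by
    intro s hs
    have hs' : (0 : ℝ) < s := hs
    have hi : Integrable fun z : E2 =>
        (2 * s * d - 4 * s ^ 2 * P z) * Real.exp (-s * (‖z‖ ^ 2 + 1)) := by
      refine integrable_of_gaussian_bound (A := 2 * s + 4 * s ^ 2) (k := 1) (s := s)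
        (by fun_prop) hs' fun z => ?_
      have hP := abs_flatVec_mul_le z i j
      have h1 : |2 * s * d - 4 * s ^ 2 * P z| ≤ (2 * s + 4 * s ^ 2) * (1 + ‖z‖ ^ 2) ^ 1 := by
        refine (abs_dipole_coeff_le hs' hd1 hP).trans ?_
        nlinarith [sq_nonneg ‖z‖, sq_nonneg s, mul_nonneg hs'.le (sq_nonneg ‖z‖)]
      have h2 : Real.exp (-s * (‖z‖ ^ 2 + 1)) ≤ Real.exp (-s * ‖z‖ ^ 2) :=
        Real.exp_le_exp.2 (by nlinarith)
      rw [abs_mul, abs_of_pos (Real.exp_pos _), ← mul_assoc (2 * s + 4 * s ^ 2)]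
      exact mul_le_mul h1 h2 (Real.exp_pos _).le (by positivity)
    simp only [k]
    rw [integral_const_mul, dipTerm, integral_prod]
    exact integrable_cell_mul hi
      (W := fun x z => (f₂ (z + x) - f₁ (z + x)) * (f₂ x - f₁ x))
      (by exact hN.measurable) (fun x z => hNb (x, z))
  refine ⟨h1.congr_fun hdip measurableSet_Ioi, ?_⟩
  rw [← setIntegral_congr_fun measurableSet_Ioi hdip, h3, integral_prod _ h2]
  simp only [v, dipoleMatrix, Matrix.of_apply, integral_const_mul, N, P, hd]

/-! ### The homogenized matrix -/

theorem integrableOn_heatWeight_cell (hf₁ : IsSurface f₁ K B) (hf₂ : IsSurface f₂ K B)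
    (hpos : ∀ x, 0 < f₁ x) (hlt : ∀ x, f₁ x < f₂ x) (i j : Fin 3) :
    IntegrableOn (fun s => heatWeight s * ∫ z, gaussHess s i j z * cellCorr f₁ f₂ z)
        (Set.Ioi 0) ∧
      ∫ s in Set.Ioi 0, heatWeight s * ∫ z, gaussHess s i j z * cellCorr f₁ f₂ z
        = 1 / (4 * Real.pi) * (surfaceMatrix f₁ f₁ i j + surfaceMatrix f₂ f₂ i j
          - surfaceMatrix f₁ f₂ i j - surfaceMatrix f₁ f₂ j i + dipoleMatrix f₁ f₂ i j) := by
  have h11 := integral_heatWeight_surfTerm hf₁ hf₁ i j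
  have h22 := integral_heatWeight_surfTerm hf₂ hf₂ i j
  have h12 := integral_heatWeight_surfTerm hf₁ hf₂ i j
  have h21 := integral_heatWeight_surfTerm hf₁ hf₂ j i
  have hd := integral_heatWeight_dipTerm hf₁ hf₂ i j
  have he : Set.EqOn (fun s => heatWeight s * surfTerm s f₁ f₁ i j
        + heatWeight s * surfTerm s f₂ f₂ i j - heatWeight s * surfTerm s f₁ f₂ i j
        - heatWeight s * surfTerm s f₁ f₂ j i + heatWeight s * dipTerm s f₁ f₂ i j)
      (fun s => heatWeight s * ∫ z, gaussHess s i j z * cellCorr f₁ f₂ z) (Set.Ioi 0) := by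
    intro s hs
    simp only
    rw [cell_formula hf₁ hf₂ hpos hlt hs]
    ring
  have i1 := h11.1.add h22.1
  have i2 := i1.sub h12.1
  have i3 := i2.sub h21.1
  refine ⟨(i3.add hd.1).congr_fun he measurableSet_Ioi, ?_⟩
  rw [← setIntegral_congr_fun measurableSet_Ioi he, integral_add (by exact i3) hd.1,
    integral_sub (by exact i2) h21.1, integral_sub (by exact i1) h12.1,
    integral_add h11.1 h22.1, h11.2, h22.2, h12.2, h21.2, hd.2]
  ring

/-- The integral produces `S(f₁, f₂)` plus its transpose, whereas `Ahom` contains twice `S(f₁, f₂)`.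
The difference is antisymmetric and vanishes against a symmetric `G`. -/
theorem sum_mul_integral_cell (hf₁ : IsSurface f₁ K B) (hf₂ : IsSurface f₂ K B)
    (hpos : ∀ x, 0 < f₁ x) (hlt : ∀ x, f₁ x < f₂ x) {G : Fin 3 → Fin 3 → ℝ}
    (hG : ∀ i j, G i j = G j i) :
    ∑ i, ∑ j, G i j * ∫ s in Set.Ioi 0, heatWeight s *
        ∫ z, gaussHess s i j z * cellCorr f₁ f₂ z
      = ∑ i, ∑ j, G i j * Ahom f₁ f₂ i j := by
  have h : ∀ i j, G i j * ∫ s in Set.Ioi 0, heatWeight s *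
        ∫ z, gaussHess s i j z * cellCorr f₁ f₂ z
      = G i j * Ahom f₁ f₂ i j + (1 / (4 * Real.pi) * (G i j * surfaceMatrix f₁ f₂ i j)
        - 1 / (4 * Real.pi) * (G i j * surfaceMatrix f₁ f₂ j i)) := by
    intro i j
    rw [(integrableOn_heatWeight_cell hf₁ hf₂ hpos hlt i j).2]
    simp only [Ahom, Matrix.add_apply, Matrix.sub_apply, Matrix.smul_apply, smul_eq_mul]
    have := Real.pi_pos
    field_simp
    ring
  simp only [h, Finset.sum_add_distrib, Finset.sum_sub_distrib]
  rw [add_eq_left, sub_eq_zero, Finset.sum_comm]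
  refine Finset.sum_congr rfl fun i _ => Finset.sum_congr rfl fun j _ => ?_
  rw [hG]

end Surface

/-! ### Weak convergence in `H¹` and strong convergence -/

/-- Square integrable triples of fields, containing the graphs of the weak gradient. -/
abbrev GraphSpace (ω : Set E2) : Type :=
  PiLp 2 fun _ : Fin 3 => Lp E3 2 (volume.restrict ω)

theorem memLp_smul_vec {X : Type*} [MeasurableSpace X] {μ : Measure X} {p : X → ℝ}
    (hp : MemLp p 2 μ) (v : E3) : MemLp (fun x => p x • v) 2 μ :=
  (ContinuousLinearMap.toSpanSingleton ℝ v).comp_memLp' hp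

/-! ### Weak derivatives as orthogonality to test vectors -/

section TestVec

variable {ω : Set E2} {φ : E2 → ℝ}

theorem IsTestFunction.memLp (hφ : IsTestFunction ω φ) : MemLp φ 2 (volume.restrict ω) :=
  (hφ.smooth.continuous.memLp_of_hasCompactSupport hφ.compact).restrict ω

theorem IsTestFunction.memLp_gradient_apply (hφ : IsTestFunction ω φ) (i : Fin 2) :
    MemLp (fun x => gradient φ x i) 2 (volume.restrict ω) := by
  have hc : Continuous fun x => gradient φ x i := by
    simp only [gradient_apply]
    exact (hφ.smooth.continuous_fderiv (by simp)).clm_apply continuous_const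
  refine (hc.memLp_of_hasCompactSupport ?_).restrict ω
  refine (hφ.compact.fderiv (𝕜 := ℝ)).mono' fun x hx => subset_closure ?_
  intro h0
  apply hx
  simp only [gradient_apply]
  rw [h0]; rfl

/-- The vector that tests the `i`-th weak derivative against `φ` in the direction `v`. -/
def testVec (hφ : IsTestFunction ω φ) (i : Fin 2) (v : E3) : GraphSpace ω :=
  WithLp.toLp 2 (Fin.cons (α := fun _ => Lp E3 2 (volume.restrict ω))
    ((memLp_smul_vec (hφ.memLp_gradient_apply i) v).toLp)
    (Pi.single i ((memLp_smul_vec hφ.memLp v).toLp)))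

theorem integrable_smul_of_memLp {X : Type*} [MeasurableSpace X] {μ : Measure X} {p : X → ℝ}
    {m : X → E3} (hp : MemLp p 2 μ) (hm : MemLp m 2 μ) :
    Integrable (fun x => p x • m x) μ :=
  memLp_one_iff_integrable.1 (hm.smul hp)

theorem inner_smul_toLp {X : Type*} [MeasurableSpace X] {μ : Measure X} {p : X → ℝ}
    (hp : MemLp p 2 μ) (v : E3) (F : Lp E3 2 μ) {m : X → E3} (hm : F =ᵐ[μ] m) :
    inner ℝ ((memLp_smul_vec hp v).toLp) F = inner ℝ v (∫ x, p x • m x ∂μ) := by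
  have hm2 : MemLp m 2 μ := (memLp_congr_ae hm).1 (Lp.memLp F)
  rw [L2.inner_def, ← integral_inner (integrable_smul_of_memLp hp hm2)]
  refine integral_congr_ae ?_
  filter_upwards [hm, (memLp_smul_vec hp v).coeFn_toLp] with x h1 h2
  rw [h1, h2, real_inner_smul_left, real_inner_smul_right]

/-- The pairing is the defect in the weak derivative identity, in the direction `v`. Graphs of weak
gradients are therefore exactly the orthogonal complement of the test vectors, a closed subspace. -/
theorem inner_testVec (hφ : IsTestFunction ω φ) (i : Fin 2) (v : E3) (F : GraphSpace ω)
    {m : E2 → E3} {Dm : Fin 2 → E2 → E3} (hm : F 0 =ᵐ[volume.restrict ω] m)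
    (hDm : ∀ i : Fin 2, F i.succ =ᵐ[volume.restrict ω] Dm i) :
    inner ℝ (testVec hφ i v) F
      = inner ℝ v ((∫ x in ω, gradient φ x i • m x) + ∫ x in ω, φ x • Dm i x) := by
  rw [PiLp.inner_apply, Fin.sum_univ_succ, inner_add_right]
  congr 1
  · exact inner_smul_toLp (hφ.memLp_gradient_apply i) v (F 0) hm
  · rw [Finset.sum_eq_single i]
    · have e : (testVec hφ i v) i.succ = (memLp_smul_vec hφ.memLp v).toLp := by
        simp [testVec]
      rw [e]
      exact inner_smul_toLp hφ.memLp v _ (hDm i)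
    · intro j _ hj
      have e : (testVec hφ i v) j.succ = 0 := by
        simp [testVec, Pi.single_eq_of_ne hj]
      rw [e, inner_zero_left]
    · simp

end TestVec

/-- The closed subspace of the graphs of the weak gradient. -/
def graphSubspace (ω : Set E2) : Submodule ℝ (GraphSpace ω) :=
  (Submodule.span ℝ {G | ∃ (φ : E2 → ℝ) (hφ : IsTestFunction ω φ) (i : Fin 2) (v : E3),
    G = testVec hφ i v})ᗮ

instance (ω : Set E2) : CompleteSpace (graphSubspace ω) := by
  unfold graphSubspace; infer_instance

theorem mem_graphSubspace_iff {ω : Set E2} {F : GraphSpace ω} :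
    F ∈ graphSubspace ω ↔ ∀ (φ : E2 → ℝ) (hφ : IsTestFunction ω φ) (i : Fin 2) (v : E3),
      inner ℝ (testVec hφ i v) F = 0 := by
  constructor
  · intro h φ hφ i v
    exact h _ (Submodule.subset_span ⟨φ, hφ, i, v, rfl⟩)
  · intro h u hu
    induction hu using Submodule.span_induction with
    | mem x hx => obtain ⟨φ, hφ, i, v, rfl⟩ := hx; exact h φ hφ i v
    | zero => exact inner_zero_left _
    | add x y _ _ hx hy => rw [inner_add_left, hx, hy, add_zero]
    | smul a x _ hx => rw [inner_smul_left, hx, mul_zero]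

/-- The graph of the weak gradient as an element of the space of triples. -/
def IsH1.graph {ω : Set E2} {m : E2 → E3} {Dm : Fin 2 → E2 → E3} (h : IsH1 ω m Dm) :
    GraphSpace ω :=
  WithLp.toLp 2 (Fin.cons (α := fun _ => Lp E3 2 (volume.restrict ω)) h.memLp.toLp
    fun i => (h.memLp_deriv i).toLp)

theorem IsH1.graph_mem {ω : Set E2} {m : E2 → E3} {Dm : Fin 2 → E2 → E3} (h : IsH1 ω m Dm) :
    h.graph ∈ graphSubspace ω := by
  rw [mem_graphSubspace_iff]
  intro φ hφ i v
  rw [inner_testVec hφ i v h.graph h.memLp.coeFn_toLp fun i => (h.memLp_deriv i).coeFn_toLp,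
    h.weak_deriv φ hφ i, neg_add_cancel, inner_zero_right]

theorem isH1_of_mem_graphSubspace {ω : Set E2} {F : GraphSpace ω} (hF : F ∈ graphSubspace ω) :
    IsH1 ω (F 0) fun i => F i.succ where
  memLp := Lp.memLp _
  memLp_deriv i := Lp.memLp _
  weak_deriv φ hφ i := by
    rw [mem_graphSubspace_iff] at hF
    rw [eq_neg_iff_add_eq_zero]
    refine ext_inner_left ℝ fun v => ?_
    rw [inner_zero_right, ← inner_testVec hφ i v F (m := F 0) (Dm := fun i => F i.succ)
      (EventuallyEq.refl _ _) (fun i => EventuallyEq.refl _ _)]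
    exact hF φ hφ i v

theorem IsH1.inner_graph {ω : Set E2} {m : E2 → E3} {Dm : Fin 2 → E2 → E3} (h : IsH1 ω m Dm)
    (F : GraphSpace ω) :
    inner ℝ h.graph F = h1Inner ω m Dm (F 0) fun i => F i.succ := by
  rw [PiLp.inner_apply, Fin.sum_univ_succ, h1Inner]
  congr 1
  · rw [L2.inner_def]
    refine integral_congr_ae ?_
    filter_upwards [h.memLp.coeFn_toLp] with x hx
    exact congrArg (fun y => inner ℝ y (F 0 x)) hx
  · refine Finset.sum_congr rfl fun i _ => ?_
    rw [L2.inner_def]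
    refine integral_congr_ae ?_
    filter_upwards [(h.memLp_deriv i).coeFn_toLp] with x hx
    exact congrArg (fun y => inner ℝ y (F i.succ x)) hx

/-- Riesz representation in `H¹` of the functional `m ↦ ∫ ⟨m, g⟩`. -/
theorem exists_h1_representative {ω : Set E2} {g : E2 → E3} (hg : MemLp g 2 (volume.restrict ω)) :
    ∃ (h : E2 → E3) (Dh : Fin 2 → E2 → E3), IsH1 ω h Dh ∧
      ∀ (m : E2 → E3) (Dm : Fin 2 → E2 → E3), IsH1 ω m Dm →
        h1Inner ω m Dm h Dh = ∫ x in ω, inner ℝ (m x) (g x) := by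
  -- Pairing a graph with `(g, 0, 0)` gives the functional. The representative is the projection of
  -- this triple on the graph subspace, the remainder being orthogonal to all graphs.
  set e : GraphSpace ω := WithLp.toLp 2 (Fin.cons (α := fun _ => Lp E3 2 (volume.restrict ω))
    hg.toLp fun _ => 0) with he
  set F : GraphSpace ω := (graphSubspace ω).starProjection e
  have hF : F ∈ graphSubspace ω := Submodule.starProjection_apply_mem _ _
  refine ⟨F 0, fun i => F i.succ, isH1_of_mem_graphSubspace hF, fun m Dm hm => ?_⟩
  rw [← hm.inner_graph F]
  have h1 : inner ℝ (e - F) hm.graph = 0 :=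
    Submodule.starProjection_inner_eq_zero e hm.graph hm.graph_mem
  rw [inner_sub_left, sub_eq_zero] at h1
  rw [real_inner_comm, ← h1, real_inner_comm, PiLp.inner_apply, Fin.sum_univ_succ]
  have e0 : e 0 = hg.toLp := by simp [he]
  have es : ∀ i : Fin 2, e i.succ = 0 := fun i => by simp [he]
  have g0 : hm.graph 0 = hm.memLp.toLp := by simp [IsH1.graph]
  simp only [es, inner_zero_right, Finset.sum_const_zero, add_zero]
  rw [e0, g0, inner_toLp_eq]

/-! ### Strong convergence from weak convergence and the norm constraint -/

section Strong

variable {ω : Set E2} {M : ℝ → E2 → E3} {DM : ℝ → Fin 2 → E2 → E3} {m₀ : E2 → E3}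
  {Dm₀ : Fin 2 → E2 → E3}

/-- Pairing with an `L²` field is an `H¹` inner product with its Riesz representative, so weak `H¹`
convergence gives weak `L²` convergence. -/
theorem WeakConvH1.tendsto_integral_inner (hw : WeakConvH1 ω M DM m₀ Dm₀)
    (hM : ∀ ε : ℝ, 0 < ε → IsH1 ω (M ε) (DM ε)) (hm₀ : IsH1 ω m₀ Dm₀) {g : E2 → E3}
    (hg : MemLp g 2 (volume.restrict ω)) :
    Tendsto (fun ε => ∫ x in ω, inner ℝ (M ε x) (g x)) (𝓝[>] 0)
      (𝓝 (∫ x in ω, inner ℝ (m₀ x) (g x))) := by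
  obtain ⟨h, Dh, hh, hrep⟩ := exists_h1_representative hg
  have := hw h Dh hh
  rw [hrep _ _ hm₀] at this
  refine this.congr' ?_
  filter_upwards [self_mem_nhdsWithin] with ε hε
  exact hrep _ _ (hM ε hε)

/-- Expanding the square, `|m|² + |m₀|² ≤ 2 = 2 |m₀|²`. The right side is affine in `m`, so weak
convergence will send it to zero. -/
theorem integral_norm_sq_sub_le [IsFiniteMeasure (volume.restrict ω)] {m : E2 → E3}
    (hm : MemLp m 2 (volume.restrict ω)) (hm₀ : MemLp m₀ 2 (volume.restrict ω))
    (hle : ∀ᵐ x ∂(volume.restrict ω), ‖m x‖ ≤ 1)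
    (hsph : ∀ᵐ x ∂(volume.restrict ω), ‖m₀ x‖ = 1) :
    ∫ x in ω, ‖m x - m₀ x‖ ^ 2
      ≤ 2 * ((∫ x in ω, inner ℝ (m₀ x) (m₀ x)) - ∫ x in ω, inner ℝ (m x) (m₀ x)) := by
  have h1 := integrable_inner hm₀ hm₀
  have h2 := integrable_inner hm hm₀
  rw [← integral_sub h1 h2, ← integral_const_mul]
  refine integral_mono_ae (integrable_norm_sq (hm.sub hm₀)) ((h1.sub h2).const_mul 2) ?_
  filter_upwards [hle, hsph] with x hx hx0
  rw [norm_sub_sq_real, real_inner_self_eq_norm_sq, hx0]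
  nlinarith [norm_nonneg (m x)]

theorem tendsto_integral_norm_of_sq {α : Type*} [MeasurableSpace α] {μ : Measure α}
    [IsFiniteMeasure μ] {l : Filter ℝ} {a : ℝ → α → E3} (ha : ∀ᶠ ε in l, MemLp (a ε) 2 μ)
    (hlim : Tendsto (fun ε => ∫ x, ‖a ε x‖ ^ 2 ∂μ) l (𝓝 0)) :
    Tendsto (fun ε => ∫ x, ‖a ε x‖ ∂μ) l (𝓝 0) := by
  rw [tendsto_order]
  refine ⟨fun y hy => Eventually.of_forall fun ε =>
    hy.trans_le (integral_nonneg fun _ => norm_nonneg _), fun η hη => ?_⟩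
  set V : ℝ := μ.real Set.univ
  have hV : 0 ≤ V := measureReal_nonneg
  set δ : ℝ := η / (V + 1)
  have hδ : 0 < δ := by positivity
  filter_upwards [ha, (tendsto_order.1 hlim).2 (δ * η) (by positivity)] with ε hε hlt
  have hi := integrable_norm_sq hε
  -- The inequality `t ≤ δ/2 + t²/(2δ)` replaces Cauchy–Schwarz. The choice of `δ` keeps the
  -- constant part, times the total mass, below `η / 2`.
  have hle : ∫ x, ‖a ε x‖ ∂μ ≤ ∫ x, (δ / 2 + 1 / (2 * δ) * ‖a ε x‖ ^ 2) ∂μ := by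
    refine integral_mono (hε.integrable one_le_two).norm
      ((integrable_const _).add (hi.const_mul _)) fun x => ?_
    simp only
    have h := sq_nonneg (‖a ε x‖ - δ)
    have e : δ / 2 + 1 / (2 * δ) * ‖a ε x‖ ^ 2 - ‖a ε x‖
        = 1 / (2 * δ) * (‖a ε x‖ - δ) ^ 2 := by field_simp; ring
    have : 0 ≤ 1 / (2 * δ) * (‖a ε x‖ - δ) ^ 2 := by positivity
    linarith
  rw [integral_add (integrable_const _) (hi.const_mul _), integral_const_mul, integral_const,
    smul_eq_mul] at hle
  have h1 : V * (δ / 2) < η / 2 := by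
    have : V * δ < η := by
      have e : (V + 1) * δ = η := by simp only [δ]; field_simp
      nlinarith
    linarith
  have h2 : 1 / (2 * δ) * ∫ x, ‖a ε x‖ ^ 2 ∂μ < η / 2 := by
    calc _ < 1 / (2 * δ) * (δ * η) := by gcongr
      _ = η / 2 := by field_simp
  linarith

theorem WeakConvH1.tendsto_integral_norm_sub [IsFiniteMeasure (volume.restrict ω)]
    (hw : WeakConvH1 ω M DM m₀ Dm₀)
    (hM : ∀ ε : ℝ, 0 < ε → IsH1 ω (M ε) (DM ε)) (hm₀ : IsH1 ω m₀ Dm₀)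
    (hle : ∀ ε : ℝ, 0 < ε → ∀ᵐ x ∂(volume.restrict ω), ‖M ε x‖ ≤ 1)
    (hsph : ∀ᵐ x ∂(volume.restrict ω), ‖m₀ x‖ = 1) :
    Tendsto (fun ε => ∫ x in ω, ‖M ε x - m₀ x‖) (𝓝[>] 0) (𝓝 0) := by
  have hpos : ∀ᶠ ε : ℝ in 𝓝[>] 0, 0 < ε := self_mem_nhdsWithin
  refine tendsto_integral_norm_of_sq (hpos.mono fun ε hε => (hM ε hε).memLp.sub hm₀.memLp) ?_
  have h := ((tendsto_const_nhds (x := ∫ x in ω, inner ℝ (m₀ x) (m₀ x))).sub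
    (hw.tendsto_integral_inner hM hm₀ hm₀.memLp)).const_mul 2
  rw [sub_self, mul_zero] at h
  refine squeeze_zero' (Eventually.of_forall fun ε => integral_nonneg fun _ => sq_nonneg _)
    (hpos.mono fun ε hε => ?_) h
  exact integral_norm_sq_sub_le (hM ε hε).memLp hm₀.memLp (hle ε hε) hsph

end Strong

/-! ### Bounds and measurability of correlations -/

theorem abs_corr_le {F : E3 → E3} (hF : MemLp F 2) (i j : Fin 3) (z : E3) :
    |corr F i j z| ≤ ∫ x, ‖F x‖ ^ 2 := by
  have h := abs_integral_mul_comp_add_le (memLp_coord hF i) (memLp_coord hF j) z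
  have hk : ∀ k, ∫ x, F x k ^ 2 ≤ ∫ x, ‖F x‖ ^ 2 := fun k =>
    integral_mono (memLp_coord hF k).integrable_sq (integrable_norm_sq hF) fun x => by
      simp only
      rw [← sq_abs]
      exact pow_le_pow_left₀ (abs_nonneg _) (abs_apply_le_norm _ _) 2
  refine (abs_integral_le_integral_abs).trans (h.trans ?_)
  linarith [hk i, hk j]

theorem crossCorr_self_eq_sum {F : E3 → E3} (hF : MemLp F 2) (z : E3) :
    crossCorr F F z = ∑ i, corr F i i z :=
  crossCorr_eq_sum hF hF z

theorem aestronglyMeasurable_corr_smul {F : E3 → E3} (hF : MemLp F 2) (i j : Fin 3) {ε : ℝ}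
    (hε : ε ≠ 0) : AEStronglyMeasurable fun z : E3 => corr F i j (ε • z) := by
  have h2 := ((integrable_mul_integral (integrable_exp_neg_mul_norm_sq (E := E3) one_pos)
    hF hF i j).comp_smul hε).aestronglyMeasurable
  have h3 : AEStronglyMeasurable (fun z : E3 => Real.exp (1 * ‖ε • z‖ ^ 2)) :=
    Continuous.aestronglyMeasurable (by fun_prop)
  refine (h3.mul h2).congr (Eventually.of_forall fun z => ?_)
  simp only [Pi.mul_apply]
  rw [← mul_assoc, ← Real.exp_add, corr]
  simp

/-! ### Parabolic scaling -/

theorem heatWeight_scale {s ε : ℝ} (hε : 0 < ε) :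
    heatWeight ((ε ^ 2)⁻¹ * s) = ε * heatWeight s := by
  unfold heatWeight
  rw [Real.sqrt_mul (by positivity), Real.sqrt_inv, Real.sqrt_sq hε.le]
  simp only [one_div, mul_inv, inv_inv]
  ring

theorem gaussHess_scale (s : ℝ) {ε : ℝ} (hε : 0 < ε) (i j : Fin 3) (z : E3) :
    gaussHess ((ε ^ 2)⁻¹ * s) i j (ε • z) = (ε ^ 2)⁻¹ * gaussHess s i j z := by
  have e : -((ε ^ 2)⁻¹ * s) * ‖ε • z‖ ^ 2 = -s * ‖z‖ ^ 2 := by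
    rw [norm_smul, Real.norm_of_nonneg hε.le]
    field_simp
  unfold gaussHess
  rw [e, PiLp.smul_apply, PiLp.smul_apply, smul_eq_mul, smul_eq_mul]
  field_simp

theorem normGauss_scale {s ε : ℝ} (hε : 0 < ε) (z : E3) :
    normGauss ((ε ^ 2)⁻¹ * s) (ε • z) = (ε ^ 3)⁻¹ * normGauss s z := by
  have e : -((ε ^ 2)⁻¹ * s) * ‖ε • z‖ ^ 2 = -s * ‖z‖ ^ 2 := by
    rw [norm_smul, Real.norm_of_nonneg hε.le]
    field_simp
  unfold normGauss
  rw [e, Real.sqrt_mul (by positivity), Real.sqrt_inv, Real.sqrt_sq hε.le]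
  have := Real.pi_pos
  have := Real.sqrt_pos.2 Real.pi_pos
  field_simp

theorem integral_eq_pow_mul_integral_smul (g : E3 → ℝ) {ε : ℝ} (hε : 0 < ε) :
    ∫ z, g z = ε ^ 3 * ∫ z, g (ε • z) := by
  rw [Measure.integral_comp_smul]
  simp only [finrank_euclideanSpace, Fintype.card_fin, smul_eq_mul]
  rw [abs_of_pos (by positivity)]
  field_simp

theorem integral_normGauss_scale (r : E3 → ℝ) (s : ℝ) {ε : ℝ} (hε : 0 < ε) :
    ∫ z, normGauss ((ε ^ 2)⁻¹ * s) z * r z = ∫ z, normGauss s z * r (ε • z) := by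
  rw [integral_eq_pow_mul_integral_smul _ hε, ← integral_const_mul]
  refine integral_congr_ae (Eventually.of_forall fun z => ?_)
  simp only
  rw [normGauss_scale hε]
  field_simp

theorem integral_gaussHess_scale (r : E3 → ℝ) (s : ℝ) {ε : ℝ} (hε : 0 < ε) (i j : Fin 3) :
    ∫ z, gaussHess ((ε ^ 2)⁻¹ * s) i j z * r z = ε * ∫ z, gaussHess s i j z * r (ε • z) := by
  rw [integral_eq_pow_mul_integral_smul _ hε, ← integral_const_mul, ← integral_const_mul]
  refine integral_congr_ae (Eventually.of_forall fun z => ?_)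
  simp only
  rw [gaussHess_scale s hε]
  field_simp

/-- The form is scale invariant: `ds` gives `ε⁻²`, while the weight and the integral of the second
derivatives give a factor `ε` each. -/
theorem integral_heat_scale (r : Fin 3 → Fin 3 → E3 → ℝ) (a b : ℝ) {ε : ℝ} (hε : 0 < ε) :
    ∫ s in ((ε ^ 2)⁻¹ * a)..((ε ^ 2)⁻¹ * b),
        heatWeight s * ∑ i, ∑ j, ∫ z, gaussHess s i j z * r i j z
      = ∫ s in a..b, heatWeight s * ∑ i, ∑ j, ∫ z, gaussHess s i j z * r i j (ε • z) := by
  rw [← intervalIntegral.smul_integral_comp_mul_left, smul_eq_mul,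
    ← intervalIntegral.integral_const_mul]
  refine intervalIntegral.integral_congr fun s _ => ?_
  simp only [heatWeight_scale hε, integral_gaussHess_scale _ s hε, ← Finset.mul_sum]
  field_simp

/-! ### Superposition of gaussians on a bounded range of widths -/

theorem integral_heat_eq_sum {a b : ℝ} (ha : 0 < a) (hab : a ≤ b) {r : Fin 3 → Fin 3 → E3 → ℝ}
    (hr : ∀ i j, AEStronglyMeasurable (r i j)) {C : ℝ} (hC : ∀ i j z, |r i j z| ≤ C) :
    ∫ s in a..b, heatWeight s * ∑ i, ∑ j, ∫ z, gaussHess s i j z * r i j z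
      = ∑ i, ∑ j, ∫ p : ℝ × E3, heatWeight p.1 * (gaussHess p.1 i j p.2 * r i j p.2)
          ∂((volume.restrict (Set.Ioc a b)).prod volume) := by
  have hi := fun i j => integral_heatWeight_gaussHess_swap ha hab (hr i j) (hC i j) i j
  have hi' : ∀ i j, Integrable (fun s => heatWeight s * ∫ z, gaussHess s i j z * r i j z)
      (volume.restrict (Set.Ioc a b)) := fun i j => by
    simpa only [integral_const_mul] using (hi i j).integral_prod_left
  rw [intervalIntegral.integral_of_le hab]
  simp only [Finset.mul_sum]
  rw [integral_finsetSum _ fun i _ => integrable_finsetSum _ fun j _ => hi' i j]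
  refine Finset.sum_congr rfl fun i _ => ?_
  rw [integral_finsetSum _ fun j _ => hi' i j]
  refine Finset.sum_congr rfl fun j _ => ?_
  rw [integral_prod _ (hi i j)]
  simp only [integral_const_mul]

/-- Dominated convergence jointly in the width and the space variable; a bounded range of widths
away from zero makes the kernel integrable against a constant. -/
theorem tendsto_integral_heat {l : Filter ℝ} [l.IsCountablyGenerated] {a b : ℝ} (ha : 0 < a)
    (hab : a ≤ b) {r : ℝ → Fin 3 → Fin 3 → E3 → ℝ} {r₀ : Fin 3 → Fin 3 → E3 → ℝ}
    (hr : ∀ᶠ ε in l, ∀ i j, AEStronglyMeasurable (r ε i j))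
    (hr₀ : ∀ i j, AEStronglyMeasurable (r₀ i j)) {C : ℝ}
    (hC : ∀ᶠ ε in l, ∀ i j z, |r ε i j z| ≤ C) (hC₀ : ∀ i j z, |r₀ i j z| ≤ C)
    (hlim : ∀ i j z, Tendsto (fun ε => r ε i j z) l (𝓝 (r₀ i j z))) :
    Tendsto (fun ε => ∫ s in a..b, heatWeight s * ∑ i, ∑ j, ∫ z, gaussHess s i j z * r ε i j z) l
      (𝓝 (∫ s in a..b, heatWeight s * ∑ i, ∑ j, ∫ z, gaussHess s i j z * r₀ i j z)) := by
  rw [integral_heat_eq_sum ha hab hr₀ hC₀]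
  have hdct : Tendsto (fun ε => ∑ i, ∑ j,
      ∫ p : ℝ × E3, heatWeight p.1 * (gaussHess p.1 i j p.2 * r ε i j p.2)
        ∂((volume.restrict (Set.Ioc a b)).prod volume)) l
      (𝓝 (∑ i, ∑ j, ∫ p : ℝ × E3, heatWeight p.1 * (gaussHess p.1 i j p.2 * r₀ i j p.2)
        ∂((volume.restrict (Set.Ioc a b)).prod volume))) := by
    refine tendsto_finsetSum _ fun i _ => tendsto_finsetSum _ fun j _ => ?_
    have hone := integral_heatWeight_gaussHess_swap ha hab (r := fun _ => C)
      aestronglyMeasurable_const (B := |C|) (fun _ => le_rfl) i j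
    refine tendsto_integral_filter_of_dominated_convergence
      (fun p => ‖heatWeight p.1 * (gaussHess p.1 i j p.2 * C)‖) ?_ ?_ hone.norm ?_
    · filter_upwards [hr, hC] with ε h1 h2
      exact (integral_heatWeight_gaussHess_swap ha hab (h1 i j) (h2 i j) i j).aestronglyMeasurable
    · filter_upwards [hC] with ε h2
      refine Eventually.of_forall fun p => ?_
      simp only [norm_mul, Real.norm_eq_abs]
      have := (h2 i j p.2).trans (le_abs_self C)
      gcongr
    · exact Eventually.of_forall fun p => ((hlim i j p.2).const_mul _).const_mul _
  refine hdct.congr' ?_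
  filter_upwards [hr, hC] with ε h1 h2
  rw [integral_heat_eq_sum ha hab h1 h2]

/-! ### Limits of the correlations of a thin layer -/

/-- The Gram matrix of the components of a field. -/
def gram (m : E2 → E3) (i j : Fin 3) : ℝ := ∫ x, m x i * m x j

theorem gram_comm (m : E2 → E3) (i j : Fin 3) : gram m i j = gram m j i := by
  simp only [gram, mul_comm]

section CellCorr

variable {f₁ f₂ : E2 → ℝ} {K : NNReal} {B : ℝ}

theorem norm_overlap_le (hf₂ : IsSurface f₂ K B) (hpos : ∀ x, 0 < f₁ x) (z : E3) (x : E2) :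
    ‖overlap f₁ f₂ z x‖ ≤ B := by
  rw [Real.norm_of_nonneg (overlap_nonneg _ _ _ _)]
  exact overlap_le hpos (fun x => (le_abs_self _).trans (hf₂.bdd x)) hf₂.bound_nonneg z x

theorem continuous_cellCorr (hf₁ : IsSurface f₁ K B) (hf₂ : IsSurface f₂ K B)
    (hpos : ∀ x, 0 < f₁ x) : Continuous (cellCorr f₁ f₂) := by
  have hc := continuous_overlap_uncurry hf₁.lip.continuous hf₂.lip.continuous
  unfold cellCorr
  refine continuous_of_dominated (bound := fun _ => B) (fun z => ?_)
    (fun z => Eventually.of_forall fun x => norm_overlap_le hf₂ hpos z x) (integrable_const B)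
    (Eventually.of_forall fun x => ?_)
  · exact (continuous_overlap hf₁.lip.continuous hf₂.lip.continuous z).aestronglyMeasurable
  · exact hc.comp (by fun_prop : Continuous fun z : E3 => (z, x))

theorem abs_cellCorr_le (hf₂ : IsSurface f₂ K B) (hpos : ∀ x, 0 < f₁ x) (z : E3) :
    |cellCorr f₁ f₂ z| ≤ B := by
  have h := norm_integral_le_of_norm_le_const (μ := volume.restrict cellQ)
    (Eventually.of_forall fun x => norm_overlap_le hf₂ hpos z x)
  simpa [cellCorr, measureReal_def] using h

/-- Rescaling fixes the gaussian and moves the shrinking into the argument of `D`, which is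
continuous at zero. -/
theorem tendsto_integral_normGauss_mul {D : E3 → ℝ} (hD : Continuous D) {C : ℝ}
    (hC : ∀ z, |D z| ≤ C) :
    Tendsto (fun δ : ℝ => ∫ z, normGauss ((δ ^ 2)⁻¹ * 1) z * D z) (𝓝[>] 0) (𝓝 (D 0)) := by
  have h : Tendsto (fun δ : ℝ => ∫ z, normGauss 1 z * D (δ • z)) (𝓝[>] 0)
      (𝓝 (∫ z : E3, normGauss 1 z * D 0)) := by
    refine tendsto_integral_filter_of_dominated_convergence (fun z => normGauss 1 z * C) ?_ ?_
      ((integrable_normGauss one_pos).mul_const C) ?_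
    · refine Eventually.of_forall fun δ => Continuous.aestronglyMeasurable ?_
      have := continuous_normGauss (1 : ℝ)
      fun_prop
    · refine Eventually.of_forall fun δ => Eventually.of_forall fun z => ?_
      rw [norm_mul, Real.norm_of_nonneg (normGauss_nonneg one_pos z)]
      exact mul_le_mul_of_nonneg_left (hC _) (normGauss_nonneg one_pos z)
    · refine Eventually.of_forall fun z => Tendsto.const_mul _ ?_
      have hc : Continuous fun δ : ℝ => D (δ • z) := by fun_prop
      have := hc.tendsto 0
      rw [zero_smul] at this
      exact this.mono_left nhdsWithin_le_nhds
  rw [integral_mul_const, integral_normGauss one_pos, one_mul] at h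
  refine h.congr' ?_
  filter_upwards [self_mem_nhdsWithin] with δ hδ
  rw [integral_normGauss_scale D 1 hδ]

end CellCorr

/-! ### The limit of the energy of a thin layer -/

theorem tendsto_of_approx {l : Filter ℝ} {e : ℝ → ℝ} {L : ℝ}
    (h : ∀ η > 0, ∃ (I R : ℝ → ℝ) (I₀ R₀ : ℝ), Tendsto I l (𝓝 I₀) ∧ Tendsto R l (𝓝 R₀) ∧
      (∀ᶠ ε in l, |e ε - I ε| ≤ R ε) ∧ |I₀ - L| < η ∧ R₀ < η) :
    Tendsto e l (𝓝 L) := by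
  rw [Metric.tendsto_nhds]
  intro η hη
  obtain ⟨I, R, I₀, R₀, hI, hR, hle, h1, h2⟩ := h (η / 3) (by positivity)
  filter_upwards [hle, (tendsto_order.1 hR).2 _ h2,
    Metric.tendsto_nhds.1 hI (η / 3) (by positivity)] with ε a1 a2 a3
  rw [Real.dist_eq] at a3 ⊢
  have : e ε - L = (e ε - I ε) + (I ε - I₀) + (I₀ - L) := by ring
  rw [this]
  refine (abs_add_three _ _ _).trans_lt ?_
  linarith

/-- A single parameter drives both cutoffs, `a = δ` and `b = δ⁻²`. The factor `1` keeps the upper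
end in the form used by the parabolic scaling. -/
theorem tendsto_intervalIntegral_Ioi {g : ℝ → ℝ} (hg : IntegrableOn g (Set.Ioi 0)) :
    Tendsto (fun δ : ℝ => ∫ s in δ..((δ ^ 2)⁻¹ * 1), g s) (𝓝[>] 0)
      (𝓝 (∫ s in Set.Ioi 0, g s)) := by
  have hpos : ∀ᶠ δ : ℝ in 𝓝[>] 0, 0 < δ := self_mem_nhdsWithin
  have hinv : Tendsto (fun δ : ℝ => (δ ^ 2)⁻¹ * 1) (𝓝[>] 0) atTop := by
    simp only [mul_one]
    refine Tendsto.inv_tendsto_nhdsGT_zero ?_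
    refine tendsto_nhdsWithin_iff.2 ⟨?_, hpos.mono fun δ hδ => pow_pos hδ 2⟩
    have h : Tendsto (fun δ : ℝ => δ ^ 2) (𝓝 0) (𝓝 0) := by
      simpa using (continuous_pow 2).tendsto (0 : ℝ)
    exact h.mono_left nhdsWithin_le_nhds
  have hcov : AECover (volume.restrict (Set.Ioi (0 : ℝ))) (𝓝[>] (0 : ℝ))
      fun δ : ℝ => Set.Ioc δ ((δ ^ 2)⁻¹ * 1) := by
    refine ⟨?_, fun δ => measurableSet_Ioc⟩
    rw [ae_restrict_iff' measurableSet_Ioi]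
    refine Eventually.of_forall fun s hs => ?_
    have hlt : ∀ᶠ δ : ℝ in 𝓝[>] 0, δ < s :=
      mem_nhdsWithin_of_mem_nhds (Iio_mem_nhds hs)
    filter_upwards [hlt, hinv.eventually_ge_atTop s] with δ h1 h2
    exact ⟨h1, h2⟩
  refine (hcov.integral_tendsto_of_countably_generated hg).congr' ?_
  filter_upwards [hpos, hinv.eventually_ge_atTop 1,
    mem_nhdsWithin_of_mem_nhds (Iio_mem_nhds one_pos)] with δ h1 h2 h3
  rw [intervalIntegral.integral_of_le ((le_of_lt h3).trans h2),
    Measure.restrict_restrict measurableSet_Ioc, Set.inter_eq_left.2]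
  exact fun s hs => h1.trans hs.1

namespace BoundedConv

variable {m : ℝ → E2 → E3} {m₀ : E2 → E3} {f₁ f₂ : E2 → ℝ} {K : NNReal} {B : ℝ}

theorem memLp_layer (h : BoundedConv m m₀) (hf₁ : IsSurface f₁ K B) (hf₂ : IsSurface f₂ K B)
    (hpos : ∀ x, 0 < f₁ x) {ε : ℝ} (hε : 0 < ε) : MemLp (layerField f₁ f₂ ε (m ε)) 2 :=
  memLp_layerField hf₁.lip.continuous hf₂.lip.continuous hpos
    (fun x => (le_abs_self _).trans (hf₂.bdd x)) hε (h.memLp hε)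

theorem tendsto_corr_gram (h : BoundedConv m m₀) (hf₁ : IsSurface f₁ K B)
    (hf₂ : IsSurface f₂ K B) (hpos : ∀ x, 0 < f₁ x) (i j : Fin 3) (z : E3) :
    Tendsto (fun ε => ε⁻¹ * corr (layerField f₁ f₂ ε (m ε)) i j (ε • z)) (𝓝[>] 0)
      (𝓝 (gram m₀ i j * cellCorr f₁ f₂ z)) :=
  h.tendsto_corr hf₁.lip.continuous hf₂.lip.continuous hf₁.per hf₂.per hf₁.bound_nonneg hpos
    (fun x => (le_abs_self _).trans (hf₂.bdd x)) i j z

theorem tendsto_crossCorr (h : BoundedConv m m₀) (hf₁ : IsSurface f₁ K B)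
    (hf₂ : IsSurface f₂ K B) (hpos : ∀ x, 0 < f₁ x) (z : E3) :
    Tendsto (fun ε => ε⁻¹ * crossCorr (layerField f₁ f₂ ε (m ε)) (layerField f₁ f₂ ε (m ε)) (ε • z))
      (𝓝[>] 0) (𝓝 ((∑ i, gram m₀ i i) * cellCorr f₁ f₂ z)) := by
  rw [Finset.sum_mul]
  refine (tendsto_finsetSum _ fun i _ => h.tendsto_corr_gram hf₁ hf₂ hpos i i z).congr' ?_
  filter_upwards [self_mem_nhdsWithin] with ε hε
  rw [crossCorr_self_eq_sum (h.memLp_layer hf₁ hf₂ hpos hε), Finset.mul_sum]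

theorem tendsto_norm_sq (h : BoundedConv m m₀) (hf₁ : IsSurface f₁ K B)
    (hf₂ : IsSurface f₂ K B) (hpos : ∀ x, 0 < f₁ x) :
    Tendsto (fun ε => ε⁻¹ * ∫ x, ‖layerField f₁ f₂ ε (m ε) x‖ ^ 2) (𝓝[>] 0)
      (𝓝 ((∑ i, gram m₀ i i) * cellCorr f₁ f₂ 0)) := by
  have h0 := h.tendsto_crossCorr hf₁ hf₂ hpos 0
  simp only [smul_zero, ← integral_inner_eq_crossCorr_zero, real_inner_self_eq_norm_sq] at h0
  exact h0

theorem tendsto_shiftSq (h : BoundedConv m m₀) (hf₁ : IsSurface f₁ K B)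
    (hf₂ : IsSurface f₂ K B) (hpos : ∀ x, 0 < f₁ x) (z : E3) :
    Tendsto (fun ε => ε⁻¹ * shiftSq (layerField f₁ f₂ ε (m ε)) (ε • z)) (𝓝[>] 0)
      (𝓝 (2 * (∑ i, gram m₀ i i) * (cellCorr f₁ f₂ 0 - cellCorr f₁ f₂ z))) := by
  have h1 := ((h.tendsto_norm_sq hf₁ hf₂ hpos).sub (h.tendsto_crossCorr hf₁ hf₂ hpos z)).const_mul 2
  rw [← mul_sub, ← mul_assoc] at h1
  refine h1.congr' ?_
  filter_upwards [self_mem_nhdsWithin] with ε hε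
  rw [shiftSq_eq (h.memLp_layer hf₁ hf₂ hpos hε)]
  ring

theorem exists_energy_bound (h : BoundedConv m m₀) (hf₁ : IsSurface f₁ K B)
    (hf₂ : IsSurface f₂ K B) (hpos : ∀ x, 0 < f₁ x) :
    ∃ C, ∀ᶠ ε in 𝓝[>] 0, ε⁻¹ * ∫ x, ‖layerField f₁ f₂ ε (m ε) x‖ ^ 2 ≤ C :=
  ⟨(∑ i, gram m₀ i i) * cellCorr f₁ f₂ 0 + 1,
    ((tendsto_order.1 (h.tendsto_norm_sq hf₁ hf₂ hpos)).2 _ (lt_add_one _)).mono fun _ => le_of_lt⟩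

theorem tendsto_heat (h : BoundedConv m m₀) (hf₁ : IsSurface f₁ K B)
    (hf₂ : IsSurface f₂ K B) (hpos : ∀ x, 0 < f₁ x) {a b : ℝ} (ha : 0 < a) (hab : a ≤ b) :
    Tendsto (fun ε => ∫ s in a..b, heatWeight s * ∑ i, ∑ j, ∫ z, gaussHess s i j z *
        (ε⁻¹ * corr (layerField f₁ f₂ ε (m ε)) i j (ε • z))) (𝓝[>] 0)
      (𝓝 (∫ s in a..b, heatWeight s * ∑ i, ∑ j, ∫ z, gaussHess s i j z *
        (gram m₀ i j * cellCorr f₁ f₂ z))) := by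
  obtain ⟨C, hC⟩ := h.exists_energy_bound hf₁ hf₂ hpos
  have hmain : ∀ᶠ ε : ℝ in 𝓝[>] 0, ∀ i j z,
      |ε⁻¹ * corr (layerField f₁ f₂ ε (m ε)) i j (ε • z)| ≤ C := by
    filter_upwards [hC, self_mem_nhdsWithin] with ε h1 hε i j z
    have hε' : (0 : ℝ) < ε := hε
    rw [abs_mul, abs_of_pos (inv_pos.2 hε')]
    refine le_trans ?_ h1
    exact mul_le_mul_of_nonneg_left (abs_corr_le (h.memLp_layer hf₁ hf₂ hpos hε) i j _)
      (inv_pos.2 hε').le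
  refine tendsto_integral_heat ha hab (C := C) ?_ (fun i j => ?_) hmain (fun i j z => ?_)
    (fun i j z => h.tendsto_corr_gram hf₁ hf₂ hpos i j z)
  · filter_upwards [self_mem_nhdsWithin] with ε hε i j
    have hε' : (0 : ℝ) < ε := hε
    exact (aestronglyMeasurable_corr_smul (h.memLp_layer hf₁ hf₂ hpos hε) i j hε'.ne').const_mul _
  · exact ((continuous_cellCorr hf₁ hf₂ hpos).const_mul _).aestronglyMeasurable
  -- The limit inherits the uniform bound of the rescaled correlations.
  · exact le_of_tendsto (h.tendsto_corr_gram hf₁ hf₂ hpos i j z).abs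
      (hmain.mono fun ε hε => hε i j z)

theorem tendsto_integral_shiftSq (h : BoundedConv m m₀) (hf₁ : IsSurface f₁ K B)
    (hf₂ : IsSurface f₂ K B) (hpos : ∀ x, 0 < f₁ x) {b : ℝ} (hb : 0 < b) :
    Tendsto (fun ε => ∫ z, normGauss b z *
        (ε⁻¹ * shiftSq (layerField f₁ f₂ ε (m ε)) (ε • z))) (𝓝[>] 0)
      (𝓝 (∫ z, normGauss b z *
        (2 * (∑ i, gram m₀ i i) * (cellCorr f₁ f₂ 0 - cellCorr f₁ f₂ z)))) := by
  obtain ⟨C, hC⟩ := h.exists_energy_bound hf₁ hf₂ hpos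
  refine tendsto_integral_filter_of_dominated_convergence (fun z => normGauss b z * (4 * C)) ?_ ?_
    ((integrable_normGauss hb).mul_const _)
    (Eventually.of_forall fun z => (h.tendsto_shiftSq hf₁ hf₂ hpos z).const_mul _)
  · filter_upwards [self_mem_nhdsWithin] with ε hε
    have hε' : (0 : ℝ) < ε := hε
    have hF := h.memLp_layer hf₁ hf₂ hpos hε
    refine (continuous_normGauss b).aestronglyMeasurable.mul (AEStronglyMeasurable.const_mul ?_ _)
    simp only [shiftSq_eq hF, crossCorr_self_eq_sum hF]
    refine aestronglyMeasurable_const.sub (AEStronglyMeasurable.const_mul ?_ _)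
    exact Finset.aestronglyMeasurable_fun_sum _ fun i _ =>
      aestronglyMeasurable_corr_smul hF i i hε'.ne'
  · filter_upwards [hC, self_mem_nhdsWithin] with ε h1 hε
    have hε' : (0 : ℝ) < ε := hε
    have hF := h.memLp_layer hf₁ hf₂ hpos hε
    refine Eventually.of_forall fun z => ?_
    rw [norm_mul, Real.norm_of_nonneg (normGauss_nonneg hb z)]
    refine mul_le_mul_of_nonneg_left ?_ (normGauss_nonneg hb z)
    have hnn : 0 ≤ shiftSq (layerField f₁ f₂ ε (m ε)) (ε • z) :=
      integral_nonneg fun _ => sq_nonneg _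
    rw [norm_mul, Real.norm_of_nonneg (inv_pos.2 hε').le, Real.norm_of_nonneg hnn, shiftSq_eq hF]
    have h2 := abs_le.1 (abs_crossCorr_le hF hF (ε • z))
    calc _ ≤ ε⁻¹ * (4 * ∫ x, ‖layerField f₁ f₂ ε (m ε) x‖ ^ 2) := by
          refine mul_le_mul_of_nonneg_left ?_ (inv_pos.2 hε').le
          linarith [h2.1]
      _ ≤ _ := by linarith

theorem layerField_eq_zero (hpos : ∀ x, 0 < f₁ x) (hf₂ : IsSurface f₂ K B) {ε : ℝ} (hε : 0 < ε)
    (w : E2 → E3) (x : E3) (hx : x ∉ strip (ε * B)) : layerField f₁ f₂ ε w x = 0 := by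
  refine Set.indicator_of_notMem (fun hmem => hx ?_) _
  refine ⟨(mul_pos hε (hpos _)).trans hmem.2.1, hmem.2.2.trans_le ?_⟩
  exact mul_le_mul_of_nonneg_left ((le_abs_self _).trans (hf₂.bdd _)) hε.le

/-- The general estimate is used with widths `a / ε²` and `b / ε²` and thickness `ε B`. The product
`l √(a / π)` is then `B √(a / π)` for every `ε`. -/
theorem abs_layer_energy_sub_le (hf₂ : IsSurface f₂ K B) (hpos : ∀ x, 0 < f₁ x) {ε : ℝ} (hε : 0 < ε)
    {w : E2 → E3} {Du : E3 → E3}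
    (hDu : IsGradProj (layerField f₁ f₂ ε w) Du) {a b c : ℝ} (ha : 0 < a) (hab : a ≤ b)
    (hc : 0 < c) :
    |ε⁻¹ * (∫ x, ‖Du x‖ ^ 2) - ∫ s in a..b, heatWeight s * ∑ i, ∑ j, ∫ z, gaussHess s i j z *
        (ε⁻¹ * corr (layerField f₁ f₂ ε w) i j (ε • z))|
      ≤ (c + 1 / (2 * c) * (B * √(a / Real.pi))) *
          (ε⁻¹ * ∫ x, ‖layerField f₁ f₂ ε w x‖ ^ 2)
        + 1 / (2 * c) * ∫ z, normGauss b z *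
          (ε⁻¹ * shiftSq (layerField f₁ f₂ ε w) (ε • z)) := by
  have hB := hf₂.bound_nonneg
  have hmain := hDu.abs_energy_sub_le (a := (ε ^ 2)⁻¹ * a) (b := (ε ^ 2)⁻¹ * b) (l := ε * B)
    (by positivity) (by gcongr) (by positivity) hc (layerField_eq_zero hpos hf₂ hε _)
  rw [integral_heat_scale _ a b hε, integral_normGauss_scale _ b hε] at hmain
  have hl : ε * B * √((ε ^ 2)⁻¹ * a / Real.pi) = B * √(a / Real.pi) := by
    rw [mul_div_assoc, Real.sqrt_mul (by positivity), Real.sqrt_inv, Real.sqrt_sq hε.le]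
    field_simp
  rw [hl] at hmain
  have e1 : ∫ s in a..b, heatWeight s * ∑ i, ∑ j, ∫ z, gaussHess s i j z *
        (ε⁻¹ * corr (layerField f₁ f₂ ε w) i j (ε • z))
      = ε⁻¹ * ∫ s in a..b, heatWeight s * ∑ i, ∑ j, ∫ z, gaussHess s i j z *
        corr (layerField f₁ f₂ ε w) i j (ε • z) := by
    rw [← intervalIntegral.integral_const_mul]
    refine intervalIntegral.integral_congr fun s _ => ?_
    simp only [mul_left_comm _ ε⁻¹, integral_const_mul, ← Finset.mul_sum]
  have e2 : ∫ z, normGauss b z * (ε⁻¹ * shiftSq (layerField f₁ f₂ ε w) (ε • z))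
      = ε⁻¹ * ∫ z, normGauss b z * shiftSq (layerField f₁ f₂ ε w) (ε • z) := by
    rw [← integral_const_mul]
    simp only [mul_left_comm _ ε⁻¹]
  rw [e1, e2, ← mul_sub, abs_mul, abs_of_pos (inv_pos.2 hε)]
  refine (mul_le_mul_of_nonneg_left hmain (inv_pos.2 hε).le).trans_eq ?_
  ring

/-- As `δ → 0` the spreading gaussian contributes `√δ`, and the concentrating one evaluates at zero
a continuous function that vanishes there. Only the Young term `c E` survives. -/
theorem tendsto_limit_error (hf₁ : IsSurface f₁ K B) (hf₂ : IsSurface f₂ K B)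
    (hpos : ∀ x, 0 < f₁ x) (c T E : ℝ) :
    Tendsto (fun δ : ℝ => (c + 1 / (2 * c) * (B * √(δ / Real.pi))) * E
        + 1 / (2 * c) * ∫ z, normGauss ((δ ^ 2)⁻¹ * 1) z *
          (2 * T * (cellCorr f₁ f₂ 0 - cellCorr f₁ f₂ z))) (𝓝[>] 0) (𝓝 (c * E)) := by
  have hcc := continuous_cellCorr hf₁ hf₂ hpos
  have h1 := tendsto_integral_normGauss_mul
    (D := fun z => 2 * T * (cellCorr f₁ f₂ 0 - cellCorr f₁ f₂ z)) (by fun_prop)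
    (C := |2 * T| * (B + B)) fun z => by
      rw [abs_mul]
      refine mul_le_mul_of_nonneg_left ((abs_sub _ _).trans ?_) (abs_nonneg _)
      exact add_le_add (abs_cellCorr_le hf₂ hpos 0) (abs_cellCorr_le hf₂ hpos z)
  have h2 : Tendsto (fun δ : ℝ => (c + 1 / (2 * c) * (B * √(δ / Real.pi))) * E) (𝓝[>] 0)
      (𝓝 (c * E)) := by
    have hcont : Continuous fun δ : ℝ => (c + 1 / (2 * c) * (B * √(δ / Real.pi))) * E := by
      fun_prop
    have := hcont.tendsto 0
    simp only [zero_div, Real.sqrt_zero, mul_zero, add_zero] at this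
    exact this.mono_left nhdsWithin_le_nhds
  have h3 := h2.add (h1.const_mul (1 / (2 * c)))
  simpa only [sub_self, mul_zero, add_zero] using h3

theorem tendsto_limit_heat (hf₁ : IsSurface f₁ K B) (hf₂ : IsSurface f₂ K B)
    (hpos : ∀ x, 0 < f₁ x) (hlt : ∀ x, f₁ x < f₂ x) (m₀ : E2 → E3) :
    Tendsto (fun δ : ℝ => ∫ s in δ..((δ ^ 2)⁻¹ * 1), heatWeight s *
        ∑ i, ∑ j, ∫ z, gaussHess s i j z * (gram m₀ i j * cellCorr f₁ f₂ z)) (𝓝[>] 0)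
      (𝓝 (∑ i, ∑ j, gram m₀ i j * Ahom f₁ f₂ i j)) := by
  have hi := fun i j => integrableOn_heatWeight_cell hf₁ hf₂ hpos hlt i j
  have e : (fun s => heatWeight s *
        ∑ i, ∑ j, ∫ z, gaussHess s i j z * (gram m₀ i j * cellCorr f₁ f₂ z))
      = fun s => ∑ i, ∑ j, gram m₀ i j *
        (heatWeight s * ∫ z, gaussHess s i j z * cellCorr f₁ f₂ z) := by
    funext s
    simp only [mul_left_comm _ (gram m₀ _ _), integral_const_mul, Finset.mul_sum]
  have hij := fun i j => (hi i j).1.const_mul (gram m₀ i j)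
  have h := tendsto_intervalIntegral_Ioi (g := fun s => ∑ i, ∑ j, gram m₀ i j *
        (heatWeight s * ∫ z, gaussHess s i j z * cellCorr f₁ f₂ z))
    (integrable_finsetSum _ fun i _ => integrable_finsetSum _ fun j _ => hij i j)
  rw [integral_finsetSum _ fun i _ => integrable_finsetSum _ fun j _ => hij i j] at h
  simp only [integral_finsetSum _ fun j _ => hij _ j, integral_const_mul] at h
  rw [sum_mul_integral_cell hf₁ hf₂ hpos hlt (gram_comm m₀)] at h
  simpa only [e] using h

/-- The energies of a thin layer converge to the homogenized energy. -/
theorem tendsto_energy (h : BoundedConv m m₀) (hf₁ : IsSurface f₁ K B)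
    (hf₂ : IsSurface f₂ K B) (hpos : ∀ x, 0 < f₁ x) (hlt : ∀ x, f₁ x < f₂ x)
    {Du : ℝ → E3 → E3} (hDu : ∀ ε, 0 < ε → IsGradProj (layerField f₁ f₂ ε (m ε)) (Du ε)) :
    Tendsto (fun ε => ε⁻¹ * ∫ x, ‖Du ε x‖ ^ 2) (𝓝[>] 0)
      (𝓝 (∑ i, ∑ j, gram m₀ i j * Ahom f₁ f₂ i j)) := by
  refine tendsto_of_approx fun η hη => ?_
  set T := ∑ i, gram m₀ i i
  set E := T * cellCorr f₁ f₂ 0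
  -- This makes the surviving error `c E` smaller than `η`; adding one covers `E = 0`.
  set c := η / (2 * (|E| + 1))
  have hc : 0 < c := by positivity
  have hcE : c * E < η := by
    have h1 : c * E ≤ c * |E| := mul_le_mul_of_nonneg_left (le_abs_self E) hc.le
    have h2 : c * (2 * (|E| + 1)) = η := by simp only [c]; field_simp
    nlinarith [abs_nonneg E]
  have hsmall : ∀ᶠ δ : ℝ in 𝓝[>] 0, δ < 1 := mem_nhdsWithin_of_mem_nhds (Iio_mem_nhds one_pos)
  -- One `δ` is fixed for which the limiting error and the truncation of the width integral are both
  -- below `η`. Only then does `ε` tend to zero.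
  have hev := (((tendsto_order.1 (tendsto_limit_error hf₁ hf₂ hpos c T E)).2 η hcE).and
    (Metric.tendsto_nhds.1 (tendsto_limit_heat hf₁ hf₂ hpos hlt m₀) η hη)).and
    (hsmall.and self_mem_nhdsWithin)
  obtain ⟨δ, ⟨hR, hI⟩, hδ1, hδ⟩ := hev.exists
  have hδ0 : (0 : ℝ) < δ := hδ
  have hab : δ ≤ (δ ^ 2)⁻¹ * 1 := by
    rw [mul_one]
    refine hδ1.le.trans ((one_le_inv₀ (by positivity)).2 ?_)
    exact pow_le_one₀ hδ0.le hδ1.le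
  refine ⟨_, _, _, _, h.tendsto_heat hf₁ hf₂ hpos hδ0 hab,
    ((h.tendsto_norm_sq hf₁ hf₂ hpos).const_mul (c + 1 / (2 * c) * (B * √(δ / Real.pi)))).add
      ((h.tendsto_integral_shiftSq hf₁ hf₂ hpos (hδ0.trans_le hab)).const_mul (1 / (2 * c))),
    ?_, by rwa [Real.dist_eq] at hI, hR⟩
  filter_upwards [self_mem_nhdsWithin] with ε hε
  exact abs_layer_energy_sub_le hf₂ hpos hε (hDu ε hε) hδ0 hab hc

end BoundedConv

/-! ### Reduction to bounded fields on the whole plane -/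

/-- The extension by zero of a field from `ω`, cut off where its norm exceeds one. -/
def clampField (ω : Set E2) (m : E2 → E3) : E2 → E3 :=
  open scoped Classical in ω.indicator fun x => if ‖m x‖ ≤ 1 then m x else 0

theorem norm_clampField_le (ω : Set E2) (m : E2 → E3) (x : E2) : ‖clampField ω m x‖ ≤ 1 := by
  unfold clampField
  by_cases hx : x ∈ ω
  · rw [Set.indicator_of_mem hx]
    split_ifs with h
    · exact h
    · simp
  · rw [Set.indicator_of_notMem hx]; simp

section Clamp

variable {ω : Set E2} {m : E2 → E3}

theorem clampField_ae_eq (hω : MeasurableSet ω)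
    (hm : ∀ᵐ x ∂(volume.restrict ω), ‖m x‖ ≤ 1) : clampField ω m =ᵐ[volume] ω.indicator m := by
  rw [ae_restrict_iff' hω] at hm
  filter_upwards [hm] with x hx
  unfold clampField
  by_cases h : x ∈ ω
  · rw [Set.indicator_of_mem h, Set.indicator_of_mem h, if_pos (hx h)]
  · rw [Set.indicator_of_notMem h, Set.indicator_of_notMem h]

theorem integrable_clampField (hω : MeasurableSet ω)
    (hm : ∀ᵐ x ∂(volume.restrict ω), ‖m x‖ ≤ 1) (hi : Integrable m (volume.restrict ω)) :
    Integrable (clampField ω m) :=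
  ((integrable_indicator_iff hω).2 hi).congr (clampField_ae_eq hω hm).symm

theorem measurableSet_film (hω : MeasurableSet ω) {f₁ f₂ : E2 → ℝ} (h₁ : Continuous f₁)
    (h₂ : Continuous f₂) (ε : ℝ) : MeasurableSet (film ω f₁ f₂ ε) := by
  have h := (continuous_horiz.measurable hω).inter (measurableSet_film_univ h₁ h₂ ε)
  convert h using 1
  ext x
  simp [film]

/-- The clamp changes the field on a null set of the plane, whose preimage under `horiz` is null in
space. -/
theorem layerField_clampField_ae_eq (hω : MeasurableSet ω)
    (hm : ∀ᵐ x ∂(volume.restrict ω), ‖m x‖ ≤ 1) (f₁ f₂ : E2 → ℝ) (ε : ℝ) :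
    layerField f₁ f₂ ε (clampField ω m)
      =ᵐ[volume] (film ω f₁ f₂ ε).indicator fun x => m (horiz x) := by
  filter_upwards [quasiMeasurePreserving_horiz.ae (clampField_ae_eq hω hm)] with x hx
  unfold layerField
  by_cases h : x ∈ film Set.univ f₁ f₂ ε
  · rw [Set.indicator_of_mem h, hx]
    by_cases h2 : horiz x ∈ ω
    · rw [Set.indicator_of_mem h2, Set.indicator_of_mem (show x ∈ film ω f₁ f₂ ε from ⟨h2, h.2⟩)]
    · rw [Set.indicator_of_notMem h2, Set.indicator_of_notMem fun h3 => h2 h3.1]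
  · rw [Set.indicator_of_notMem h, Set.indicator_of_notMem fun h3 => h ⟨trivial, h3.2⟩]

/-- The energy depends only on the gradient, so only the gradient part of the approximation is kept,
and the film integral becomes an integral of the extended field over all of space. -/
theorem SolvesMagnetostatic.isGradProj (hω : MeasurableSet ω)
    (hm : ∀ᵐ x ∂(volume.restrict ω), ‖m x‖ ≤ 1) {f₁ f₂ : E2 → ℝ} (h₁ : Continuous f₁)
    (h₂ : Continuous f₂) {ε : ℝ} {u : E3 → ℝ} {Du : E3 → E3}
    (hF : MemLp (layerField f₁ f₂ ε (clampField ω m)) 2)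
    (hu : SolvesMagnetostatic (film ω f₁ f₂ ε) (fun x => m (horiz x)) u Du) :
    IsGradProj (layerField f₁ f₂ ε (clampField ω m)) Du where
  memLp_field := hF
  memLp_grad := hu.isHomH1.memLp_grad
  approx := by
    obtain ⟨φ, h1, _, h3⟩ := hu.isHomH1.approx
    exact ⟨φ, h1, h3⟩
  equation φ hφ := by
    rw [hu.equation φ hφ, ← integral_indicator (measurableSet_film hω h₁ h₂ ε)]
    refine integral_congr_ae ?_
    filter_upwards [layerField_clampField_ae_eq hω hm f₁ f₂ ε] with x hx
    rw [hx]
    by_cases h : x ∈ film ω f₁ f₂ ε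
    · rw [Set.indicator_of_mem h, Set.indicator_of_mem h]
    · rw [Set.indicator_of_notMem h, Set.indicator_of_notMem h, inner_zero_left]

theorem gram_clampField (hω : MeasurableSet ω)
    (hm : ∀ᵐ x ∂(volume.restrict ω), ‖m x‖ ≤ 1) (i j : Fin 3) :
    gram (clampField ω m) i j = ∫ x in ω, m x i * m x j := by
  rw [gram, ← integral_indicator hω]
  refine integral_congr_ae ?_
  filter_upwards [clampField_ae_eq hω hm] with x hx
  rw [hx]
  by_cases h : x ∈ ω
  · rw [Set.indicator_of_mem h, Set.indicator_of_mem h]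
  · rw [Set.indicator_of_notMem h, Set.indicator_of_notMem h]; simp

theorem integral_quadraticForm (hm : MemLp m 2 (volume.restrict ω))
    (A : Matrix (Fin 3) (Fin 3) ℝ) :
    ∫ x in ω, A.mulVec (m x) ⬝ᵥ (m x) = ∑ i, ∑ j, (∫ x in ω, m x i * m x j) * A i j := by
  have hi : ∀ i j, Integrable (fun x => m x i * m x j * A i j) (volume.restrict ω) := fun i j =>
    ((memLp_coord hm i).integrable_mul (memLp_coord hm j)).mul_const _
  simp only [← integral_mul_const]
  simp only [← integral_finsetSum _ fun j _ => hi _ j]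
  rw [← integral_finsetSum _ fun i _ => integrable_finsetSum _ fun j _ => hi i j]
  refine integral_congr_ae (Eventually.of_forall fun x => ?_)
  simp only [dotProduct, Matrix.mulVec, Finset.sum_mul]
  exact Finset.sum_congr rfl fun i _ => Finset.sum_congr rfl fun j _ => by ring

end Clamp

theorem WeakConvH1.boundedConv {ω : Set E2} (hω : MeasurableSet ω)
    [IsFiniteMeasure (volume.restrict ω)] {M : ℝ → E2 → E3} {DM : ℝ → Fin 2 → E2 → E3}
    {m₀ : E2 → E3} {Dm₀ : Fin 2 → E2 → E3} (hw : WeakConvH1 ω M DM m₀ Dm₀)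
    (hM : ∀ ε : ℝ, 0 < ε → IsH1 ω (M ε) (DM ε)) (hm₀ : IsH1 ω m₀ Dm₀)
    (hle : ∀ ε : ℝ, 0 < ε → ∀ᵐ x ∂(volume.restrict ω), ‖M ε x‖ ≤ 1)
    (hsph : ∀ᵐ x ∂(volume.restrict ω), ‖m₀ x‖ = 1) :
    BoundedConv (fun ε => clampField ω (M ε)) (clampField ω m₀) where
  integrable ε hε := integrable_clampField hω (hle ε hε) ((hM ε hε).memLp.integrable one_le_two)
  integrable_lim := integrable_clampField hω (hsph.mono fun _ h => h.le)
    (hm₀.memLp.integrable one_le_two)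
  norm_le ε x := norm_clampField_le _ _ _
  norm_lim_le x := norm_clampField_le _ _ _
  tendsto := by
    refine (hw.tendsto_integral_norm_sub hM hm₀ hle hsph).congr' ?_
    filter_upwards [self_mem_nhdsWithin] with ε hε
    rw [← integral_indicator hω]
    refine integral_congr_ae ?_
    filter_upwards [clampField_ae_eq hω (hle ε hε),
      clampField_ae_eq hω (hsph.mono fun _ h => h.le)] with x h1 h2
    rw [h1, h2]
    by_cases h : x ∈ ω
    · simp only [Set.indicator_of_mem h]
    · simp only [Set.indicator_of_notMem h, sub_zero, norm_zero]

end ThinFilm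

end

/-! ### The homogenization theorem -/

theorem proposition3p12
    (f₁ f₂ : ThinFilm.E2 → ℝ)
    (hf₁_lip : ∃ K, LipschitzWith K f₁) (hf₂_lip : ∃ K, LipschitzWith K f₂)
    (hf₁_per : ThinFilm.QPeriodic f₁) (hf₂_per : ThinFilm.QPeriodic f₂)
    (hf₁_pos : ∀ x, 0 < f₁ x) (hf₁₂ : ∀ x, f₁ x < f₂ x)
    (ω : Set ThinFilm.E2) (hω_open : IsOpen ω) (hω_bdd : Bornology.IsBounded ω)
    (hω_lip : ThinFilm.HasLipschitzBoundary ω)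
    (m₀ : ThinFilm.E2 → ThinFilm.E3) (Dm₀ : Fin 2 → ThinFilm.E2 → ThinFilm.E3)
    (hm₀ : ThinFilm.IsH1 ω m₀ Dm₀)
    (hm₀_sphere : ∀ᵐ x ∂(MeasureTheory.volume.restrict ω), ‖m₀ x‖ = 1)
    (M : ℝ → ThinFilm.E2 → ThinFilm.E3) (DM : ℝ → Fin 2 → ThinFilm.E2 → ThinFilm.E3)
    (hM : ∀ ε : ℝ, 0 < ε → ThinFilm.IsH1 ω (M ε) (DM ε))
    (hM_ball : ∀ ε : ℝ, 0 < ε → ∀ᵐ x ∂(MeasureTheory.volume.restrict ω), ‖M ε x‖ ≤ 1)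
    (hM_weak : ThinFilm.WeakConvH1 ω M DM m₀ Dm₀)
    (u : ℝ → ThinFilm.E3 → ℝ) (Du : ℝ → ThinFilm.E3 → ThinFilm.E3)
    (hu : ∀ ε : ℝ, 0 < ε → ThinFilm.SolvesMagnetostatic (ThinFilm.film ω f₁ f₂ ε)
      (fun x => M ε (ThinFilm.horiz x)) (u ε) (Du ε)) :
    Filter.Tendsto (fun ε : ℝ => (1 / ε) * ∫ x : ThinFilm.E3, ‖Du ε x‖ ^ 2)
      (nhdsWithin 0 (Set.Ioi 0))
      (nhds (∫ x in ω,
        Matrix.mulVec (ThinFilm.Ahom f₁ f₂) (m₀ x) ⬝ᵥ (m₀ x))) := by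
  obtain ⟨K₁, hK₁⟩ := hf₁_lip
  obtain ⟨K₂, hK₂⟩ := hf₂_lip
  obtain ⟨B₁, _, hB₁⟩ := hf₁_per.exists_bound hK₁.continuous
  obtain ⟨B₂, _, hB₂⟩ := hf₂_per.exists_bound hK₂.continuous
  -- Both surfaces are given the same constants, as the estimates for pairs of surfaces require.
  have hs₁ : ThinFilm.IsSurface f₁ (max K₁ K₂) (max B₁ B₂) :=
    ⟨hK₁.weaken (le_max_left _ _), hf₁_per, fun x => (hB₁ x).trans (le_max_left _ _)⟩
  have hs₂ : ThinFilm.IsSurface f₂ (max K₁ K₂) (max B₁ B₂) :=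
    ⟨hK₂.weaken (le_max_right _ _), hf₂_per, fun x => (hB₂ x).trans (le_max_right _ _)⟩
  have hω := hω_open.measurableSet
  have : MeasureTheory.IsFiniteMeasure (MeasureTheory.volume.restrict ω) :=
    ⟨by simpa using hω_bdd.measure_lt_top⟩
  have hconv := hM_weak.boundedConv hω hM hm₀ hM_ball hm₀_sphere
  have h := hconv.tendsto_energy hs₁ hs₂ hf₁_pos hf₁₂ (Du := Du) fun ε hε =>
    (hu ε hε).isGradProj hω (hM_ball ε hε) hK₁.continuous hK₂.continuous
      (hconv.memLp_layer hs₁ hs₂ hf₁_pos hε)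
  simp only [ThinFilm.gram_clampField hω (hm₀_sphere.mono fun _ h => h.le)] at h
  rw [ThinFilm.integral_quadraticForm hm₀.memLp]
  simpa only [one_div] using h
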